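/- **Setting.** Let $d\in\{1,2\}$, let $G^d=\mathbb Z^d\dashv\mathbb Z$ be the comb graph on $\mathbb Z^d\times\mathbb Z$ (in which $(\vec\jmath,j)\sim(\vec k,k)$ iff $\vec\jmath=\vec k$ and $|j-k|=1$, or $j=k=0$ and $\vec\jmath\sim\vec k$ in the lattice $\mathbb Z^d$), and let $A$ be its adjacency operator on $\ell^2(\mathbb Z^d\times\mathbb Z)$. Let $\Lambda_n=(\mathbb Z_{2n+1})^d\dashv[-n,n]$ be the finite comb with periodic boundary conditions on the base and a chain $[-n,n]$ as fibre (for $n=0$ it is a single vertex without edges). It is identified with a graph on $[-n,n]^d\times[-n,n]\subset\mathbb Z^d\times\mathbb Z$, and its adjacency operator $A_{\Lambda_n}$ is extended by $0$ to $\ell^2(\mathbb Z^d\times\mathbb Z)$. Inner products are conjugate-linear in the first variable. Fix $\beta>0$ and chemical potentials $\mu_n<0$ with $\mu_n\to0$, put $H_n=(\|A\|-\mu_n)I-A_{\Lambda_n}$, and let $\omega_n$ be the finite volume Gibbs state, i.e. the gauge-invariant quasi-free state with $$\omega_n(a^+(\xi)a(\eta))=\langle\eta,(e^{\beta H_n}-I)^{-1}\xi\rangle,\qquad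 \omega_n(W(f))=\exp\bigl(-\tfrac14\|f\|^2-\tfrac12\,\omega_n(a^+(f)a(f))\bigr).$$ Let $\mathcal S_0$ be the space of all $\xi\in\ell^2(\mathbb Z^d\times\mathbb Z)$ for which the norms $\|\xi_{\vec\jmath}\|$ of the restrictions of $\xi$ to the fibres are rapidly decreasing in $\vec\jmath\in\mathbb Z^d$. Let $v=u\otimes w$, where $u\equiv1$ on $\mathbb Z^d$ and $w=\|R_{\mathbb Z}(\|A\|)\delta_0\|^{-1}R_{\mathbb Z}(\|A\|)\delta_0\in\ell^2(\mathbb Z)$, with $R_{\mathbb Z}(\lambda)=(\lambda-A_{\mathbb Z})^{-1}$ and $A_{\mathbb Z}$ the adjacency operator of the line $\mathbb Z$. **Theorem.** 1. The vector $v$ is a generalized Perron–Frobenius vector of $G^d$: its entries are strictly positive and $Av=\|A\|v$ entrywise. 2. There are real numbers $k'_n\to+\infty$, vectors $v_n=u_n\otimes w_n$ supported in $\Lambda_n$, with $u_n$ the indicator function of $[-n,n]^d$ and $w_n\in\ell^2(\mathbb Z)$ supported in $[-n,n]$, and sesquilinear forms $C_n$ on $\mathcal S_0$, all independent of $\xi,\eta$,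 such that for all $n$ and all $\xi,\eta\in\mathcal S_0$ $$\omega_n(a^+(\xi)a(\eta))=k'_n\,\langle\eta,v_n\rangle\langle v_n,\xi\rangle+C_n(\eta,\xi).$$ Here $w_n\to w$ in norm (so $v_n\to v$ pointwise); for every $\eta\in\mathcal S_0$ the series $\langle v,\eta\rangle$ converges absolutely and $\langle v_n,\eta\rangle\to\langle v,\eta\rangle$; and $C_n(\eta,\xi)\to C(\eta,\xi)$ for all $\xi,\eta\in\mathcal S_0$, with $C$ a sesquilinear form on $\mathcal S_0$. 3. Consequently no locally normal state describing Bose–Einstein condensation exists: if $\varphi$ is a state on the C$^*$-algebra $\mathrm{CCR}(\mathcal S_0)$ generated by the Weyl operators $W(f)$, $f\in\mathcal S_0$, and $\varphi(W(f))=\lim_n\omega_n(W(f))$ for all finitely supported $f\in\mathcal S_0$, then $\varphi$ is not locally normal. (A state is locally normal if for every finite set $\Lambda$ of vertices its GNS representation, restricted to $\mathrm{CCR}(\ell^2(\Lambda))$, is quasi-equivalent to the Fock representation, i.e. both have the same normal states.) -/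

import Mathlib

noncomputable section
namespace CombBEC
open Complex ComplexConjugate Filter Topology
open scoped InnerProductSpace ComplexOrder

section Fock
variable (E : Type) [NormedAddCommGroup E] [InnerProductSpace ℂ E]

variable {E} in
/-- Overlap `⟪W(f)Ω, W(g)Ω⟫ = exp (⟪f, g⟫ / 2 - ‖f‖² / 4 - ‖g‖² / 4)` of two coherent vectors of the
symmetric Fock space over (the completion of) `E`. -/
def vacuumKernel (f g : E) : ℂ :=
  Complex.exp (⟪f, g⟫_ℂ / 2 - (‖f‖ ^ 2 / 4 : ℝ) - (‖g‖ ^ 2 / 4 : ℝ))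

theorem posSemidef_innerKernel {K : Type} [NormedAddCommGroup K] [InnerProductSpace ℂ K]
    {ι : Type} (v : ι → K) : (Matrix.of fun f g : ι => ⟪v f, v g⟫_ℂ).PosSemidef := by
  refine ⟨?_, fun x => ?_⟩
  · ext f g
    simp [Matrix.conjTranspose_apply]
  · have h : (x.sum fun f c => x.sum fun g c' =>
        star c * (Matrix.of fun f g : ι => ⟪v f, v g⟫_ℂ) f g * c') =
        ⟪x.sum fun f c => c • v f, x.sum fun f c => c • v f⟫_ℂ := by
      simp only [Finsupp.sum, sum_inner, Matrix.of_apply, Complex.star_def]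
      refine Finset.sum_congr rfl fun f _ => ?_
      rw [inner_sum]
      refine Finset.sum_congr rfl fun g _ => ?_
      rw [inner_smul_left, inner_smul_right]
      ring
    rw [h, inner_self_eq_norm_sq_to_K]
    positivity

theorem posSemidef_expInner :
    (Matrix.of fun f g : E => Complex.exp (⟪f, g⟫_ℂ / 2)).PosSemidef := by
  have hpow : ∀ k : ℕ, (Matrix.of fun f g : E => ⟪f, g⟫_ℂ ^ k).PosSemidef := by
    intro k
    induction k with
    | zero =>
      have e : (Matrix.of fun f g : E => ⟪f, g⟫_ℂ ^ 0) =
          Matrix.of fun _ _ : E => ⟪(1 : ℂ), (1 : ℂ)⟫_ℂ := by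
        ext f g; simp
      rw [e]
      exact posSemidef_innerKernel (fun _ : E => (1 : ℂ))
    | succ k ih =>
      have e : (Matrix.of fun f g : E => ⟪f, g⟫_ℂ ^ (k + 1)) =
          (Matrix.of fun f g : E => ⟪f, g⟫_ℂ ^ k).hadamard
            (Matrix.of fun f g : E => ⟪f, g⟫_ℂ) := by
        ext f g; simp [pow_succ]
      rw [e]
      exact ih.hadamard (posSemidef_innerKernel (fun f : E => f))
  refine ⟨?_, fun x => ?_⟩
  · ext f g
    simp [Matrix.conjTranspose_apply, ← Complex.exp_conj, Complex.conj_ofNat]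
  · have hs : HasSum (fun k : ℕ => (((2 : ℝ) ^ k * k.factorial)⁻¹ : ℝ) *
        x.sum fun f c => x.sum fun g c' =>
          star c * (Matrix.of fun f g : E => ⟪f, g⟫_ℂ ^ k) f g * c')
        (x.sum fun f c => x.sum fun g c' =>
          star c * (Matrix.of fun f g : E => Complex.exp (⟪f, g⟫_ℂ / 2)) f g * c') := by
      simp only [Finsupp.sum, Finset.mul_sum]
      refine hasSum_sum fun f _ => hasSum_sum fun g _ => ?_
      have h := NormedSpace.expSeries_div_hasSum_exp (𝔸 := ℂ) (⟪f, g⟫_ℂ / 2)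
      rw [← Complex.exp_eq_exp_ℂ] at h
      have h2 := (h.mul_left (star (x f))).mul_right (x g)
      refine h2.congr_fun ?_
      intro k
      simp only [Matrix.of_apply]
      push_cast
      rw [div_pow]
      field_simp
    refine hs.nonneg fun k => mul_nonneg ?_ ((hpow k).2 x)
    exact Complex.zero_le_real.mpr (by positivity)

theorem posSemidef_vacuumKernel : (Matrix.of fun f g : E => vacuumKernel f g).PosSemidef := by
  have e : (Matrix.of fun f g : E => vacuumKernel f g) =
      (Matrix.of fun f g : E => Complex.exp (⟪f, g⟫_ℂ / 2)).hadamard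
        (Matrix.of fun f g : E => ⟪(Real.exp (-(‖f‖ ^ 2 / 4)) : ℂ),
          (Real.exp (-(‖g‖ ^ 2 / 4)) : ℂ)⟫_ℂ) := by
    ext f g
    simp only [Matrix.of_apply, vacuumKernel, Matrix.hadamard_apply,
      RCLike.inner_apply, Complex.conj_ofReal]
    rw [Complex.ofReal_exp, Complex.ofReal_exp]
    rw [← Complex.exp_add, ← Complex.exp_add]
    congr 1
    push_cast
    ring
  rw [e]
  exact (posSemidef_expInner E).hadamard
    (posSemidef_innerKernel fun f : E => (Real.exp (-(‖f‖ ^ 2 / 4)) : ℂ))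

/-- Finite linear combinations of the coherent vectors `W(f)Ω`, `f : E`. -/
def PreFock : Type := E →₀ ℂ

instance : AddCommGroup (PreFock E) := inferInstanceAs (AddCommGroup (E →₀ ℂ))
instance : Module ℂ (PreFock E) := inferInstanceAs (Module ℂ (E →₀ ℂ))

/-- The coefficients of a finite linear combination of coherent vectors. -/
def preFockCoeff : PreFock E ≃ₗ[ℂ] (E →₀ ℂ) := LinearEquiv.refl ℂ _

/-- The inner product determined by the overlaps of the coherent vectors. -/
abbrev preFockCore : PreInnerProductSpace.Core ℂ (PreFock E) where
  inner x y := (preFockCoeff E x).sum fun f c => (preFockCoeff E y).sum fun g c' =>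
    star c * vacuumKernel f g * c'
  conj_inner_symm x y := by
    rw [Finsupp.sum_comm]
    simp only [map_finsuppSum, map_mul, Complex.star_def, Complex.conj_conj]
    refine Finset.sum_congr rfl fun f _ => Finset.sum_congr rfl fun g _ => ?_
    have h := congrFun (congrFun (posSemidef_vacuumKernel E).1 f) g
    simp only [Matrix.conjTranspose_apply, Matrix.of_apply, Complex.star_def] at h
    beta_reduce
    rw [h]
    ring
  re_inner_nonneg x :=
    (Complex.nonneg_iff.mp ((posSemidef_vacuumKernel E).2 (preFockCoeff E x))).1
  add_left x y z := by
    rw [map_add, Finsupp.sum_add_index'] <;> simp [← Finsupp.sum_add, add_mul]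
  smul_left x y r := by
    rw [map_smul, Finsupp.sum_smul_index] <;> simp [Finsupp.mul_sum, mul_assoc]

instance : SeminormedAddCommGroup (PreFock E) :=
  InnerProductSpace.Core.toSeminormedAddCommGroup (c := preFockCore E)
instance : InnerProductSpace ℂ (PreFock E) := InnerProductSpace.ofCore (preFockCore E)

/-- The symmetric Fock space over (the completion of) `E`, as the completed span of the coherent
vectors. -/
abbrev Fock : Type := UniformSpace.Completion (PreFock E)

variable {E}

/-- The coherent vector `W(f)Ω`. -/
def preCoherent (f : E) : PreFock E := (preFockCoeff E).symm (Finsupp.single f 1)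

/-- The coherent vector `W(f)Ω`; the vacuum `Ω` is `coherent 0`. -/
def coherent (f : E) : Fock E := ((preCoherent f : PreFock E) : Fock E)

theorem inner_preFock (x y : PreFock E) : ⟪x, y⟫_ℂ =
    (preFockCoeff E x).sum fun f c => (preFockCoeff E y).sum fun g c' =>
      star c * vacuumKernel f g * c' := rfl

theorem inner_preCoherent (f g : E) : ⟪preCoherent f, preCoherent g⟫_ℂ = vacuumKernel f g := by
  rw [inner_preFock]
  simp [preCoherent]

theorem inner_coherent (f g : E) : ⟪coherent f, coherent g⟫_ℂ = vacuumKernel f g := by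
  rw [coherent, coherent, UniformSpace.Completion.inner_coe, inner_preCoherent]

/-- The phase in `W(h) W(f)Ω = exp (-i Im ⟪h, f⟫ / 2) W(h + f)Ω`. -/
def weylPhase (h f : E) : ℂ := Complex.exp (-(Complex.I * ((⟪h, f⟫_ℂ).im / 2 : ℝ)))

theorem vacuumKernel_translate (h f g : E) :
    conj (weylPhase h f) * vacuumKernel (h + f) (h + g) * weylPhase h g = vacuumKernel f g := by
  simp only [weylPhase, vacuumKernel, ← Complex.exp_conj]
  rw [← Complex.exp_add, ← Complex.exp_add]
  congr 1
  have e1 : ((‖h + f‖ ^ 2 : ℝ) : ℂ) = ‖h‖ ^ 2 + 2 * ((⟪h, f⟫_ℂ).re : ℂ) + ‖f‖ ^ 2 := by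
    rw [norm_add_sq (𝕜 := ℂ)]; push_cast; simp
  have e2 : ((‖h + g‖ ^ 2 : ℝ) : ℂ) = ‖h‖ ^ 2 + 2 * ((⟪h, g⟫_ℂ).re : ℂ) + ‖g‖ ^ 2 := by
    rw [norm_add_sq (𝕜 := ℂ)]; push_cast; simp
  have e3 : ⟪h, h⟫_ℂ = (‖h‖ : ℂ) ^ 2 := inner_self_eq_norm_sq_to_K h
  have e4 : ⟪f, h⟫_ℂ = conj ⟪h, f⟫_ℂ := (inner_conj_symm f h).symm
  simp only [Complex.ofReal_div]
  rw [e1, e2, inner_add_left, inner_add_right, inner_add_right, e3, e4]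
  simp only [map_neg, map_mul, Complex.conj_I, map_div₀, Complex.conj_ofReal]
  have e6 := Complex.re_add_im ⟪h, g⟫_ℂ
  have e7 : ∀ z : ℂ, conj z = z.re - z.im * Complex.I := fun z => by
    apply Complex.ext <;> simp
  rw [e7 ⟪h, f⟫_ℂ]
  generalize (⟪h, f⟫_ℂ).re = a at *
  generalize (⟪h, f⟫_ℂ).im = b at *
  generalize (⟪h, g⟫_ℂ).re = c at *
  generalize (⟪h, g⟫_ℂ).im = d at *
  rw [← e6]
  push_cast
  ring

/-- The Weyl operator `W(h)` on finite linear combinations of coherent vectors. -/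
def preWeyl (h : E) : PreFock E →ₗ[ℂ] PreFock E :=
  (Finsupp.linearCombination ℂ fun f => weylPhase h f • preCoherent (h + f)) ∘ₗ
    (preFockCoeff E).toLinearMap

theorem preWeyl_preCoherent (h f : E) :
    preWeyl h (preCoherent f) = weylPhase h f • preCoherent (h + f) := by
  simp [preWeyl, preCoherent]

theorem inner_preWeyl (h : E) (x y : PreFock E) : ⟪preWeyl h x, preWeyl h y⟫_ℂ = ⟪x, y⟫_ℂ := by
  have e : ∀ z : PreFock E, preWeyl h z =
      ∑ f ∈ (preFockCoeff E z).support,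
        preFockCoeff E z f • (weylPhase h f • preCoherent (h + f)) := fun z => rfl
  rw [e x, e y, inner_preFock x y]
  rw [sum_inner, Finsupp.sum]
  refine Finset.sum_congr rfl fun f _ => ?_
  rw [inner_sum, Finsupp.sum]
  refine Finset.sum_congr rfl fun g _ => ?_
  simp only [inner_smul_left, inner_smul_right, inner_preCoherent]
  rw [← vacuumKernel_translate h f g, Complex.star_def]
  ring

/-- The Weyl operator `W(h)` of the Fock representation. -/
def weyl (h : E) : Fock E →L[ℂ] Fock E :=
  ContinuousLinearMap.completion
    ((preWeyl h).isometryOfInner (inner_preWeyl h)).toContinuousLinearMap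

theorem weyl_coherent (h f : E) : weyl h (coherent f) = weylPhase h f • coherent (h + f) := by
  have : weyl h (coherent f) = ((preWeyl h (preCoherent f) : PreFock E) : Fock E) := by
    simp [weyl, coherent]
  rw [this, preWeyl_preCoherent, UniformSpace.Completion.coe_smul]
  rfl

variable (E) in
/-- The C⋆-algebra of operators generated by the Weyl operators. -/
def ccrSubalgebra : StarSubalgebra ℂ (Fock E →L[ℂ] Fock E) :=
  (StarAlgebra.adjoin ℂ (Set.range (weyl (E := E)))).topologicalClosure

variable (E) in
/-- The CCR algebra over the pre-Hilbert space `E`. -/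
def CCR : Type := ccrSubalgebra E

instance : CStarAlgebra (CCR E) :=
  have : IsClosed (ccrSubalgebra E : Set (Fock E →L[ℂ] Fock E)) :=
    StarSubalgebra.isClosed_topologicalClosure _
  inferInstanceAs (CStarAlgebra (ccrSubalgebra E))

instance : PartialOrder (CCR E) := CStarAlgebra.spectralOrder _
instance : StarOrderedRing (CCR E) := CStarAlgebra.spectralOrderedRing _

/-- The Weyl operator `W(f)` as an element of the CCR algebra. -/
def ccrWeyl (f : E) : CCR E :=
  ⟨weyl f, StarSubalgebra.le_topologicalClosure _ (StarAlgebra.subset_adjoin ℂ _ ⟨f, rfl⟩)⟩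

variable (E) in
/-- The Fock representation of the CCR algebra. -/
def fockRep : CCR E →⋆ₐ[ℂ] (Fock E →L[ℂ] Fock E) := (ccrSubalgebra E).subtype

/-- The C⋆-subalgebra of the CCR algebra that is generated by the `W(f)` with `f ∈ M`. -/
def localCCR (M : Submodule ℂ E) : StarSubalgebra ℂ (CCR E) :=
  (StarAlgebra.adjoin ℂ (ccrWeyl '' (M : Set E))).topologicalClosure

/-- The Fock space over `M` inside the Fock space over `E`. -/
def localFock (M : Submodule ℂ E) : Submodule ℂ (Fock E) :=
  (Submodule.span ℂ (coherent '' (M : Set E))).topologicalClosure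

/-- The states `a ↦ ∑ₙ ⟪ξₙ, π(a) ξₙ⟫` of a `⋆`-algebra that are given by density matrices on the
subrepresentation of `π` on the closed invariant subspace `L`. -/
def normalStates {A K : Type} [Semiring A] [Algebra ℂ A] [StarRing A] [NormedAddCommGroup K]
    [InnerProductSpace ℂ K] [CompleteSpace K] (π : A →⋆ₐ[ℂ] (K →L[ℂ] K)) (L : Submodule ℂ K) :
    Set (A → ℂ) :=
  {ψ | ∃ ξ : ℕ → K, (∀ n, ξ n ∈ L) ∧ HasSum (fun n => ‖ξ n‖ ^ 2) 1 ∧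
    ∀ a, HasSum (fun n => ⟪ξ n, π a (ξ n)⟫_ℂ) (ψ a)}

/-- The GNS representation of `φ`, restricted to the subalgebra over `M`, is quasi-equivalent to
the Fock representation of that subalgebra, i.e. the two have the same normal states. -/
def IsFockNormalOn (φ : CCR E →ₚ[ℂ] ℂ) (M : Submodule ℂ E) : Prop :=
  normalStates (φ.gnsStarAlgHom.comp (localCCR M).subtype) ⊤ =
    normalStates ((fockRep E).comp (localCCR M).subtype) (localFock M)

end Fock
section Graphs

/-- The Hilbert space `ℓ²(V)`. -/
abbrev L2 (V : Type) : Type := lp (fun _ : V => ℂ) 2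

/-- The degrees of the vertices of `G` are bounded. -/
class BoundedDegree {V : Type} (G : SimpleGraph V) : Prop where
  exists_bound : ∃ D : ℕ, ∀ v, (G.neighborSet v).Finite ∧ (G.neighborSet v).ncard ≤ D

theorem BoundedDegree.of_finset {V : Type} (G : SimpleGraph V) (D : ℕ) (N : V → Finset V)
    (hN : ∀ v w, G.Adj v w → w ∈ N v) (hD : ∀ v, (N v).card ≤ D) : BoundedDegree G := by
  refine ⟨D, fun v => ?_⟩
  have hsub : G.neighborSet v ⊆ (N v : Set V) := fun w hw => hN v w hw
  refine ⟨(N v).finite_toSet.subset hsub, ?_⟩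
  calc (G.neighborSet v).ncard ≤ (N v : Set V).ncard :=
        Set.ncard_le_ncard hsub (N v).finite_toSet
    _ = (N v).card := Set.ncard_coe_finset _
    _ ≤ D := hD v

variable {V : Type} (G : SimpleGraph V) [hG : BoundedDegree G]

/-- The finite set of the neighbours of a vertex. -/
def nbrs (v : V) : Finset V := (hG.exists_bound.choose_spec v).1.toFinset

theorem mem_nbrs {v w : V} : w ∈ nbrs G v ↔ G.Adj v w := by
  simp [nbrs]

theorem card_nbrs (v : V) : (nbrs G v).card ≤ hG.exists_bound.choose := by
  rw [nbrs, ← Set.ncard_eq_toFinset_card _ (hG.exists_bound.choose_spec v).1]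
  exact (hG.exists_bound.choose_spec v).2

theorem sum_nbrs_le (f : L2 V) (s : Finset V) :
    ∑ v ∈ s, ‖∑ w ∈ nbrs G v, f w‖ ^ 2 ≤ ((hG.exists_bound.choose : ℝ) * ‖f‖) ^ 2 := by
  classical
  set D := hG.exists_bound.choose with hD
  have hf : ∀ t : Finset V, ∑ w ∈ t, ‖f w‖ ^ 2 ≤ ‖f‖ ^ 2 := by
    intro t
    have h := lp.sum_rpow_le_norm_rpow (p := 2) (by norm_num) f t
    simpa using h
  have h1 : ∀ v ∈ s, ‖∑ w ∈ nbrs G v, f w‖ ^ 2 ≤ D * ∑ w ∈ nbrs G v, ‖f w‖ ^ 2 := by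
    intro v _
    calc ‖∑ w ∈ nbrs G v, f w‖ ^ 2 ≤ (∑ w ∈ nbrs G v, ‖f w‖) ^ 2 := by
          gcongr; exact norm_sum_le _ _
      _ ≤ (nbrs G v).card * ∑ w ∈ nbrs G v, ‖f w‖ ^ 2 := sq_sum_le_card_mul_sum_sq
      _ ≤ D * ∑ w ∈ nbrs G v, ‖f w‖ ^ 2 := by
          gcongr; exact card_nbrs G v
  set t := s.biUnion (nbrs G)
  have h2 : ∑ v ∈ s, ∑ w ∈ nbrs G v, ‖f w‖ ^ 2 =
      ∑ w ∈ t, ∑ v ∈ s.filter (fun v => w ∈ nbrs G v), ‖f w‖ ^ 2 := by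
    refine Finset.sum_comm' fun v w => ?_
    simp only [Finset.mem_filter, t, Finset.mem_biUnion]
    constructor
    · rintro ⟨h, h'⟩; exact ⟨⟨h, h'⟩, v, h, h'⟩
    · rintro ⟨h, _⟩; exact h
  have h3 : ∀ w ∈ t, ∑ v ∈ s.filter (fun v => w ∈ nbrs G v), ‖f w‖ ^ 2 ≤ D * ‖f w‖ ^ 2 := by
    intro w _
    rw [Finset.sum_const, nsmul_eq_mul]
    gcongr
    refine le_trans (Finset.card_le_card fun v hv => ?_) (card_nbrs G w)
    rw [mem_nbrs]
    exact ((mem_nbrs G).1 (Finset.mem_filter.1 hv).2).symm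
  calc ∑ v ∈ s, ‖∑ w ∈ nbrs G v, f w‖ ^ 2
      ≤ ∑ v ∈ s, D * ∑ w ∈ nbrs G v, ‖f w‖ ^ 2 := Finset.sum_le_sum h1
    _ = D * ∑ w ∈ t, ∑ v ∈ s.filter (fun v => w ∈ nbrs G v), ‖f w‖ ^ 2 := by
        rw [← Finset.mul_sum, h2]
    _ ≤ D * ∑ w ∈ t, D * ‖f w‖ ^ 2 := by gcongr with w hw; exact h3 w hw
    _ = D ^ 2 * ∑ w ∈ t, ‖f w‖ ^ 2 := by rw [← Finset.mul_sum]; ring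
    _ ≤ D ^ 2 * ‖f‖ ^ 2 := by gcongr; exact hf t
    _ = (D * ‖f‖) ^ 2 := by ring

/-- The adjacency operator `(A f)(v) = ∑_{w ∼ v} f(w)` on `ℓ²(V)`. -/
def adjOp : L2 V →L[ℂ] L2 V :=
  LinearMap.mkContinuousOfExistsBound
    { toFun := fun f => ⟨fun v => ∑ w ∈ nbrs G v, f w,
        memℓp_gen' (C := ((hG.exists_bound.choose : ℝ) * ‖f‖) ^ 2) fun s => by
          simpa using sum_nbrs_le G f s⟩
      map_add' := fun f g => by
        ext v
        exact Finset.sum_add_distrib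
      map_smul' := fun c f => by
        ext v; simp [Finset.mul_sum] }
    ⟨(hG.exists_bound.choose : ℝ), fun f =>
      lp.norm_le_of_forall_sum_le (by norm_num) (by positivity) fun s => by
        simpa using sum_nbrs_le G f s⟩

theorem adjOp_apply (f : L2 V) (v : V) : adjOp G f v = ∑ w ∈ nbrs G v, f w := rfl

/-- A generalized Perron–Frobenius vector: strictly positive entries, and `A v = ‖A‖ v` entrywise,
without any summability. -/
def IsGeneralizedPerronFrobenius (v : V → ℂ) : Prop :=
  (∀ x, 0 < v x) ∧ ∀ x, ∑ y ∈ nbrs G x, v y = (‖adjOp G‖ : ℂ) * v x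

end Graphs

section Combs

/-- The comb product `G ⊣ (H, o)`. -/
def comb {α β : Type} (G : SimpleGraph α) (H : SimpleGraph β) (o : β) : SimpleGraph (α × β) where
  Adj p q := (p.1 = q.1 ∧ H.Adj p.2 q.2) ∨ (p.2 = o ∧ q.2 = o ∧ G.Adj p.1 q.1)
  symm := ⟨fun _ _ h => h.imp (fun h => ⟨h.1.symm, h.2.symm⟩) fun h => ⟨h.2.1, h.1, h.2.2.symm⟩⟩
  loopless := ⟨fun _ h => h.elim (fun h => H.irrefl h.2) fun h => G.irrefl h.2.2⟩

instance {α β : Type} (G : SimpleGraph α) (H : SimpleGraph β) (o : β) [hG : BoundedDegree G]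
    [hH : BoundedDegree H] : BoundedDegree (comb G H o) := by
  classical
  refine BoundedDegree.of_finset _ (hH.exists_bound.choose + hG.exists_bound.choose)
    (fun p => (nbrs H p.2).image (fun y => (p.1, y)) ∪ (nbrs G p.1).image (fun x => (x, o)))
    ?_ fun p => ?_
  · rintro ⟨x, y⟩ ⟨x', y'⟩ h
    simp only [Finset.mem_union, Finset.mem_image, mem_nbrs]
    rcases h with ⟨h1, h2⟩ | ⟨_, h2, h3⟩
    · exact Or.inl ⟨y', h2, by simpa using h1⟩
    · exact Or.inr ⟨x', h3, by simpa using h2.symm⟩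
  · refine (Finset.card_union_le _ _).trans (Nat.add_le_add ?_ ?_)
    · exact Finset.card_image_le.trans (card_nbrs H _)
    · exact Finset.card_image_le.trans (card_nbrs G _)

instance {V : Type} [Finite V] (G : SimpleGraph V) : BoundedDegree G := by
  classical
  have := Fintype.ofFinite V
  exact BoundedDegree.of_finset G (Fintype.card V) (fun _ => Finset.univ)
    (fun _ _ _ => Finset.mem_univ _) fun _ => le_rfl

instance {V W : Type} (f : V ↪ W) (G : SimpleGraph V) [hG : BoundedDegree G] :
    BoundedDegree (G.map f) := by
  classical
  refine ⟨hG.exists_bound.choose, fun w => ?_⟩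
  by_cases hw : ∃ v, f v = w
  · obtain ⟨v, rfl⟩ := hw
    have hsub : (G.map f).neighborSet (f v) ⊆ ((nbrs G v).map f : Set W) := by
      intro w hw
      obtain ⟨a, b, hab, ha, rfl⟩ := (SimpleGraph.map_adj f G _ _).1 hw
      obtain rfl := f.injective ha
      simpa [mem_nbrs] using hab
    refine ⟨(Finset.finite_toSet _).subset hsub, ?_⟩
    refine (Set.ncard_le_ncard hsub (Finset.finite_toSet _)).trans ?_
    rw [Set.ncard_coe_finset, Finset.card_map]
    exact card_nbrs G v
  · have h : (G.map f).neighborSet w = ∅ := by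
      ext w'
      simp only [SimpleGraph.mem_neighborSet, SimpleGraph.map_adj, Set.mem_empty_iff_false,
        iff_false]
      rintro ⟨a, b, _, ha, _⟩
      exact hw ⟨a, ha⟩
    simp [h]

/-- The lattice `ℤ^d` with nearest-neighbour edges. -/
def lattice (d : ℕ) : SimpleGraph (Fin d → ℤ) where
  Adj x y := ∃ i, |x i - y i| = 1 ∧ ∀ j, j ≠ i → x j = y j
  symm := ⟨fun _ _ ⟨i, h, h'⟩ => ⟨i, by rwa [abs_sub_comm], fun j hj => (h' j hj).symm⟩⟩
  loopless := ⟨fun _ ⟨_, h, _⟩ => by simp at h⟩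

instance (d : ℕ) : BoundedDegree (lattice d) := by
  classical
  refine BoundedDegree.of_finset _ ((Finset.univ : Finset (Fin d × Bool)).card)
    (fun x => (Finset.univ : Finset (Fin d × Bool)).image fun p =>
      Function.update x p.1 (if p.2 then x p.1 + 1 else x p.1 - 1)) ?_
    fun _ => Finset.card_image_le
  rintro x y ⟨i, hi, h⟩
  rw [Finset.mem_image]
  rcases (abs_eq zero_le_one).1 hi with h1 | h1
  · refine ⟨(i, false), Finset.mem_univ _, funext fun j => ?_⟩
    by_cases hj : j = i
    · subst hj; simp; omega
    · simp [hj, h j hj]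
  · refine ⟨(i, true), Finset.mem_univ _, funext fun j => ?_⟩
    by_cases hj : j = i
    · subst hj; simp; omega
    · simp [hj, h j hj]

/-- The integer line `ℤ` with nearest-neighbour edges. -/
def line : SimpleGraph ℤ where
  Adj x y := |x - y| = 1
  symm := ⟨fun x y h => by rwa [abs_sub_comm]⟩
  loopless := ⟨fun _ h => by simp at h⟩

instance : BoundedDegree line := by
  refine BoundedDegree.of_finset _ 2 (fun x => {x + 1, x - 1}) (fun x y h => ?_)
    fun _ => Finset.card_le_two
  rcases (abs_eq zero_le_one).1 h with h1 | h1
  · simp; omega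
  · simp; omega

/-- The vertices of the comb `ℤ^d ⊣ ℤ`. -/
abbrev Vtx (d : ℕ) : Type := (Fin d → ℤ) × ℤ

/-- The comb graph `ℤ^d ⊣ ℤ`. -/
def combZ (d : ℕ) : SimpleGraph (Vtx d) := comb (lattice d) line 0

instance (d : ℕ) : BoundedDegree (combZ d) := inferInstanceAs (BoundedDegree (comb _ _ _))

/-- The interval `[-n, n]` in `ℤ`. -/
abbrev Box (n : ℕ) : Type := Set.Icc (-(n : ℤ)) n

/-- The finite chain on `[-n, n]`. -/
def chain (n : ℕ) : SimpleGraph (Box n) where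
  Adj x y := |(x : ℤ) - y| = 1
  symm := ⟨fun x y h => by rwa [abs_sub_comm]⟩
  loopless := ⟨fun _ h => by simp at h⟩

/-- The discrete torus `(ℤ / (2n+1))^d` on the vertex set `[-n, n]^d`: neighbours differ in exactly
one coordinate, and there by `±1` modulo `2n+1`. -/
def torus (d n : ℕ) : SimpleGraph (Fin d → Box n) where
  Adj x y := ∃ i, x i ≠ y i ∧
    ((x i : ℤ) ≡ y i + 1 [ZMOD 2 * n + 1] ∨ (y i : ℤ) ≡ x i + 1 [ZMOD 2 * n + 1]) ∧
    ∀ j, j ≠ i → x j = y j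
  symm := ⟨fun _ _ ⟨i, h, h', h''⟩ => ⟨i, h.symm, h'.symm, fun j hj => (h'' j hj).symm⟩⟩
  loopless := ⟨fun _ ⟨_, h, _⟩ => h rfl⟩

/-- The inclusion of `[-n, n]^d × [-n, n]` into `ℤ^d × ℤ`. -/
def boxEmbedding (d n : ℕ) : (Fin d → Box n) × Box n ↪ Vtx d where
  toFun p := (fun i => p.1 i, p.2)
  inj' p q h := by
    have h1 := congrArg Prod.fst h
    have h2 := congrArg Prod.snd h
    exact Prod.ext (funext fun i => Subtype.ext (congrFun h1 i)) (Subtype.ext h2)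

/-- The finite volume comb `Λ_n = (ℤ / (2n+1))^d ⊣ [-n, n]`, as a graph on `ℤ^d × ℤ` without edges
at the vertices outside `[-n, n]^d × [-n, n]`. -/
def combBox (d n : ℕ) : SimpleGraph (Vtx d) :=
  (comb (torus d n) (chain n) ⟨0, by simp⟩).map (boxEmbedding d n)

instance (d n : ℕ) : BoundedDegree (combBox d n) :=
  inferInstanceAs (BoundedDegree (SimpleGraph.map _ _))

/-- The Hamiltonian `H_n = (‖A‖ - μ) I - A_{Λ_n}` with chemical potential `μ`. -/
def hamiltonian (d : ℕ) (μ : ℝ) (n : ℕ) : L2 (Vtx d) →L[ℂ] L2 (Vtx d) :=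
  ((‖adjOp (combZ d)‖ - μ : ℝ) : ℂ) • 1 - adjOp (combBox d n)

/-- The two-point function `ω_n(a⁺(ξ) a(η)) = ⟪η, (e^{β H_n} - 1)⁻¹ ξ⟫` of the finite volume Gibbs
grand canonical state at inverse temperature `β`. -/
def gibbsTwoPoint (d : ℕ) (β μ : ℝ) (n : ℕ) (ξ η : L2 (Vtx d)) : ℂ :=
  ⟪η, Ring.inverse (NormedSpace.exp ((β : ℂ) • hamiltonian d μ n) - 1) ξ⟫_ℂ

/-- The value `ω_n(W(f)) = exp (-‖f‖² / 4 - ω_n(a⁺(f) a(f)) / 2)` of the finite volume Gibbs state,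
which is the gauge-invariant quasi-free state with the above two-point function. -/
def gibbsWeyl (d : ℕ) (β μ : ℝ) (n : ℕ) (f : L2 (Vtx d)) : ℂ :=
  Complex.exp (-(‖f‖ ^ 2 / 4 : ℝ) - gibbsTwoPoint d β μ n f f / 2)

/-- The restriction of `ξ ∈ ℓ²(ℤ^d × ℤ)` to the fibre over `j ∈ ℤ^d`. -/
def fiber {d : ℕ} (ξ : L2 (Vtx d)) (j : Fin d → ℤ) : L2 ℤ :=
  ⟨fun k => ξ (j, k), by
    refine memℓp_gen ?_
    have h := (lp.memℓp ξ).summable (by norm_num)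
    exact h.comp_injective (Prod.mk_right_injective j)⟩

/-- The space `𝒮₀` of the `ξ ∈ ℓ²(ℤ^d × ℤ)` for which the sequence `‖ξ_j‖`, `j ∈ ℤ^d`, of the norms
of the restrictions to the fibres is rapidly decreasing. -/
def S0 (d : ℕ) : Submodule ℂ (L2 (Vtx d)) where
  carrier := {ξ | ∀ N : ℕ, ∃ C : ℝ, ∀ j : Fin d → ℤ, (1 + ‖j‖) ^ N * ‖fiber ξ j‖ ≤ C}
  zero_mem' N := ⟨0, fun j => by
    have : fiber (0 : L2 (Vtx d)) j = 0 := by ext; rfl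
    simp [this]⟩
  add_mem' {ξ η} hξ hη N := by
    obtain ⟨C, hC⟩ := hξ N
    obtain ⟨C', hC'⟩ := hη N
    refine ⟨C + C', fun j => ?_⟩
    have e : fiber (ξ + η) j = fiber ξ j + fiber η j := by ext; rfl
    calc (1 + ‖j‖) ^ N * ‖fiber (ξ + η) j‖
        ≤ (1 + ‖j‖) ^ N * (‖fiber ξ j‖ + ‖fiber η j‖) := by
          rw [e]; gcongr; exact norm_add_le _ _
      _ ≤ C + C' := by rw [mul_add]; exact add_le_add (hC j) (hC' j)
  smul_mem' c ξ hξ N := by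
    obtain ⟨C, hC⟩ := hξ N
    refine ⟨‖c‖ * C, fun j => ?_⟩
    have e : fiber (c • ξ) j = c • fiber ξ j := by ext; rfl
    rw [e, norm_smul, mul_left_comm]
    gcongr
    exact hC j

/-- The unit vector `w = R_ℤ(‖A‖)δ₀ / ‖R_ℤ(‖A‖)δ₀‖` in `ℓ²(ℤ)`, where `A` is the adjacency operator
of `ℤ^d ⊣ ℤ` and `R_ℤ` is the resolvent of the adjacency operator of `ℤ`. -/
def pfFiber (d : ℕ) : L2 ℤ :=
  let r : L2 ℤ := resolvent (adjOp line) (‖adjOp (combZ d)‖ : ℂ) (lp.single 2 0 1)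
  (‖r‖ : ℂ)⁻¹ • r

/-- The vector `v = u ⊗ w` on `ℤ^d × ℤ`, with `u` constantly equal to `1` on `ℤ^d`. -/
def pfVector (d : ℕ) : Vtx d → ℂ := fun x => pfFiber d x.2

/-- The vector `u_n ⊗ w`, with `u_n` the indicator function of `[-n, n]^d`. -/
def boxVector (d n : ℕ) (w : L2 ℤ) : Vtx d → ℂ :=
  Set.indicator {x | ∀ i, |x.1 i| ≤ n} fun x => w x.2

/-- The pairing `⟨v, f⟩ = ∑ₓ conj (v x) * f x`, conjugate-linear in `v`. -/
def pairing {V : Type} (v : V → ℂ) (f : L2 V) : ℂ := ∑' x, conj (v x) * f x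

/-- A state `φ` on the CCR algebra over a subspace `S` of `ℓ²(V)` is locally normal if, for every
finite region `Λ` of `V`, its GNS representation restricted to the CCR algebra over `ℓ²(Λ)` is
quasi-equivalent to the Fock representation. -/
def IsLocallyNormal {V : Type} {S : Submodule ℂ (L2 V)} (φ : CCR S →ₚ[ℂ] ℂ) : Prop :=
  ∀ Λ : Finset V, IsFockNormalOn φ
    { carrier := {f : S | ∀ x, x ∉ Λ → (f : L2 V) x = 0}
      zero_mem' := fun _ _ => rfl
      add_mem' := fun {f g} hf hg x hx => by
        have h1 := hf x hx
        have h2 := hg x hx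
        simp [h1, h2]
      smul_mem' := fun c f hf x hx => by
        have h1 := hf x hx
        simp [h1] }

end Combs

end CombBEC

end

open CombBEC Filter Topology ComplexConjugate
open scoped ComplexOrder

/-!
**Perron–Frobenius vector.** Write `λ = 2 √(d² + 1)` and `r = √(d² + 1) - d`. The function
`(x, k) ↦ r ^ |k|` is strictly positive and satisfies `A v = λ v` entrywise on `ℤ^d ⊣ ℤ`, and it is
a `λ`-supersolution on every comb whose fibres are subgraphs of the line and whose base has degree
`2d`. The Schur test
(`adjOp_norm_le_of_superharmonic`) bounds the norms of all these combs by `λ`, and exponential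
damping along the base shows `‖A‖ = λ` (`norm_adjOp_combZ`). As `λ > 2 ≥ ‖A_ℤ‖`, the resolvent
vector `R_ℤ(λ) δ₀` exists; it equals `(2d)⁻¹ r ^ |k|` (`resolvent_line`).

**Two-point function.** The function `1 / (eˣ - 1) - 1 / x` extends continuously to `x = 0`, so
`(e^{βH} - 1)⁻¹` is `β⁻¹` times a resolvent of `A_Λ` plus a continuous function of the Hamiltonian
(`inverse_exp_hamiltonian`), and the latter converges strongly (`tendsto_boseRegOp_apply`). The
resolvent of the finite comb at `s = λ - μ` is computed fibrewise: eliminating the fibres, whose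
resolvents stay bounded, leaves the equation `(g⁻¹ - B) q = g⁻¹ p` on the torus at level zero,
where `B` is the adjacency operator of the torus and `g = ⟪δ₀, R(s) δ₀⟫` is the diagonal resolvent
entry of the chain and `p` consists of the overlaps of the source with the chain vector `R(s) δ₀`.
It is solved by the Green function `K` of mass `ρ = g⁻¹ - 2d`, which is
positive and tends to `0` (`inner_resolvent_combBox`, `chainVec_zero_lt`).

Writing `K x = K 0 - (K 0 - K x)`, the constant `K 0` contributes a rank one form built from
`u_n ⊗ w_n` with `w_n` the normalized chain resolvent vector (`gibbsTwoPoint_sub`). In the remainder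
only the differences `K 0 - K x` occur.

* `K 0 → ∞` in dimension at most two: by the Dirichlet principle `K 0` is bounded below by the
  inverse energy of a logarithmic cutoff (`tendsto_green_zero`). This is recurrence of the base.
* `K 0 - K x` converges, and `|K 0 - K x| ≤ |x|₁` (`exists_tendsto_torus_potential`,
  `IsGreen.abs_zero_sub_le`). The increments of `K` are bounded by `1` by the maximum principle,
  hence limits exist along ultrafilters; they are even solutions of the same Poisson equation on
  `ℤ^d` with bounded increments, and a Liouville theorem makes them unique.

Rapid decrease of the fibre norms absorbs the linear growth, and dominated convergence gives the
limiting form (`exists_condensate_decomposition`).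

**No locally normal state.** Take `f = t δ` with `t ≠ 0` real and `δ` the unit vector at the
origin. Its pairing with the Perron–Frobenius vector does not vanish, hence `ω_n(a⁺(f) a(f)) → ∞`
and the limit state vanishes on `W(f)`. For a locally normal state, `W(t δ) ↦ φ(W(t δ))` would be
given by a density matrix on Fock space, and strong continuity of the Weyl operators there would
force the limit `1` as `t → 0` (`not_isLocallyNormal`).
-/

namespace CombBEC
open scoped InnerProductSpace

/-! ### Adjacency operators -/

/-- The Schur test: a positive supersolution bounds the norm of the adjacency operator. -/
theorem adjOp_norm_le_of_superharmonic {V : Type} (G : SimpleGraph V) [BoundedDegree G]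
    (v : V → ℝ) (hv : ∀ x, 0 < v x) {c : ℝ} (hc : 0 ≤ c)
    (h : ∀ x, ∑ w ∈ nbrs G x, v w ≤ c * v x) : ‖adjOp G‖ ≤ c := by
  classical
  refine ContinuousLinearMap.opNorm_le_bound _ hc fun f => ?_
  refine lp.norm_le_of_forall_sum_le (by norm_num) (by positivity) fun s => ?_
  have hf : ∀ t : Finset V, ∑ w ∈ t, ‖f w‖ ^ 2 ≤ ‖f‖ ^ 2 := by
    intro t
    have h := lp.sum_rpow_le_norm_rpow (p := 2) (by norm_num) f t
    simpa using h
  -- Cauchy–Schwarz with the weights `v`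
  have h1 : ∀ x ∈ s, ‖∑ w ∈ nbrs G x, f w‖ ^ 2 ≤
      ∑ w ∈ nbrs G x, c * v x * (‖f w‖ ^ 2 / v w) := by
    intro x _
    have hS : 0 ≤ ∑ w ∈ nbrs G x, ‖f w‖ ^ 2 / v w :=
      Finset.sum_nonneg fun w _ => div_nonneg (by positivity) (hv w).le
    calc ‖∑ w ∈ nbrs G x, f w‖ ^ 2 ≤ (∑ w ∈ nbrs G x, ‖f w‖) ^ 2 := by
          gcongr; exact norm_sum_le _ _
      _ ≤ (∑ w ∈ nbrs G x, v w) * ∑ w ∈ nbrs G x, ‖f w‖ ^ 2 / v w := by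
          refine Finset.sum_sq_le_sum_mul_sum_of_sq_le_mul _ (fun w _ => (hv w).le)
            (fun w _ => div_nonneg (by positivity) (hv w).le) fun w _ => ?_
          rw [mul_div_cancel₀ _ (hv w).ne']
      _ ≤ c * v x * ∑ w ∈ nbrs G x, ‖f w‖ ^ 2 / v w := by gcongr; exact h x
      _ = _ := Finset.mul_sum _ _ _
  set t := s.biUnion (nbrs G)
  have h2 : ∑ x ∈ s, ∑ w ∈ nbrs G x, c * v x * (‖f w‖ ^ 2 / v w) =
      ∑ w ∈ t, ∑ x ∈ s.filter (fun x => w ∈ nbrs G x), c * v x * (‖f w‖ ^ 2 / v w) := by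
    refine Finset.sum_comm' fun v w => ?_
    simp only [Finset.mem_filter, t, Finset.mem_biUnion]
    constructor
    · rintro ⟨h, h'⟩; exact ⟨⟨h, h'⟩, v, h, h'⟩
    · rintro ⟨h, _⟩; exact h
  have h3 : ∀ w ∈ t, ∑ x ∈ s.filter (fun x => w ∈ nbrs G x), c * v x * (‖f w‖ ^ 2 / v w) ≤
      c ^ 2 * ‖f w‖ ^ 2 := by
    intro w _
    have h4 : ∑ x ∈ s.filter (fun x => w ∈ nbrs G x), v x ≤ c * v w := by
      refine le_trans (Finset.sum_le_sum_of_subset_of_nonneg (fun x hx => ?_)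
        fun x _ _ => (hv x).le) (h w)
      rw [mem_nbrs]
      exact ((mem_nbrs G).1 (Finset.mem_filter.1 hx).2).symm
    rw [← Finset.sum_mul, ← Finset.mul_sum]
    have hw := hv w
    calc c * (∑ x ∈ s.filter (fun x => w ∈ nbrs G x), v x) * (‖f w‖ ^ 2 / v w)
        ≤ c * (c * v w) * (‖f w‖ ^ 2 / v w) := by gcongr
      _ = c ^ 2 * ‖f w‖ ^ 2 := by field_simp
  have h5 : ∑ x ∈ s, ‖∑ w ∈ nbrs G x, f w‖ ^ 2 ≤ (c * ‖f‖) ^ 2 := by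
    calc ∑ x ∈ s, ‖∑ w ∈ nbrs G x, f w‖ ^ 2
        ≤ ∑ w ∈ t, ∑ x ∈ s.filter (fun x => w ∈ nbrs G x), c * v x * (‖f w‖ ^ 2 / v w) :=
          (Finset.sum_le_sum h1).trans h2.le
      _ ≤ ∑ w ∈ t, c ^ 2 * ‖f w‖ ^ 2 := Finset.sum_le_sum h3
      _ = c ^ 2 * ∑ w ∈ t, ‖f w‖ ^ 2 := by rw [Finset.mul_sum]
      _ ≤ c ^ 2 * ‖f‖ ^ 2 := by gcongr; exact hf t
      _ = _ := by ring
  simpa [adjOp_apply] using h5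

theorem adjOp_single {V : Type} [DecidableEq V] (G : SimpleGraph V) [BoundedDegree G] (x : V) :
    adjOp G (lp.single 2 x 1) = ∑ w ∈ nbrs G x, lp.single 2 w (1 : ℂ) := by
  ext v
  rw [adjOp_apply]
  have h : v ∈ nbrs G x ↔ x ∈ nbrs G v := by
    rw [mem_nbrs, mem_nbrs]; exact ⟨fun h => h.symm, fun h => h.symm⟩
  have e : ((∑ w ∈ nbrs G x, lp.single 2 w (1 : ℂ) : L2 V) : V → ℂ) v =
      ∑ w ∈ nbrs G x, (lp.single 2 w (1 : ℂ) : L2 V) v := by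
    rw [lp.coeFn_sum, Finset.sum_apply]
  rw [e]
  simp [lp.single_apply, Pi.single_apply, Finset.sum_ite_eq, h]

/-- Uniformly bounded operators converge strongly as soon as they converge on a total set. -/
theorem tendsto_apply_of_total {E F : Type} [NormedAddCommGroup E] [NormedSpace ℂ E]
    [NormedAddCommGroup F] [NormedSpace ℂ F] {ι : Type} {l : Filter ι} {T : ι → E →L[ℂ] F}
    {T' : E →L[ℂ] F} {c : ℝ} (hb : ∀ᶠ i in l, ‖T i‖ ≤ c) (D : Set E)
    (hD : Dense (Submodule.span ℂ D : Set E))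
    (h : ∀ f ∈ D, Tendsto (fun i => T i f) l (𝓝 (T' f))) (f : E) :
    Tendsto (fun i => T i f) l (𝓝 (T' f)) := by
  have hs : ∀ f ∈ Submodule.span ℂ D, Tendsto (fun i => T i f) l (𝓝 (T' f)) := by
    intro f hf
    induction hf using Submodule.span_induction with
    | mem x hx => exact h x hx
    | zero => simp [tendsto_const_nhds]
    | add x y _ _ hx hy => simpa using hx.add hy
    | smul a x _ hx => simpa using hx.const_smul a
  rw [Metric.tendsto_nhds]
  intro ε hε
  set M := max c 0 + ‖T'‖ + 1 with hM
  have hMpos : 0 < M := by positivity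
  obtain ⟨g, hg, hgf⟩ := Metric.mem_closure_iff.1 (hD f) (ε / (2 * M)) (by positivity)
  filter_upwards [hb, (Metric.tendsto_nhds.1 (hs g hg)) (ε / 2) (by positivity)] with i hi hi'
  rw [dist_eq_norm] at *
  have e : T i f - T' f = T i (f - g) - T' (f - g) + (T i g - T' g) := by
    simp only [map_sub]; abel
  have b1 : ‖T i (f - g) - T' (f - g)‖ ≤ M * ‖f - g‖ := by
    refine (norm_sub_le _ _).trans ?_
    have := (T i).le_opNorm (f - g)
    have h2 := T'.le_opNorm (f - g)
    have h3 : ‖T i‖ ≤ max c 0 := hi.trans (le_max_left _ _)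
    have h4 := mul_le_mul_of_nonneg_right h3 (norm_nonneg (f - g))
    have h5 := norm_nonneg (f - g)
    rw [hM]; linarith
  have b2 : M * ‖f - g‖ < M * (ε / (2 * M)) := by gcongr
  have b3 : M * (ε / (2 * M)) = ε / 2 := by field_simp
  rw [e]
  have := norm_add_le (T i (f - g) - T' (f - g)) (T i g - T' g)
  linarith

theorem dense_span_single (V : Type) [DecidableEq V] :
    Dense (Submodule.span ℂ (Set.range fun x : V => (lp.single 2 x 1 : L2 V)) : Set (L2 V)) := by
  intro f
  have h := lp.hasSum_single (p := 2) (by norm_num) f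
  refine mem_closure_of_tendsto h (Eventually.of_forall fun s => ?_)
  refine Submodule.sum_mem _ fun x _ => ?_
  have : (lp.single 2 x (f x) : L2 V) = f x • lp.single 2 x (1 : ℂ) := by
    rw [← lp.single_smul]; simp
  rw [this]
  exact Submodule.smul_mem _ _ (Submodule.subset_span ⟨x, rfl⟩)

/-- Adjacency operators converge strongly if the graphs converge locally. -/
theorem tendsto_adjOp {V ι : Type} {l : Filter ι} (G : SimpleGraph V) [BoundedDegree G]
    (Gn : ι → SimpleGraph V) [∀ i, BoundedDegree (Gn i)] {c : ℝ}
    (hb : ∀ᶠ i in l, ‖adjOp (Gn i)‖ ≤ c)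
    (h : ∀ x, ∀ᶠ i in l, ∀ y, (Gn i).Adj x y ↔ G.Adj x y) (f : L2 V) :
    Tendsto (fun i => adjOp (Gn i) f) l (𝓝 (adjOp G f)) := by
  classical
  refine tendsto_apply_of_total hb _ (dense_span_single V) ?_ f
  rintro _ ⟨x, rfl⟩
  refine tendsto_const_nhds.congr' ?_
  filter_upwards [h x] with i hi
  rw [adjOp_single, adjOp_single]
  congr 1
  ext y
  rw [mem_nbrs, mem_nbrs, hi]

theorem inner_adjOp_left {V : Type} (G : SimpleGraph V) [BoundedDegree G] (f g : L2 V) :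
    ⟪adjOp G f, g⟫_ℂ = ⟪f, adjOp G g⟫_ℂ := by
  classical
  have key : ∀ x y : V, ⟪adjOp G (lp.single 2 x 1), (lp.single 2 y 1 : L2 V)⟫_ℂ =
      ⟪(lp.single 2 x 1 : L2 V), adjOp G (lp.single 2 y 1)⟫_ℂ := by
    intro x y
    rw [lp.inner_single_left, lp.inner_single_right, adjOp_apply, adjOp_apply]
    have h : y ∈ nbrs G x ↔ x ∈ nbrs G y := by
      rw [mem_nbrs, mem_nbrs]; exact ⟨fun h => h.symm, fun h => h.symm⟩
    simp [lp.single_apply, Pi.single_apply, h]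
  have hD := dense_span_single V
  set D := Submodule.span ℂ (Set.range fun x : V => (lp.single 2 x 1 : L2 V))
  have h1 : ∀ x : V, ∀ g : L2 V, ⟪adjOp G (lp.single 2 x 1), g⟫_ℂ =
      ⟪(lp.single 2 x 1 : L2 V), adjOp G g⟫_ℂ := by
    intro x g
    have := ContinuousLinearMap.ext_on (f := innerSL ℂ (adjOp G (lp.single 2 x 1)))
      (g := (innerSL ℂ (lp.single 2 x 1 : L2 V)).comp (adjOp G)) hD (by
        rintro _ ⟨y, rfl⟩
        simpa using key x y)
    simpa using congrArg (fun T => T g) this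
  have h2 : ∀ f : L2 V, ⟪g, adjOp G f⟫_ℂ = ⟪adjOp G g, f⟫_ℂ := by
    intro f
    have := ContinuousLinearMap.ext_on (f := (innerSL ℂ g).comp (adjOp G))
      (g := innerSL ℂ (adjOp G g)) hD (by
        rintro _ ⟨y, rfl⟩
        have := congrArg conj (h1 y g)
        simpa using this)
    simpa using congrArg (fun T => T f) this
  have := congrArg conj (h2 f)
  simpa using this

theorem isSelfAdjoint_adjOp {V : Type} (G : SimpleGraph V) [BoundedDegree G] :
    IsSelfAdjoint (adjOp G) := by
  rw [ContinuousLinearMap.isSelfAdjoint_iff_isSymmetric]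
  exact fun f g => inner_adjOp_left G f g

/-! ### Resolvents outside the norm ball -/

section Resolvent
variable {H : Type} [NormedAddCommGroup H] [InnerProductSpace ℂ H] [CompleteSpace H]

theorem isUnit_sub_of_norm_lt (X : H →L[ℂ] H) {z : ℂ} (h : ‖X‖ < ‖z‖) :
    IsUnit (algebraMap ℂ (H →L[ℂ] H) z - X) := by
  rcases subsingleton_or_nontrivial H with hs | hs
  · exact isUnit_of_subsingleton _
  · exact spectrum.mem_resolventSet_of_norm_lt h

theorem resolvent_spec (X : H →L[ℂ] H) {z : ℂ} (h : ‖X‖ < ‖z‖) (f : H) :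
    z • resolvent X z f - X (resolvent X z f) = f := by
  have := Ring.mul_inverse_cancel _ (isUnit_sub_of_norm_lt X h)
  have := congrArg (fun T : H →L[ℂ] H => T f) this
  simpa [resolvent, Algebra.algebraMap_eq_smul_one] using this

theorem resolvent_unique (X : H →L[ℂ] H) {z : ℂ} (h : ‖X‖ < ‖z‖) {f y : H}
    (hy : z • y - X y = f) : y = resolvent X z f := by
  have := Ring.inverse_mul_cancel _ (isUnit_sub_of_norm_lt X h)
  have := congrArg (fun T : H →L[ℂ] H => T y) this
  rw [← hy]
  simpa [resolvent, Algebra.algebraMap_eq_smul_one] using this.symm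

theorem norm_resolvent_le (X : H →L[ℂ] H) {z : ℂ} {c : ℝ} (hX : ‖X‖ ≤ c) (h : c < ‖z‖) :
    ‖resolvent X z‖ ≤ (‖z‖ - c)⁻¹ := by
  have hpos : 0 < ‖z‖ - c := by linarith
  refine ContinuousLinearMap.opNorm_le_bound _ (by positivity) fun f => ?_
  have h1 := resolvent_spec X (hX.trans_lt h) f
  set y := resolvent X z f
  have h2 : ‖z‖ * ‖y‖ ≤ ‖f‖ + c * ‖y‖ := by
    have e : z • y = f + X y := by rw [← h1]; abel
    calc ‖z‖ * ‖y‖ = ‖z • y‖ := (norm_smul _ _).symm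
      _ = ‖f + X y‖ := by rw [e]
      _ ≤ ‖f‖ + ‖X y‖ := norm_add_le _ _
      _ ≤ ‖f‖ + c * ‖y‖ := by gcongr; exact X.le_of_opNorm_le hX y
  rw [inv_mul_eq_div, le_div_iff₀ hpos]
  linarith

/-- Strong convergence of resolvents at points that stay away from the norm ball. -/
theorem tendsto_resolvent {ι : Type} {l : Filter ι} {X : ι → H →L[ℂ] H} {X' : H →L[ℂ] H}
    {z : ι → ℂ} {z' : ℂ} {c : ℝ} (hX : ∀ᶠ i in l, ‖X i‖ ≤ c) (hX' : ‖X'‖ ≤ c)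
    (hz : Tendsto z l (𝓝 z')) (hz' : c < ‖z'‖)
    (h : ∀ f, Tendsto (fun i => X i f) l (𝓝 (X' f))) (f : H) :
    Tendsto (fun i => resolvent (X i) (z i) f) l (𝓝 (resolvent X' z' f)) := by
  set y := resolvent X' z' f
  have hy := resolvent_spec X' (hX'.trans_lt hz') f
  obtain ⟨a, ha, ha'⟩ := exists_between hz'
  have hev : ∀ᶠ i in l, a < ‖z i‖ := hz.norm.eventually (lt_mem_nhds ha')
  have h0 : Tendsto (fun i => f - (z i • y - X i y)) l (𝓝 0) := by
    have := tendsto_const_nhds (x := f) (f := l) |>.sub ((hz.smul_const y).sub (h y))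
    rw [hy, sub_self] at this
    exact this
  rw [tendsto_iff_norm_sub_tendsto_zero]
  have h1 : Tendsto (fun i => (a - c)⁻¹ * ‖f - (z i • y - X i y)‖) l (𝓝 0) := by
    simpa using h0.norm.const_mul (a - c)⁻¹
  refine squeeze_zero' (Eventually.of_forall fun _ => norm_nonneg _) ?_ h1
  filter_upwards [hX, hev] with i hi hi'
  have hlt : ‖X i‖ < ‖z i‖ := by linarith
  have e : resolvent (X i) (z i) f - y = resolvent (X i) (z i) (f - (z i • y - X i y)) := by
    rw [map_sub, ← resolvent_unique (X i) hlt rfl]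
  rw [e]
  refine (ContinuousLinearMap.le_of_opNorm_le _
    (norm_resolvent_le (X i) hi (ha.trans hi')) _).trans ?_
  gcongr

end Resolvent

/-! ### The Bose function of an operator -/

/-- The regular part `1 / (eˣ - 1) - 1 / x` of the Bose function, with its value `-1 / 2` at `0`
supplied by the divided differences of `exp`. -/
noncomputable def boseReg (x : ℝ) : ℝ := -(dslope (dslope Real.exp 0) 0 x) / dslope Real.exp 0 x

theorem dslope_exp_pos (x : ℝ) : 0 < dslope Real.exp 0 x := by
  rcases eq_or_ne x 0 with rfl | hx
  · simp
  · rw [dslope_of_ne _ hx, slope_def_field, Real.exp_zero, sub_zero]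
    rcases lt_or_gt_of_ne hx with h | h
    · exact div_pos_of_neg_of_neg (sub_neg.2 (Real.exp_lt_one_iff.2 h)) h
    · exact div_pos (by have := Real.one_lt_exp_iff.2 h; linarith) h

theorem continuous_boseReg : Continuous boseReg := by
  have h1 : AnalyticAt ℝ (dslope Real.exp 0) 0 := by
    obtain ⟨p, hp⟩ := analyticAt_rexp (x := 0)
    exact hp.has_fpower_series_dslope_fslope.analyticAt
  have c1 : Continuous (dslope Real.exp 0) := by
    rw [continuous_iff_continuousAt]
    intro x
    rcases eq_or_ne x 0 with rfl | hx
    · exact h1.continuousAt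
    · exact (continuousAt_dslope_of_ne hx).2 Real.continuous_exp.continuousAt
  have c2 : Continuous (dslope (dslope Real.exp 0) 0) := by
    rw [continuous_iff_continuousAt]
    intro x
    rcases eq_or_ne x 0 with rfl | hx
    · exact continuousAt_dslope_same.2 h1.differentiableAt
    · exact (continuousAt_dslope_of_ne hx).2 c1.continuousAt
  exact c2.neg.div c1 fun x => (dslope_exp_pos x).ne'

theorem inv_add_boseReg {x : ℝ} (hx : x ≠ 0) : (Real.exp x - 1) * (x⁻¹ + boseReg x) = 1 := by
  have h1 := dslope_exp_pos x
  have e : Real.exp x - 1 = x * dslope Real.exp 0 x := by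
    rw [dslope_of_ne _ hx, slope_def_field, Real.exp_zero, sub_zero]
    field_simp
  have e2 : dslope (dslope Real.exp 0) 0 x = (dslope Real.exp 0 x - 1) / x := by
    rw [dslope_of_ne _ hx, slope_def_field, sub_zero]
    simp
  rw [boseReg, e2, e]
  field_simp
  ring

section Bose
variable {H : Type} [NormedAddCommGroup H] [InnerProductSpace ℂ H] [CompleteSpace H]

theorem inverse_exp_sub_one (T : H →L[ℂ] H) (hT : IsSelfAdjoint T)
    (hpos : ∀ x ∈ spectrum ℝ T, x ≠ 0) :
    Ring.inverse (NormedSpace.exp T - 1) = Ring.inverse T + cfc boseReg T := by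
  have hinv : ContinuousOn (fun x : ℝ => x⁻¹) (spectrum ℝ T) :=
    continuousOn_inv₀.mono fun x hx => hpos x hx
  have hreg : ContinuousOn boseReg (spectrum ℝ T) := continuous_boseReg.continuousOn
  have hsum : ContinuousOn (fun x : ℝ => x⁻¹ + boseReg x) (spectrum ℝ T) := hinv.add hreg
  have hexp : ContinuousOn (fun x : ℝ => Real.exp x - 1) (spectrum ℝ T) := by fun_prop
  have e1 : NormedSpace.exp T - 1 = cfc (fun x : ℝ => Real.exp x - 1) T := by
    rw [cfc_sub (fun x : ℝ => Real.exp x) (fun _ => (1 : ℝ)) T, CFC.real_exp_eq_normedSpace_exp,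
      cfc_const_one ℝ T]
  have hu : IsUnit T := by
    by_contra h
    exact hpos 0 (spectrum.zero_mem ℝ h) rfl
  have e2 : Ring.inverse T = cfc (fun x : ℝ => x⁻¹) T := (cfc_ringInverse_id T hu hT).symm
  have e3 : (NormedSpace.exp T - 1) * (Ring.inverse T + cfc boseReg T) = 1 := by
    rw [e1, e2, ← cfc_add T (fun x : ℝ => x⁻¹) boseReg, ← cfc_mul _ _ T hexp hsum,
      ← cfc_const_one ℝ T]
    refine cfc_congr fun x hx => ?_
    exact inv_add_boseReg (hpos x hx)
  have e4 : (Ring.inverse T + cfc boseReg T) * (NormedSpace.exp T - 1) = 1 := by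
    rw [e1, e2, ← cfc_add T (fun x : ℝ => x⁻¹) boseReg, ← cfc_mul _ _ T hsum hexp,
      ← cfc_const_one ℝ T]
    refine cfc_congr fun x hx => ?_
    exact (mul_comm _ _).trans (inv_add_boseReg (hpos x hx))
  exact Ring.inverse_unit (⟨_, _, e3, e4⟩ : (H →L[ℂ] H)ˣ)

/-- The operator `boseReg T`, by continuous functional calculus. -/
noncomputable def boseRegOp (T : H →L[ℂ] H) : H →L[ℂ] H := cfc boseReg T

/-- The Bose operator splits into a resolvent, which carries the infrared singularity, and a
continuous function of the Hamiltonian. -/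
theorem inverse_exp_hamiltonian (A : H →L[ℂ] H) (hA : IsSelfAdjoint A) {β s : ℝ} (hβ : 0 < β)
    (hs : ‖A‖ < s) :
    Ring.inverse (NormedSpace.exp ((β : ℂ) • ((s : ℂ) • 1 - A)) - 1) =
      (β : ℂ)⁻¹ • resolvent A (s : ℂ) + boseRegOp ((β : ℂ) • ((s : ℂ) • 1 - A)) := by
  have hsa : IsSelfAdjoint ((β : ℂ) • ((s : ℂ) • 1 - A)) := by
    have h1 : IsSelfAdjoint (β : ℂ) := Complex.conj_ofReal β
    have h2 : IsSelfAdjoint (s : ℂ) := Complex.conj_ofReal s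
    exact h1.smul ((h2.smul (IsSelfAdjoint.one _)).sub hA)
  have hβ' : (β : ℂ) ≠ 0 := by exact_mod_cast hβ.ne'
  have hu : IsUnit (algebraMap ℂ (H →L[ℂ] H) s - A) := by
    refine isUnit_sub_of_norm_lt A ?_
    rw [Complex.norm_real]
    exact hs.trans_le (le_abs_self s)
  rw [boseRegOp, inverse_exp_sub_one _ hsa]
  · congr 1
    rw [resolvent]
    refine Ring.inverse_unit (⟨_, _, ?_, ?_⟩ : (H →L[ℂ] H)ˣ)
    · rw [smul_mul_smul_comm, mul_inv_cancel₀ hβ', one_smul, ← Algebra.algebraMap_eq_smul_one,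
        Ring.mul_inverse_cancel _ hu]
    · rw [smul_mul_smul_comm, inv_mul_cancel₀ hβ', one_smul, ← Algebra.algebraMap_eq_smul_one,
        Ring.inverse_mul_cancel _ hu]
  · rintro x hx rfl
    refine hx ?_
    rw [spectrum.mem_resolventSet_iff, map_zero, zero_sub, IsUnit.neg_iff,
      ← Algebra.algebraMap_eq_smul_one]
    exact hu.smul (Units.mk0 (β : ℂ) hβ')

/-- Continuous functions of self-adjoint operators are continuous for strong convergence, on
bounded sets. -/
theorem tendsto_cfc_apply {ι : Type} {l : Filter ι} {T : ι → H →L[ℂ] H} {T' : H →L[ℂ] H}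
    {M : ℝ} (hT : ∀ i, IsSelfAdjoint (T i)) (hT' : IsSelfAdjoint T')
    (hb : ∀ᶠ i in l, ‖T i‖ ≤ M) (hb' : ‖T'‖ ≤ M)
    (h : ∀ f, Tendsto (fun i => T i f) l (𝓝 (T' f))) {φ : ℝ → ℝ} (hφ : Continuous φ) (f : H) :
    Tendsto (fun i => cfc φ (T i) f) l (𝓝 (cfc φ T' f)) := by
  have hpow : ∀ (k : ℕ) (f : H), Tendsto (fun i => (T i ^ k) f) l (𝓝 ((T' ^ k) f)) := by
    intro k
    induction k with
    | zero => intro f; simp [tendsto_const_nhds]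
    | succ k ih =>
      intro f
      have h1 : Tendsto (fun i => (T i ^ k) (T i f - T' f)) l (𝓝 0) := by
        have h2 : Tendsto (fun i => M ^ k * ‖T i f - T' f‖) l (𝓝 0) := by
          simpa using (tendsto_iff_norm_sub_tendsto_zero.1 (h f)).const_mul (M ^ k)
        refine squeeze_zero_norm' ?_ h2
        filter_upwards [hb] with i hi
        refine ContinuousLinearMap.le_of_opNorm_le _ ?_ _
        rcases subsingleton_or_nontrivial H with hs | hs
        · rw [Subsingleton.elim (T i ^ k) 0, norm_zero]
          have := (norm_nonneg _).trans hi
          positivity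
        · exact (norm_pow_le _ _).trans (by gcongr)
      have := h1.add (ih (T' f))
      rw [zero_add] at this
      refine this.congr fun i => ?_
      rw [map_sub, pow_succ]
      simp
  have hpoly : ∀ (p : Polynomial ℝ) (f : H),
      Tendsto (fun i => (Polynomial.aeval (T i) p) f) l (𝓝 ((Polynomial.aeval T' p) f)) := by
    intro p f
    simp only [Polynomial.aeval_eq_sum_range, sum_apply]
    refine tendsto_finsetSum _ fun k _ => ?_
    simpa using (hpow k f).const_smul (p.coeff k)
  have hspec : ∀ S : H →L[ℂ] H, IsSelfAdjoint S → ‖S‖ ≤ M → ∀ x ∈ spectrum ℝ S,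
      x ∈ Set.Icc (-M) M := by
    intro S hS hSM x hx
    rcases subsingleton_or_nontrivial H with hs | hs
    · exact absurd (isUnit_of_subsingleton _) hx
    · have := spectrum.norm_le_norm_of_mem hx
      exact abs_le.1 (this.trans hSM)
  have happrox : ∀ ε : ℝ, 0 < ε → ∃ p : Polynomial ℝ, ∀ S : H →L[ℂ] H, IsSelfAdjoint S →
      ‖S‖ ≤ M → ‖cfc φ S - Polynomial.aeval S p‖ ≤ ε := by
    intro ε hε
    obtain ⟨p, hp⟩ := exists_polynomial_near_of_continuousOn (-M) M φ hφ.continuousOn ε hε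
    refine ⟨p, fun S hS hSM => ?_⟩
    rw [← cfc_polynomial p S, ← cfc_sub φ p.eval S hφ.continuousOn p.continuous.continuousOn]
    refine norm_cfc_le hε.le fun x hx => ?_
    rw [← norm_neg, neg_sub]
    exact (hp x (hspec S hS hSM x hx)).le
  rw [Metric.tendsto_nhds]
  intro ε hε
  obtain ⟨p, hp⟩ := happrox (ε / (3 * (‖f‖ + 1))) (by positivity)
  have hf : ε / (3 * (‖f‖ + 1)) * ‖f‖ < ε / 3 := by
    have h0 := norm_nonneg f
    rw [div_mul_eq_mul_div, div_lt_div_iff₀ (by positivity) (by norm_num)]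
    nlinarith
  filter_upwards [hb, Metric.tendsto_nhds.1 (hpoly p f) (ε / 3) (by positivity)] with i hi hi'
  rw [dist_eq_norm] at *
  have b1 := ContinuousLinearMap.le_of_opNorm_le _ (hp (T i) (hT i) hi) f
  have b2 := ContinuousLinearMap.le_of_opNorm_le _ (hp T' hT' hb') f
  rw [sub_apply] at b1 b2
  have e : cfc φ (T i) f - cfc φ T' f = (cfc φ (T i) f - Polynomial.aeval (T i) p f) +
      (Polynomial.aeval (T i) p f - Polynomial.aeval T' p f) -
      (cfc φ T' f - Polynomial.aeval T' p f) := by abel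
  rw [e]
  have n1 := norm_sub_le ((cfc φ (T i) f - Polynomial.aeval (T i) p f) +
      (Polynomial.aeval (T i) p f - Polynomial.aeval T' p f))
      (cfc φ T' f - Polynomial.aeval T' p f)
  have n2 := norm_add_le (cfc φ (T i) f - Polynomial.aeval (T i) p f)
      (Polynomial.aeval (T i) p f - Polynomial.aeval T' p f)
  linarith

theorem tendsto_boseRegOp_apply {ι : Type} {l : Filter ι} {T : ι → H →L[ℂ] H} {T' : H →L[ℂ] H}
    {M : ℝ} (hT : ∀ i, IsSelfAdjoint (T i)) (hT' : IsSelfAdjoint T')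
    (hb : ∀ᶠ i in l, ‖T i‖ ≤ M) (hb' : ‖T'‖ ≤ M)
    (h : ∀ f, Tendsto (fun i => T i f) l (𝓝 (T' f))) (f : H) :
    Tendsto (fun i => boseRegOp (T i) f) l (𝓝 (boseRegOp T' f)) :=
  tendsto_cfc_apply hT hT' hb hb' h continuous_boseReg f

end Bose

/-! ### Liouville theorems on the lattice -/

/-- The sum of `u` over the `2d` translates of `x` by `± e i`. -/
def nbSum {T M : Type} [AddCommGroup T] [AddCommMonoid M] {d : ℕ} (e : Fin d → T) (u : T → M)
    (x : T) : M := ∑ i, (u (x + e i) + u (x - e i))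

/-- The standard basis of `ℤ^d`. -/
def stdStep (d : ℕ) (i : Fin d) : Fin d → ℤ := Pi.single i 1

section Abstract
variable {T : Type} [AddCommGroup T] {d : ℕ} (e : Fin d → T)

theorem nbSum_const (c : ℝ) (x : T) : nbSum e (fun _ => c) x = 2 * d * c := by
  simp [nbSum]; ring

theorem nbSum_add (u v : T → ℝ) (x : T) :
    nbSum e (fun y => u y + v y) x = nbSum e u x + nbSum e v x := by
  simp only [nbSum, ← Finset.sum_add_distrib]
  exact Finset.sum_congr rfl fun _ _ => by ring

theorem nbSum_sub (u v : T → ℝ) (x : T) :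
    nbSum e (fun y => u y - v y) x = nbSum e u x - nbSum e v x := by
  simp only [nbSum, ← Finset.sum_sub_distrib]
  exact Finset.sum_congr rfl fun _ _ => by ring

theorem nbSum_neg (u : T → ℝ) (x : T) : nbSum e (fun y => -u y) x = -nbSum e u x := by
  simp only [nbSum, ← Finset.sum_neg_distrib]
  exact Finset.sum_congr rfl fun _ _ => by ring

theorem nbSum_translate (u : T → ℝ) (a x : T) :
    nbSum e (fun y => u (y + a)) x = nbSum e u (x + a) := by
  refine Finset.sum_congr rfl fun i _ => ?_
  simp only [add_right_comm x (e i) a, sub_add_eq_add_sub x (e i) a]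

theorem nbSum_even (u : T → ℝ) (x : T) :
    nbSum e (fun y => u (-y)) x = nbSum e u (-x) := by
  refine Finset.sum_congr rfl fun i _ => ?_
  have h1 : -(x + e i) = -x - e i := by abel
  have h2 : -(x - e i) = -x + e i := by abel
  simp only [h1, h2]
  exact add_comm _ _

theorem nbSum_le {u : T → ℝ} {x : T} {M : ℝ} (h : ∀ y, u y ≤ M) :
    nbSum e u x ≤ 2 * d * M := by
  rw [← nbSum_const e M x]
  exact Finset.sum_le_sum fun i _ => add_le_add (h _) (h _)

theorem tendsto_nbSum {ι : Type} {l : Filter ι} {u : ι → T → ℝ} {u' : T → ℝ}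
    (h : ∀ x, Tendsto (fun n => u n x) l (𝓝 (u' x))) (x : T) :
    Tendsto (fun n => nbSum e (u n) x) l (𝓝 (nbSum e u' x)) :=
  tendsto_finsetSum _ fun _ _ => (h _).add (h _)

theorem exists_ultrafilter_limit {ι : Type} (U : Ultrafilter ι) {f : ι → ℝ} {B : ℝ}
    (h : ∀ᶠ i in (U : Filter ι), |f i| ≤ B) : ∃ L, |L| ≤ B ∧ Tendsto f U (𝓝 L) := by
  obtain ⟨L, hL, hlim⟩ := (isCompact_Icc (a := -B) (b := B)).ultrafilter_le_nhds' (U.map f) (by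
    rw [Ultrafilter.mem_map]
    exact h.mono fun i hi => abs_le.1 hi)
  exact ⟨L, abs_le.2 hL, hlim⟩

/-- A harmonic function that attains its maximum at `x` is equal to it at the neighbours of `x`. -/
theorem eq_of_harmonic_max {u : T → ℝ} {M : ℝ} (hu : ∀ x, u x ≤ M)
    {x : T} (hx : u x = M) (hharm : nbSum e u x = 2 * d * u x) (i : Fin d) : u (x + e i) = M := by
  have h0 : ∑ j, ((M - u (x + e j)) + (M - u (x - e j))) = 0 := by
    have : nbSum e (fun y => M - u y) x = 0 := by
      rw [nbSum_sub e (fun _ => M) u, nbSum_const, hharm, hx, sub_self]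
    exact this
  rw [Finset.sum_eq_zero_iff_of_nonneg] at h0
  · have := h0 i (Finset.mem_univ i)
    have h1 := hu (x + e i)
    have h2 := hu (x - e i)
    linarith
  · intro j _
    have h1 := hu (x + e j)
    have h2 := hu (x - e j)
    linarith

/-- A bounded harmonic function does not increase along `e i`: a limit of translates attains the
supremum of the increments, hence grows linearly. -/
theorem bounded_harmonic_step_le {h : T → ℝ} {B : ℝ} (hB : ∀ x, |h x| ≤ B)
    (hharm : ∀ x, nbSum e h x = 2 * d * h x) (i : Fin d) (x : T) : h (x + e i) - h x ≤ 0 := by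
  by_contra! hpos
  set D : T → ℝ := fun x => h (x + e i) - h x
  have hbdd : BddAbove (Set.range D) := by
    refine ⟨2 * B, ?_⟩
    rintro _ ⟨y, rfl⟩
    have h1 := (abs_le.1 (hB (y + e i))).2
    have h2 := (abs_le.1 (hB y)).1
    simp only [D]
    linarith
  set M := ⨆ y, D y
  have hM : 0 < M := hpos.trans_le (le_ciSup hbdd x)
  have hseq : ∀ k : ℕ, ∃ y, M - 1 / ((k : ℝ) + 1) < D y := fun k =>
    exists_lt_of_lt_ciSup (by have : 0 < 1 / ((k : ℝ) + 1) := by positivity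
                              linarith)
  choose y hy using hseq
  -- translates along points where the increment almost attains its supremum `M`
  set U := hyperfilter ℕ
  have hUle : (U : Filter ℕ) ≤ atTop := Nat.hyperfilter_le_atTop
  choose g hg hglim using fun z : T =>
    exists_ultrafilter_limit U (f := fun k => h (z + y k)) (B := B)
      (Eventually.of_forall fun k => hB _)
  have hgharm : ∀ z, nbSum e g z = 2 * d * g z := by
    intro z
    refine tendsto_nhds_unique (tendsto_nbSum e hglim z) ?_
    refine ((hglim z).const_mul (2 * d : ℝ)).congr fun k => ?_
    rw [← hharm, nbSum_translate]
  set E : T → ℝ := fun z => g (z + e i) - g z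
  have hElim : ∀ z, Tendsto (fun k => D (z + y k)) U (𝓝 (E z)) := by
    intro z
    refine ((hglim (z + e i)).sub (hglim z)).congr fun k => ?_
    simp only [D]
    rw [add_right_comm]
  have hEle : ∀ z, E z ≤ M := fun z =>
    le_of_tendsto (hElim z) (Eventually.of_forall fun k => le_ciSup hbdd _)
  have hE0 : E 0 = M := by
    refine le_antisymm (hEle 0) (le_of_tendsto_of_tendsto ?_ (hElim 0)
      (Eventually.of_forall fun k => ?_) (f := fun k : ℕ => M - 1 / ((k : ℝ) + 1)))
    · have := (tendsto_one_div_add_atTop_nhds_zero_nat (𝕜 := ℝ)).mono_left hUle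
      simpa using this.const_sub M
    · simpa only [zero_add] using (hy k).le
  have hEharm : ∀ z, nbSum e E z = 2 * d * E z := by
    intro z
    rw [nbSum_sub e (fun y => g (y + e i)) g, nbSum_translate, hgharm, hgharm]
    simp only [E]
    ring
  have hEall : ∀ k : ℕ, E (k • e i) = M := by
    intro k
    induction k with
    | zero => simpa using hE0
    | succ k ih =>
      rw [succ_nsmul]
      exact eq_of_harmonic_max e hEle ih (hEharm _) i
  -- attaining `M` everywhere on a ray contradicts boundedness of the limit `g`
  have hgrow : ∀ k : ℕ, g (k • e i) = g 0 + k * M := by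
    intro k
    induction k with
    | zero => simp
    | succ k ih =>
      have := hEall k
      simp only [E] at this
      rw [succ_nsmul]
      push_cast
      linarith
  obtain ⟨k, hk⟩ := exists_nat_gt (2 * B / M)
  rw [div_lt_iff₀ hM] at hk
  have h1 := (abs_le.1 (hg (k • e i))).2
  have h2 := (abs_le.1 (hg 0)).1
  have h3 := hgrow k
  linarith

theorem bounded_harmonic_step {h : T → ℝ} {B : ℝ} (hB : ∀ x, |h x| ≤ B)
    (hharm : ∀ x, nbSum e h x = 2 * d * h x) (i : Fin d) (x : T) : h (x + e i) = h x := by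
  have h1 := bounded_harmonic_step_le e hB hharm i x
  have h2 := bounded_harmonic_step_le e (h := fun x => -h x) (B := B) (by simpa using hB)
    (fun x => by rw [nbSum_neg, hharm]; ring) i x
  linarith

end Abstract

theorem sum_zsmul_stdStep {d : ℕ} (x : Fin d → ℤ) : ∑ i, x i • stdStep d i = x := by
  ext j
  simp [stdStep, Finset.sum_apply, Pi.single_apply]

theorem eq_zero_of_step_invariant {d : ℕ} {α : Type} {f : (Fin d → ℤ) → α}
    (h : ∀ x i, f (x + stdStep d i) = f x) (x : Fin d → ℤ) : f x = f 0 := by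
  have hz : ∀ (k : ℤ) (i : Fin d) (y : Fin d → ℤ), f (y + k • stdStep d i) = f y := by
    intro k i
    induction k using Int.induction_on with
    | zero => simp
    | succ k ih => intro y; rw [add_smul, one_smul, ← add_assoc, h, ih]
    | pred k ih =>
      intro y
      rw [← h _ i, sub_smul, one_smul, add_assoc, sub_add_cancel, ih]
  have hs : ∀ s : Finset (Fin d), f (∑ i ∈ s, x i • stdStep d i) = f 0 := by
    intro s
    classical
    induction s using Finset.induction_on with
    | empty => simp
    | insert i s hi ih => rw [Finset.sum_insert hi, add_comm, hz, ih]
  rw [← hs Finset.univ, sum_zsmul_stdStep]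

/-- An even harmonic function on `ℤ^d` with bounded increments is constant: by Liouville's theorem
its increments are constant, and they change sign under reflection. -/
theorem even_harmonic_const {d : ℕ} {b : (Fin d → ℤ) → ℝ} {M : ℝ}
    (hL : ∀ x i, |b (x + stdStep d i) - b x| ≤ M)
    (hharm : ∀ x, nbSum (stdStep d) b x = 2 * d * b x) (heven : ∀ x, b (-x) = b x)
    (x : Fin d → ℤ) : b x = b 0 := by
  refine eq_zero_of_step_invariant (fun x i => ?_) x
  set D : (Fin d → ℤ) → ℝ := fun x => b (x + stdStep d i) - b x
  have hDharm : ∀ z, nbSum (stdStep d) D z = 2 * d * D z := by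
    intro z
    rw [nbSum_sub _ (fun y => b (y + stdStep d i)) b, nbSum_translate, hharm, hharm]
    simp only [D]
    ring
  have hconst := eq_zero_of_step_invariant
    fun x j => bounded_harmonic_step _ (h := D) (fun x => hL x i) hDharm j x
  have h1 : D x = D 0 := hconst x
  have h2 : D (-stdStep d i) = D 0 := hconst _
  have h3 : b (-stdStep d i) = b (stdStep d i) := heven _
  simp only [D, zero_add, neg_add_cancel] at h1 h2
  linarith

theorem abs_sub_zero_le {d : ℕ} {f : (Fin d → ℤ) → ℝ}
    (hL : ∀ x i, |f (x + stdStep d i) - f x| ≤ 1) (x : Fin d → ℤ) :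
    |f x - f 0| ≤ ∑ i, |(x i : ℝ)| := by
  have hn : ∀ (k : ℕ) (i : Fin d) (y : Fin d → ℤ), |f (y + k • stdStep d i) - f y| ≤ k := by
    intro k i
    induction k with
    | zero => simp
    | succ k ih =>
      intro y
      have h1 := hL (y + k • stdStep d i) i
      have h2 := ih y
      rw [succ_nsmul, ← add_assoc]
      push_cast
      calc _ = |(f (y + k • stdStep d i + stdStep d i) - f (y + k • stdStep d i)) +
            (f (y + k • stdStep d i) - f y)| := by congr 1; ring
        _ ≤ _ := (abs_add_le _ _).trans (by linarith)
  have hz : ∀ (k : ℤ) (i : Fin d) (y : Fin d → ℤ),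
      |f (y + k • stdStep d i) - f y| ≤ |(k : ℝ)| := by
    intro k i y
    obtain ⟨m, rfl | rfl⟩ := k.eq_nat_or_neg
    · simpa using hn m i y
    · have := hn m i (y + -(m : ℤ) • stdStep d i)
      rw [add_assoc, neg_smul, natCast_zsmul, neg_add_cancel, add_zero, abs_sub_comm] at this
      simpa using this
  have hs : ∀ s : Finset (Fin d),
      |f (∑ i ∈ s, x i • stdStep d i) - f 0| ≤ ∑ i ∈ s, |(x i : ℝ)| := by
    intro s
    classical
    induction s using Finset.induction_on with
    | empty => simp
    | insert i s hi ih =>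
      rw [Finset.sum_insert hi, Finset.sum_insert hi, add_comm (x i • stdStep d i)]
      have h1 := hz (x i) i (∑ i ∈ s, x i • stdStep d i)
      calc _ = |(f ((∑ i ∈ s, x i • stdStep d i) + x i • stdStep d i) -
              f (∑ i ∈ s, x i • stdStep d i)) +
            (f (∑ i ∈ s, x i • stdStep d i) - f 0)| := by congr 1; ring
        _ ≤ _ := (abs_add_le _ _).trans (by linarith)
  simpa only [sum_zsmul_stdStep] using hs Finset.univ

/-- Convergence of potential kernels. Every ultrafilter limit of the functions `k n 0 - k n x` is
an even solution of the same Poisson equation with bounded increments, hence is unique. -/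
theorem exists_tendsto_potential {d : ℕ} {ι : Type} {l : Filter ι} [l.NeBot]
    {k : ι → (Fin d → ℤ) → ℝ} (hL : ∀ᶠ n in l, ∀ x i, |k n (x + stdStep d i) - k n x| ≤ 1)
    (heven : ∀ᶠ n in l, ∀ x, k n (-x) = k n x) {σ : (Fin d → ℤ) → ℝ}
    (hlap : ∀ x, Tendsto (fun n => 2 * d * k n x - nbSum (stdStep d) (k n) x) l (𝓝 (σ x))) :
    ∃ a : (Fin d → ℤ) → ℝ, ∀ x, Tendsto (fun n => k n 0 - k n x) l (𝓝 (a x)) := by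
  have hlim : ∀ U : Ultrafilter ι, (U : Filter ι) ≤ l → ∃ a : (Fin d → ℤ) → ℝ,
      (∀ x, Tendsto (fun n => k n 0 - k n x) U (𝓝 (a x))) ∧
      (∀ x i, |a (x + stdStep d i) - a x| ≤ 1) ∧ (∀ x, a (-x) = a x) ∧
      ∀ x, 2 * d * a x - nbSum (stdStep d) a x = -σ x := by
    intro U hU
    choose a ha ha' using fun x => exists_ultrafilter_limit U (f := fun n => k n 0 - k n x)
      (B := ∑ i, |(x i : ℝ)|) (by
        filter_upwards [hU hL] with n hn
        rw [abs_sub_comm]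
        exact abs_sub_zero_le hn x)
    refine ⟨a, ha', fun x i => ?_, fun x => ?_, fun x => ?_⟩
    · refine le_of_tendsto ((ha' (x + stdStep d i)).sub (ha' x)).abs ?_
      filter_upwards [hU hL] with n hn
      have := hn x i
      rw [abs_sub_comm] at this
      simpa using this
    · refine tendsto_nhds_unique (ha' (-x)) ((ha' x).congr' ?_)
      filter_upwards [hU heven] with n hn
      rw [hn]
    · refine tendsto_nhds_unique (((ha' x).const_mul (2 * d : ℝ)).sub
        (tendsto_nbSum (stdStep d) ha' x)) ?_
      refine ((hlap x).mono_left hU).neg.congr fun n => ?_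
      rw [nbSum_sub (stdStep d) (fun _ => k n 0) (k n), nbSum_const]
      ring
  have ha0 : ∀ U : Ultrafilter ι, ∀ a : (Fin d → ℤ) → ℝ,
      (∀ x, Tendsto (fun n => k n 0 - k n x) U (𝓝 (a x))) → a 0 = 0 := by
    intro U a h
    refine tendsto_nhds_unique (h 0) ?_
    simp
  obtain ⟨a, halim, haL, hae, hal⟩ := hlim (Ultrafilter.of l) (Ultrafilter.of_le l)
  refine ⟨a, fun x => ?_⟩
  rw [tendsto_iff_ultrafilter]
  intro U hU
  obtain ⟨a', halim', haL', hae', hal'⟩ := hlim U hU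
  have hb := even_harmonic_const (b := fun x => a' x - a x) (M := 2) (fun x i => by
      have h1 := abs_le.1 (haL x i)
      have h2 := abs_le.1 (haL' x i)
      rw [abs_le]
      constructor <;> linarith)
    (fun x => by
      rw [nbSum_sub]
      have h1 := hal x
      have h2 := hal' x
      linarith)
    (fun x => by rw [hae, hae']) x
  rw [ha0 _ a halim, ha0 _ a' halim'] at hb
  have : a x = a' x := by linarith
  rw [this]
  exact halim' x

/-! ### Green functions on finite abelian groups -/

section Green
variable {T : Type} [AddCommGroup T] {d : ℕ} (e : Fin d → T)

open Classical in
/-- `K` is the Green function at the origin of `ρ - Δ`, for the graph Laplacian `Δ` of the steps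
`± e i`. -/
def IsGreen (ρ : ℝ) (K : T → ℝ) : Prop :=
  ∀ x, (ρ + 2 * d) * K x - nbSum e K x = if x = 0 then 1 else 0

theorem maximum_principle [Finite T] {ρ : ℝ} (hρ : 0 < ρ) {u : T → ℝ} (S : Set T)
    (h : ∀ x, x ∉ S → (ρ + 2 * d) * u x - nbSum e u x ≤ 0) (x : T) :
    u x ≤ 0 ∨ ∃ y ∈ S, u x ≤ u y := by
  obtain ⟨y, hy⟩ := Finite.exists_max u
  by_cases hyS : y ∈ S
  · exact Or.inr ⟨y, hyS, hy x⟩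
  · left
    have h1 := h y hyS
    have h2 := nbSum_le e (x := y) hy
    have h3 : ρ * u y ≤ 0 := by linarith
    exact (hy x).trans (nonpos_of_mul_nonpos_right h3 hρ)

theorem exists_isGreen [Finite T] {ρ : ℝ} (hρ : 0 < ρ) : ∃ K, IsGreen e ρ K := by
  classical
  have := Fintype.ofFinite T
  let L : (T → ℝ) →ₗ[ℝ] (T → ℝ) :=
    { toFun := fun u x => (ρ + 2 * d) * u x - nbSum e u x
      map_add' := fun u v => by
        ext x
        have := nbSum_add e u v x
        simp only [Pi.add_apply]
        rw [show u + v = fun y => u y + v y from rfl, this]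
        ring
      map_smul' := fun c u => by
        ext x
        have : nbSum e (c • u) x = c * nbSum e u x := by
          simp [nbSum, Finset.mul_sum, mul_add]
        simp only [Pi.smul_apply, smul_eq_mul, this, RingHom.id_apply]
        ring }
  have hinj : Function.Injective L := by
    rw [injective_iff_map_eq_zero]
    intro u hu
    have hu' : ∀ x, (ρ + 2 * d) * u x - nbSum e u x = 0 := fun x => congrFun hu x
    ext x
    have h1 := maximum_principle e hρ (u := u) ∅ (fun x _ => (hu' x).le) x
    have h2 := maximum_principle e hρ (u := fun x => -u x) ∅ (fun x _ => by
      rw [nbSum_neg]; linarith [hu' x]) x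
    simp only [Set.mem_empty_iff_false, false_and, exists_false, or_false] at h1 h2
    simp only [Pi.zero_apply]
    linarith
  obtain ⟨K, hK⟩ := LinearMap.injective_iff_surjective.1 hinj fun x => if x = 0 then 1 else 0
  refine ⟨K, fun x => (show _ = L K x from rfl).trans ((congrFun hK x).trans ?_)⟩
  congr

variable {e} {ρ : ℝ} {K : T → ℝ}

theorem IsGreen.nonneg [Finite T] (hK : IsGreen e ρ K) (hρ : 0 < ρ) (x : T) : 0 ≤ K x := by
  have h := maximum_principle e hρ (u := fun x => -K x) ∅ (fun x _ => by
    have := hK x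
    rw [nbSum_neg]
    split_ifs at this <;> linarith) x
  simp only [Set.mem_empty_iff_false, false_and, exists_false, or_false] at h
  linarith

theorem IsGreen.le_zero [Finite T] (hK : IsGreen e ρ K) (hρ : 0 < ρ) (x : T) : K x ≤ K 0 := by
  rcases maximum_principle e hρ (u := K) {0} (fun x hx => by
    have := hK x
    rw [if_neg (by simpa using hx)] at this
    exact this.le) x with h | ⟨y, rfl, h⟩
  · exact h.trans (hK.nonneg hρ 0)
  · exact h

theorem IsGreen.unique [Finite T] {K' : T → ℝ} (hK : IsGreen e ρ K) (hK' : IsGreen e ρ K')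
    (hρ : 0 < ρ) (x : T) : K x = K' x := by
  have key : ∀ {K K' : T → ℝ}, IsGreen e ρ K → IsGreen e ρ K' → K x ≤ K' x := by
    intro K K' hK hK'
    have h := maximum_principle e hρ (u := fun x => K x - K' x) ∅ (fun x _ => by
      have h1 := hK x
      have h2 := hK' x
      rw [nbSum_sub]
      linarith) x
    simp only [Set.mem_empty_iff_false, false_and, exists_false, or_false] at h
    linarith
  exact le_antisymm (key hK hK') (key hK' hK)

theorem IsGreen.even [Finite T] (hK : IsGreen e ρ K) (hρ : 0 < ρ) (x : T) : K (-x) = K x := by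
  refine IsGreen.unique (e := e) (K := fun y => K (-y)) (fun y => ?_) hK hρ x
  rw [nbSum_even, hK]
  by_cases hy : y = 0 <;> simp [hy]

/-- The equation at the origin bounds the increments of the Green function there. -/
theorem IsGreen.zero_sub_le [Finite T] (hK : IsGreen e ρ K) (hρ : 0 < ρ) (i : Fin d) :
    K 0 - K (e i) ≤ 1 := by
  have h0 := hK 0
  have hsum : ∑ j, ((K 0 - K (0 + e j)) + (K 0 - K (0 - e j))) = 1 - ρ * K 0 := by
    have : nbSum e (fun y => K 0 - K y) 0 = 1 - ρ * K 0 := by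
      rw [nbSum_sub e (fun _ => K 0) K, nbSum_const]
      simp only [if_true] at h0
      linarith
    exact this
  have h1 := Finset.single_le_sum (f := fun j => (K 0 - K (0 + e j)) + (K 0 - K (0 - e j)))
    (fun j _ => add_nonneg (sub_nonneg.2 (hK.le_zero hρ _)) (sub_nonneg.2 (hK.le_zero hρ _)))
    (Finset.mem_univ i)
  have h2 := hK.le_zero hρ (0 - e i)
  have h3 := mul_nonneg hρ.le (hK.nonneg hρ 0)
  rw [hsum] at h1
  simp only [zero_add] at h1
  linarith

/-- The increment of the Green function along a step is a dipole potential, which is extremal at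
its two poles. -/
theorem IsGreen.step_le [Finite T] (hK : IsGreen e ρ K) (hρ : 0 < ρ) (x : T) (i : Fin d) :
    |K (x + e i) - K x| ≤ 1 := by
  have hi := hK.zero_sub_le hρ i
  have hlap : ∀ x, (ρ + 2 * d) * (K x - K (x + e i)) - nbSum e (fun y => K y - K (y + e i)) x =
      ((ρ + 2 * d) * K x - nbSum e K x) - ((ρ + 2 * d) * K (x + e i) - nbSum e K (x + e i)) := by
    intro x
    rw [nbSum_sub e K fun y => K (y + e i), nbSum_translate]
    ring
  rw [abs_sub_comm, abs_le]
  constructor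
  · rcases maximum_principle e hρ (u := fun x => -(K x - K (x + e i))) {-e i} (fun x hx => by
      rw [nbSum_neg e fun y => K y - K (y + e i)]
      have h1 := hlap x
      have h2 : x + e i ≠ 0 := fun h => hx (eq_neg_of_add_eq_zero_left h)
      rw [hK, hK, if_neg h2] at h1
      split_ifs at h1 <;> linarith) x with h | ⟨y, rfl, h⟩
    · linarith
    · rw [neg_add_cancel, hK.even hρ] at h
      linarith
  · rcases maximum_principle e hρ (u := fun x => K x - K (x + e i)) {0} (fun x hx => by
      have h1 := hlap x
      rw [hK, hK, if_neg (by simpa using hx)] at h1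
      split_ifs at h1 <;> linarith) x with h | ⟨y, rfl, h⟩
    · linarith
    · rw [zero_add] at h
      linarith

theorem sum_nbSum [Fintype T] (u : T → ℝ) : ∑ x, nbSum e u x = 2 * d * ∑ x, u x := by
  simp only [nbSum]
  rw [Finset.sum_comm]
  have : ∀ i : Fin d, ∑ x, (u (x + e i) + u (x - e i)) = 2 * ∑ x, u x := by
    intro i
    have h1 : ∑ x, u (x + e i) = ∑ x, u x := Equiv.sum_comp (Equiv.addRight (e i)) u
    have h2 : ∑ x, u (x - e i) = ∑ x, u x := Equiv.sum_comp (Equiv.subRight (e i)) u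
    rw [Finset.sum_add_distrib, h1, h2]
    ring
  simp only [this]
  simp
  ring

theorem IsGreen.sum [Fintype T] (hK : IsGreen e ρ K) : ρ * ∑ x, K x = 1 := by
  classical
  have h : ∑ x, ((ρ + 2 * d) * K x - nbSum e K x) = ∑ x : T, if x = 0 then (1 : ℝ) else 0 :=
    Finset.sum_congr rfl fun x _ => by convert hK x
  rw [Finset.sum_sub_distrib, ← Finset.mul_sum, sum_nbSum, Finset.sum_ite_eq' Finset.univ (0 : T)]
    at h
  simp only [Finset.mem_univ, if_true] at h
  linarith

/-- Summation by parts. -/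
theorem sum_mul_laplacian [Fintype T] (u v : T → ℝ) :
    ∑ x, u x * ((ρ + 2 * d) * v x - nbSum e v x) =
      ρ * ∑ x, u x * v x + ∑ i, ∑ x, (u (x + e i) - u x) * (v (x + e i) - v x) := by
  have h : ∀ i, ∑ x, (u (x + e i) - u x) * (v (x + e i) - v x) =
      2 * ∑ x, u x * v x - ∑ x, u x * (v (x + e i) + v (x - e i)) := by
    intro i
    have h1 : ∑ x, u (x + e i) * v (x + e i) = ∑ x, u x * v x :=
      Equiv.sum_comp (Equiv.addRight (e i)) fun x => u x * v x
    have h2 : ∑ x, u (x + e i) * v x = ∑ x, u x * v (x - e i) := by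
      rw [← Equiv.sum_comp (Equiv.addRight (e i)) fun x => u x * v (x - e i)]
      simp
    have h3 : ∀ x, (u (x + e i) - u x) * (v (x + e i) - v x) =
        u (x + e i) * v (x + e i) - u (x + e i) * v x - u x * v (x + e i) + u x * v x :=
      fun x => by ring
    simp only [h3, mul_add, Finset.sum_add_distrib, Finset.sum_sub_distrib, h1, h2]
    ring
  have h4 : ∑ x, u x * nbSum e v x = ∑ i, ∑ x, u x * (v (x + e i) + v (x - e i)) := by
    simp only [nbSum, Finset.mul_sum]
    rw [Finset.sum_comm]
  have h5 : ∀ x, u x * ((ρ + 2 * d) * v x - nbSum e v x) =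
      (ρ + 2 * d) * (u x * v x) - u x * nbSum e v x := fun x => by ring
  simp only [h5, h, Finset.sum_sub_distrib, ← Finset.mul_sum, h4]
  simp
  ring

theorem IsGreen.zero_pos [Finite T] (hK : IsGreen e ρ K) (hρ : 0 < ρ) : 0 < K 0 := by
  have h := hK 0
  rw [if_pos rfl] at h
  have h2 : 0 ≤ nbSum e K 0 :=
    Finset.sum_nonneg fun i _ => add_nonneg (hK.nonneg hρ _) (hK.nonneg hρ _)
  by_contra h3
  have h4 : (ρ + 2 * d) * K 0 ≤ 0 := mul_nonpos_of_nonneg_of_nonpos (by positivity) (not_lt.1 h3)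
  linarith

/-- The Dirichlet principle for the value of the Green function at its pole. -/
theorem IsGreen.sq_le [Fintype T] (hK : IsGreen e ρ K) (hρ : 0 < ρ) (f : T → ℝ) :
    f 0 ^ 2 ≤ K 0 * (ρ * ∑ x, f x ^ 2 + ∑ i, ∑ x, (f (x + e i) - f x) ^ 2) := by
  classical
  have hpair : ∀ g : T → ℝ, ∑ x, g x * ((ρ + 2 * d) * K x - nbSum e K x) = g 0 := by
    intro g
    have : ∀ x, g x * ((ρ + 2 * d) * K x - nbSum e K x) = if x = 0 then g x else 0 := by
      intro x
      rw [hK x]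
      split_ifs <;> simp
    simp [this]
  have h1 := (sum_mul_laplacian (e := e) (ρ := ρ) f K).symm.trans (hpair f)
  have h2 := (sum_mul_laplacian (e := e) (ρ := ρ) K K).symm.trans (hpair K)
  set Q := ρ * ∑ x, f x ^ 2 + ∑ i, ∑ x, (f (x + e i) - f x) ^ 2 with hQ
  have hpos := hK.zero_pos hρ
  -- positivity of the energy of `f - t K`
  have key : ∀ t : ℝ, 0 ≤ Q - 2 * t * f 0 + t ^ 2 * K 0 := by
    intro t
    have h3 : 0 ≤ ρ * ∑ x, (f x - t * K x) ^ 2 +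
        ∑ i, ∑ x, ((f (x + e i) - t * K (x + e i)) - (f x - t * K x)) ^ 2 := by positivity
    have e1 : ∀ x, (f x - t * K x) ^ 2 =
        f x ^ 2 - 2 * t * (f x * K x) + t ^ 2 * (K x * K x) := fun x => by ring
    have e2 : ∀ i x, ((f (x + e i) - t * K (x + e i)) - (f x - t * K x)) ^ 2 =
        (f (x + e i) - f x) ^ 2 - 2 * t * ((f (x + e i) - f x) * (K (x + e i) - K x)) +
          t ^ 2 * ((K (x + e i) - K x) * (K (x + e i) - K x)) := fun i x => by ring
    simp only [e1, e2, Finset.sum_add_distrib, Finset.sum_sub_distrib, ← Finset.mul_sum] at h3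
    rw [← h1, ← h2, hQ]
    linarith
  -- the minimum of the quadratic polynomial in `t`
  have h4 := key (f 0 / K 0)
  have h5 : Q - 2 * (f 0 / K 0) * f 0 + (f 0 / K 0) ^ 2 * K 0 = Q - f 0 ^ 2 / K 0 := by
    field_simp
    ring
  rw [h5, sub_nonneg, div_le_iff₀ hpos] at h4
  linarith

end Green

/-! ### The discrete torus -/

/-- The standard generators of `(ℤ / N)^d`. -/
def torusStep (d N : ℕ) (i : Fin d) : Fin d → ZMod N := Pi.single i 1

/-- The distance to the origin in the torus `(ℤ / N)^d`, in the maximum norm. -/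
def torusNorm {d N : ℕ} (x : Fin d → ZMod N) : ℕ :=
  Finset.univ.sup fun i => (x i).valMinAbs.natAbs

section TorusNorm
variable {d N : ℕ}

theorem torusNorm_le_iff {x : Fin d → ZMod N} {k : ℕ} :
    torusNorm x ≤ k ↔ ∀ i, (x i).valMinAbs.natAbs ≤ k := by
  simp [torusNorm, Finset.sup_le_iff]

theorem natAbs_valMinAbs_one_le [NeZero N] : (1 : ZMod N).valMinAbs.natAbs ≤ 1 := by
  rcases Nat.lt_or_ge 1 N with h | h
  · have : ((1 : ℕ) : ZMod N).valMinAbs = (1 : ℕ) :=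
      ZMod.valMinAbs_natCast_of_le_half (by omega)
    rw [Nat.cast_one] at this
    simp [this]
  · have := ZMod.natAbs_valMinAbs_le (1 : ZMod N)
    omega

theorem torusNorm_add_step_le [NeZero N] (x : Fin d → ZMod N) (i : Fin d) :
    torusNorm (x + torusStep d N i) ≤ torusNorm x + 1 := by
  rw [torusNorm_le_iff]
  intro j
  have h0 : (x j).valMinAbs.natAbs ≤ torusNorm x := torusNorm_le_iff.1 le_rfl j
  rcases eq_or_ne j i with rfl | hj
  · have h1 := ZMod.natAbs_valMinAbs_add_le (x j) 1
    have h2 := natAbs_valMinAbs_one_le (N := N)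
    have h3 := Int.natAbs_add_le (x j).valMinAbs (1 : ZMod N).valMinAbs
    simp only [torusStep, Pi.add_apply, Pi.single_eq_same]
    omega
  · simp only [torusStep, Pi.add_apply, Pi.single_eq_of_ne hj, add_zero]
    omega

theorem torusNorm_neg (x : Fin d → ZMod N) : torusNorm (-x) = torusNorm x := by
  simp only [torusNorm, Pi.neg_apply, ZMod.natAbs_valMinAbs_neg]

theorem torusNorm_le_add_step [NeZero N] (x : Fin d → ZMod N) (i : Fin d) :
    torusNorm x ≤ torusNorm (x + torusStep d N i) + 1 := by
  have h := torusNorm_add_step_le (-(x + torusStep d N i)) i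
  rw [torusNorm_neg, neg_add, neg_add_cancel_right, torusNorm_neg] at h
  exact h

theorem card_valMinAbs_le [NeZero N] (k : ℕ) :
    (Finset.univ.filter fun a : ZMod N => a.valMinAbs.natAbs ≤ k).card ≤ 2 * k + 1 := by
  have : (Finset.Icc (-(k : ℤ)) k).card = 2 * k + 1 := by
    rw [Int.card_Icc]; omega
  rw [← this]
  refine Finset.card_le_card_of_injOn ZMod.valMinAbs (fun a ha => ?_)
    (ZMod.injective_valMinAbs.injOn)
  have := (Finset.mem_filter.1 ha).2
  simp only [Finset.coe_Icc, Set.mem_Icc]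
  omega

theorem card_valMinAbs_eq [NeZero N] (k : ℕ) :
    (Finset.univ.filter fun a : ZMod N => a.valMinAbs.natAbs = k).card ≤ 2 := by
  refine (Finset.card_le_card_of_injOn (t := {(k : ℤ), -(k : ℤ)}) ZMod.valMinAbs (fun a ha => ?_)
    (ZMod.injective_valMinAbs.injOn)).trans Finset.card_le_two
  have := (Finset.mem_filter.1 ha).2
  simp only [Finset.coe_insert, Finset.coe_singleton, Set.mem_insert_iff, Set.mem_singleton_iff]
  omega

theorem card_torusNorm_le [NeZero N] (k : ℕ) :
    (Finset.univ.filter fun x : Fin d → ZMod N => torusNorm x ≤ k).card ≤ (2 * k + 1) ^ d := by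
  have e : (Finset.univ.filter fun x : Fin d → ZMod N => torusNorm x ≤ k) =
      Fintype.piFinset fun _ : Fin d => Finset.univ.filter fun a : ZMod N =>
        a.valMinAbs.natAbs ≤ k := by
    ext x
    simp [torusNorm_le_iff]
  rw [e, Fintype.card_piFinset, Finset.prod_const, Finset.card_fin]
  exact Nat.pow_le_pow_left (card_valMinAbs_le k) d

/-- In dimension at most two, spheres grow at most linearly with their radius. -/
theorem card_torusNorm_eq [NeZero N] (hd : d = 1 ∨ d = 2) (k : ℕ) :
    (Finset.univ.filter fun x : Fin d → ZMod N => torusNorm x = k).card ≤ 8 * (k + 1) := by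
  classical
  have hsub : (Finset.univ.filter fun x : Fin d → ZMod N => torusNorm x = k) ⊆
      Finset.univ.biUnion fun i : Fin d => Fintype.piFinset fun j =>
        if j = i then Finset.univ.filter fun a : ZMod N => a.valMinAbs.natAbs = k
        else Finset.univ.filter fun a : ZMod N => a.valMinAbs.natAbs ≤ k := by
    intro x hx
    have hx' : torusNorm x = k := (Finset.mem_filter.1 hx).2
    have hne : (Finset.univ : Finset (Fin d)).Nonempty :=
      ⟨⟨0, by omega⟩, Finset.mem_univ _⟩
    obtain ⟨i, -, hi⟩ := Finset.exists_mem_eq_sup _ hne fun i => (x i).valMinAbs.natAbs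
    rw [Finset.mem_biUnion]
    refine ⟨i, Finset.mem_univ _, ?_⟩
    rw [Fintype.mem_piFinset]
    intro j
    split_ifs with hj
    · subst hj
      simpa using hi.symm.trans hx'
    · simpa using torusNorm_le_iff.1 hx'.le j
  refine (Finset.card_le_card hsub).trans (Finset.card_biUnion_le.trans ?_)
  simp only [Fintype.card_piFinset]
  have h1 := card_valMinAbs_eq (N := N) k
  have h2 := card_valMinAbs_le (N := N) k
  have h3 := Nat.mul_le_mul h1 h2
  rcases hd with rfl | rfl
  · simp
    omega
  · simp [Fin.sum_univ_two, Fin.prod_univ_two]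
    rw [mul_comm] at h3
    have h4 := mul_comm (Finset.univ.filter fun a : ZMod N => a.valMinAbs.natAbs = k).card
      (Finset.univ.filter fun a : ZMod N => a.valMinAbs.natAbs ≤ k).card
    rw [h4]
    omega

end TorusNorm

/-! ### Recurrence -/

/-- The harmonic numbers, as reals. -/
noncomputable def harm (m : ℕ) : ℝ := ∑ j ∈ Finset.range m, 1 / ((j : ℝ) + 1)

theorem tendsto_harm : Tendsto harm atTop atTop :=
  Real.tendsto_sum_range_one_div_nat_succ_atTop

theorem harm_mono : Monotone harm := fun a b h =>
  Finset.sum_le_sum_of_subset_of_nonneg (Finset.range_mono h) fun _ _ _ => by positivity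

theorem harm_succ (m : ℕ) : harm (m + 1) = harm m + 1 / ((m : ℝ) + 1) := Finset.sum_range_succ _ _

/-- The logarithmic cutoff, equal to `1` at `0` and to `0` from `m` on. -/
noncomputable def logCutoff (m k : ℕ) : ℝ := 1 - harm (min k m) / harm m

theorem logCutoff_step {m : ℕ} (hm : 0 < harm m) (k : ℕ) :
    |logCutoff m (k + 1) - logCutoff m k| ≤
      if k < m then 1 / harm m * (1 / ((k : ℝ) + 1)) else 0 := by
  split_ifs with h
  · rw [logCutoff, logCutoff, min_eq_left h, min_eq_left h.le, harm_succ, abs_le]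
    have h1 : 0 ≤ 1 / harm m * (1 / ((k : ℝ) + 1)) := by positivity
    have h2 : (harm k + 1 / ((k : ℝ) + 1)) / harm m - harm k / harm m =
      1 / harm m * (1 / ((k : ℝ) + 1)) := by field_simp; ring
    constructor <;> linarith
  · push Not at h
    rw [logCutoff, logCutoff, min_eq_right h, min_eq_right (by omega)]
    simp

/-- Between neighbouring spheres the logarithmic cutoff changes by at most the inverse radius. -/
theorem logCutoff_sub_le {m : ℕ} (hm : 0 < harm m) {k k' : ℕ} (h1 : k' ≤ k + 1) (h2 : k ≤ k' + 1) :
    (logCutoff m k' - logCutoff m k) ^ 2 ≤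
      if k ≤ m then 4 / harm m ^ 2 * (1 / ((k : ℝ) + 1) ^ 2) else 0 := by
  have hpos : (0 : ℝ) < (k : ℝ) + 1 := by positivity
  have hgoal : ∀ a : ℝ, |a| ≤ 2 / harm m * (1 / ((k : ℝ) + 1)) →
      a ^ 2 ≤ 4 / harm m ^ 2 * (1 / ((k : ℝ) + 1) ^ 2) := by
    intro a ha
    calc a ^ 2 = |a| ^ 2 := (sq_abs a).symm
      _ ≤ (2 / harm m * (1 / ((k : ℝ) + 1))) ^ 2 := by gcongr
      _ = _ := by field_simp; norm_num
  have hcases : k' = k ∨ k' = k + 1 ∨ k = k' + 1 := by omega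
  rcases hcases with rfl | rfl | rfl
  · rw [sub_self]
    split_ifs
    · simpa using hgoal 0 (by rw [abs_zero]; positivity)
    · simp
  · have h := logCutoff_step hm k
    split_ifs at h with hk
    · rw [if_pos hk.le]
      refine hgoal _ (h.trans ?_)
      gcongr
      norm_num
    · have h0 : logCutoff m (k + 1) - logCutoff m k = 0 := abs_nonpos_iff.1 h
      rw [h0]
      split_ifs
      · simpa using hgoal 0 (by rw [abs_zero]; positivity)
      · simp
  · have h := logCutoff_step hm k'
    rw [abs_sub_comm] at h
    split_ifs at h with hk
    · rw [if_pos (by omega : k' + 1 ≤ m)]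
      refine hgoal _ (h.trans ?_)
      have : (0 : ℝ) < (k' : ℝ) + 1 := by positivity
      push_cast
      rw [div_mul_div_comm, div_mul_div_comm, div_le_div_iff₀ (by positivity) (by positivity)]
      nlinarith
    · rw [if_neg (by omega), abs_nonpos_iff.1 h]
      simp

/-- Recurrence of the lattices of dimension one and two, in quantitative form: the logarithmic
cutoff has small Dirichlet energy. -/
theorem IsGreen.one_le {d N : ℕ} [NeZero N] (hd : d = 1 ∨ d = 2) {ρ : ℝ} (hρ : 0 < ρ)
    {K : (Fin d → ZMod N) → ℝ} (hK : IsGreen (torusStep d N) ρ K) {m : ℕ} (hm : 1 ≤ harm m) :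
    1 ≤ K 0 * (ρ * (2 * m + 1) ^ d + 128 / harm m) := by
  have hm0 : 0 < harm m := by linarith
  have hm1 : m ≠ 0 := by
    rintro rfl
    simp [harm] at hm0
  have hmono : ∀ k, 0 ≤ logCutoff m k ∧ logCutoff m k ≤ 1 := by
    intro k
    rw [logCutoff]
    have h1 : harm (min k m) ≤ harm m := harm_mono (min_le_right _ _)
    have h2 : 0 ≤ harm (min k m) := Finset.sum_nonneg fun _ _ => by positivity
    have h3 : harm (min k m) / harm m ≤ 1 := (div_le_one hm0).2 h1
    have h4 : 0 ≤ harm (min k m) / harm m := by positivity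
    constructor <;> linarith
  have h := hK.sq_le hρ fun x => logCutoff m (torusNorm x)
  have hz : torusNorm (0 : Fin d → ZMod N) = 0 := by
    have : torusNorm (0 : Fin d → ZMod N) ≤ 0 := torusNorm_le_iff.2 fun i => by simp
    omega
  have e0 : logCutoff m 0 = 1 := by simp [logCutoff, harm]
  simp only [hz, e0, one_pow] at h
  refine h.trans ?_
  have hK0 := hK.nonneg hρ 0
  have hsq : ∑ x : Fin d → ZMod N, logCutoff m (torusNorm x) ^ 2 ≤ (2 * m + 1) ^ d := by
    have h1 : ∀ x : Fin d → ZMod N, logCutoff m (torusNorm x) ^ 2 ≤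
        if torusNorm x ≤ m then 1 else 0 := by
      intro x
      split_ifs with hx
      · exact pow_le_one₀ (hmono _).1 (hmono _).2
      · rw [logCutoff, min_eq_right (by omega), div_self hm0.ne']
        simp
    refine (Finset.sum_le_sum fun x _ => h1 x).trans ?_
    rw [Finset.sum_boole]
    exact_mod_cast card_torusNorm_le (d := d) (N := N) m
  -- the sphere of radius `k` has at most `8 (k + 1)` points, each with energy `O((k + 1)⁻²)`; the
  -- resulting harmonic sum is of order `harm m`, against the normalization `(harm m)⁻²`
  have hshell : ∑ x : Fin d → ZMod N,
      (if torusNorm x ≤ m then 4 / harm m ^ 2 * (1 / ((torusNorm x : ℝ) + 1) ^ 2) else 0) ≤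
      64 / harm m := by
    have e1 : ∀ x : Fin d → ZMod N,
        (if torusNorm x ≤ m then 4 / harm m ^ 2 * (1 / ((torusNorm x : ℝ) + 1) ^ 2) else 0) =
        ∑ k ∈ Finset.range (m + 1),
          if torusNorm x = k then 4 / harm m ^ 2 * (1 / ((k : ℝ) + 1) ^ 2) else 0 := by
      intro x
      rw [Finset.sum_ite_eq]
      simp
    simp only [e1]
    rw [Finset.sum_comm]
    have e2 : ∀ k ∈ Finset.range (m + 1), ∑ x : Fin d → ZMod N,
        (if torusNorm x = k then 4 / harm m ^ 2 * (1 / ((k : ℝ) + 1) ^ 2) else 0) ≤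
        32 / harm m ^ 2 * (1 / ((k : ℝ) + 1)) := by
      intro k _
      rw [← Finset.sum_filter, Finset.sum_const, nsmul_eq_mul]
      have h1 : ((Finset.univ.filter fun x : Fin d → ZMod N => torusNorm x = k).card : ℝ) ≤
          8 * (k + 1) := by exact_mod_cast card_torusNorm_eq hd k
      calc _ ≤ 8 * ((k : ℝ) + 1) * (4 / harm m ^ 2 * (1 / ((k : ℝ) + 1) ^ 2)) := by gcongr
        _ = _ := by field_simp; norm_num
    refine (Finset.sum_le_sum e2).trans ?_
    rw [← Finset.mul_sum]
    have h1 : ∑ k ∈ Finset.range (m + 1), 1 / ((k : ℝ) + 1) ≤ 2 * harm m := by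
      have h2 : harm (m + 1) = harm m + 1 / ((m : ℝ) + 1) := harm_succ m
      have h3 : 1 / ((m : ℝ) + 1) ≤ 1 := by
        rw [div_le_one (by positivity)]
        linarith [(Nat.cast_nonneg m : (0 : ℝ) ≤ m)]
      change harm (m + 1) ≤ _
      linarith
    calc _ ≤ 32 / harm m ^ 2 * (2 * harm m) := by gcongr
      _ = _ := by field_simp; norm_num
  have henergy : ∑ i, ∑ x : Fin d → ZMod N,
      (logCutoff m (torusNorm (x + torusStep d N i)) - logCutoff m (torusNorm x)) ^ 2 ≤
      128 / harm m := by
    have h1 : ∀ i ∈ (Finset.univ : Finset (Fin d)), ∑ x : Fin d → ZMod N,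
        (logCutoff m (torusNorm (x + torusStep d N i)) - logCutoff m (torusNorm x)) ^ 2 ≤
        64 / harm m := fun i _ =>
      (Finset.sum_le_sum fun x _ => logCutoff_sub_le hm0 (torusNorm_add_step_le x i)
        (torusNorm_le_add_step x i)).trans hshell
    refine (Finset.sum_le_sum h1).trans ?_
    rw [Finset.sum_const, Finset.card_fin, nsmul_eq_mul]
    have hd2 : (d : ℝ) ≤ 2 := by
      rcases hd with rfl | rfl <;> norm_num
    calc (d : ℝ) * (64 / harm m) ≤ 2 * (64 / harm m) := by gcongr
      _ = _ := by ring
  gcongr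

/-- In dimensions one and two the torus Green function at the origin diverges as the mass vanishes,
whatever the size of the torus. -/
theorem tendsto_green_zero {d : ℕ} (hd : d = 1 ∨ d = 2) {ι : Type} {l : Filter ι} {N : ι → ℕ}
    [∀ n, NeZero (N n)] {ρ : ι → ℝ} (hρ : ∀ᶠ n in l, 0 < ρ n) (hρ0 : Tendsto ρ l (𝓝 0))
    {K : ∀ n, (Fin d → ZMod (N n)) → ℝ} (hK : ∀ᶠ n in l, IsGreen (torusStep d (N n)) (ρ n) (K n)) :
    Tendsto (fun n => K n 0) l atTop := by
  rw [tendsto_atTop]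
  intro B
  set B' := max B 1 with hB'
  have hB1 : (1 : ℝ) ≤ B' := le_max_right _ _
  obtain ⟨m, hm⟩ := (tendsto_harm.eventually_ge_atTop (256 * B')).exists
  have hsmall : ∀ᶠ n in l, ρ n * (2 * m + 1) ^ d < 1 / (2 * B') := by
    have : Tendsto (fun n => ρ n * (2 * (m : ℝ) + 1) ^ d) l (𝓝 0) := by
      simpa using hρ0.mul_const ((2 * (m : ℝ) + 1) ^ d)
    exact this.eventually (gt_mem_nhds (by positivity))
  filter_upwards [hρ, hK, hsmall] with n h1 h2 h3
  have h4 := h2.one_le hd h1 (m := m) (by linarith)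
  have h5 : 128 / harm m ≤ 1 / (2 * B') := by
    rw [div_le_div_iff₀ (by linarith) (by positivity)]
    linarith
  have h6 := h2.nonneg h1 0
  have h7 : 1 ≤ K n 0 * (1 / (2 * B') + 1 / (2 * B')) := h4.trans (by gcongr)
  have h8 : K n 0 * (1 / (2 * B') + 1 / (2 * B')) = K n 0 / B' := by field_simp; norm_num
  rw [h8, le_div_iff₀ (by positivity), one_mul] at h7
  exact (le_max_left _ _).trans h7

/-! ### Potential kernels of large tori -/

/-- The projection of `ℤ^d` to the torus `(ℤ / N)^d`. -/
def torusProj (d N : ℕ) (x : Fin d → ℤ) : Fin d → ZMod N := fun i => (x i : ZMod N)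

section TorusProj
variable {d N : ℕ}

theorem torusProj_zero : torusProj d N 0 = 0 := by ext; simp [torusProj]

theorem torusProj_neg (x : Fin d → ℤ) : torusProj d N (-x) = -torusProj d N x := by
  ext; simp [torusProj]

theorem torusProj_sub (x y : Fin d → ℤ) :
    torusProj d N (x - y) = torusProj d N x - torusProj d N y := by
  ext; simp [torusProj]

theorem torusProj_add (x y : Fin d → ℤ) :
    torusProj d N (x + y) = torusProj d N x + torusProj d N y := by
  ext; simp [torusProj]

theorem torusProj_step (i : Fin d) : torusProj d N (stdStep d i) = torusStep d N i := by
  ext j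
  rcases eq_or_ne j i with rfl | hj
  · simp [torusProj, stdStep, torusStep]
  · simp [torusProj, stdStep, torusStep, hj]

theorem nbSum_torusProj (K : (Fin d → ZMod N) → ℝ) (x : Fin d → ℤ) :
    nbSum (stdStep d) (fun y => K (torusProj d N y)) x =
      nbSum (torusStep d N) K (torusProj d N x) := by
  simp only [nbSum, torusProj_add, torusProj_sub, torusProj_step]

theorem eventually_torusProj_ne_zero {ι : Type} {l : Filter ι} {N : ι → ℕ}
    (hN : Tendsto N l atTop) {x : Fin d → ℤ} (hx : x ≠ 0) :
    ∀ᶠ n in l, torusProj d (N n) x ≠ 0 := by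
  obtain ⟨i, hi⟩ := Function.ne_iff.1 hx
  filter_upwards [hN.eventually_gt_atTop (x i).natAbs] with n hn h
  have h1 : ((x i : ℤ) : ZMod (N n)) = 0 := congrFun h i
  rw [ZMod.intCast_zmod_eq_zero_iff_dvd] at h1
  exact hi (Int.eq_zero_of_abs_lt_dvd h1 (by rw [Int.abs_eq_natAbs]; exact_mod_cast hn))

/-- The Green function has total mass `1 / ρ` and bounded increments, so that its value at the pole
cannot be of order `1 / ρ`. -/
theorem IsGreen.mul_zero_le [NeZero N] {ρ : ℝ} (hρ : 0 < ρ) {K : (Fin d → ZMod N) → ℝ}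
    (hK : IsGreen (torusStep d N) ρ K) (i : Fin d) {m : ℕ} (hm : m ≤ N) :
    m * (ρ * K 0) ≤ 1 + ρ * m ^ 2 := by
  classical
  have hstep : ∀ j : ℕ, K 0 - j ≤ K (j • torusStep d N i) := by
    intro j
    induction j with
    | zero => simp
    | succ j ih =>
      have := (abs_le.1 (hK.step_le hρ (j • torusStep d N i) i)).1
      rw [succ_nsmul]
      push_cast
      linarith
  have hinj : Set.InjOn (fun j : ℕ => j • torusStep d N i) (Finset.range m) := by
    intro a ha b hb hab
    have h1 := congrFun hab i
    simp only [torusStep, Pi.smul_apply, Pi.single_eq_same, nsmul_eq_mul, mul_one] at h1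
    rw [ZMod.natCast_eq_natCast_iff] at h1
    have ha' : a < N := (Finset.mem_range.1 ha).trans_le hm
    have hb' : b < N := (Finset.mem_range.1 hb).trans_le hm
    exact Nat.ModEq.eq_of_lt_of_lt h1 ha' hb'
  have h1 : ∑ j ∈ Finset.range m, K (j • torusStep d N i) ≤ ∑ x, K x := by
    rw [← Finset.sum_image (f := K) hinj]
    exact Finset.sum_le_sum_of_subset_of_nonneg (Finset.subset_univ _)
      fun x _ _ => hK.nonneg hρ x
  have h2 : ∑ j ∈ Finset.range m, (K 0 - m) ≤ ∑ j ∈ Finset.range m, K (j • torusStep d N i) := by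
    refine Finset.sum_le_sum fun j hj => (sub_le_sub_left ?_ _).trans (hstep j)
    exact_mod_cast (Finset.mem_range.1 hj).le
  rw [Finset.sum_const, Finset.card_range, nsmul_eq_mul] at h2
  have h3 := mul_le_mul_of_nonneg_left (h2.trans h1) hρ.le
  rw [hK.sum] at h3
  linarith

theorem IsGreen.abs_zero_sub_le [NeZero N] {ρ : ℝ} (hρ : 0 < ρ) {K : (Fin d → ZMod N) → ℝ}
    (hK : IsGreen (torusStep d N) ρ K) (x : Fin d → ℤ) :
    |K 0 - K (torusProj d N x)| ≤ ∑ i, |(x i : ℝ)| := by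
  rw [abs_sub_comm]
  have := abs_sub_zero_le (f := fun y => K (torusProj d N y)) (fun y i => by
    rw [torusProj_add, torusProj_step]
    exact hK.step_le hρ _ i) x
  simpa only [torusProj_zero] using this

/-- The mass term disappears from the limiting equation for the potential kernels. -/
theorem tendsto_mass_mul_green {ι : Type} {l : Filter ι} {N : ι → ℕ} [∀ n, NeZero (N n)]
    (i : Fin d) (hN : Tendsto N l atTop) {ρ : ι → ℝ} (hρ : ∀ᶠ n in l, 0 < ρ n)
    (hρ0 : Tendsto ρ l (𝓝 0)) {K : ∀ n, (Fin d → ZMod (N n)) → ℝ}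
    (hK : ∀ᶠ n in l, IsGreen (torusStep d (N n)) (ρ n) (K n)) :
    Tendsto (fun n => ρ n * K n 0) l (𝓝 0) := by
  rw [Metric.tendsto_nhds]
  intro ε hε
  obtain ⟨m, hm⟩ := exists_nat_gt (2 / ε)
  have hm0 : (0 : ℝ) < m := (by positivity : (0 : ℝ) < 2 / ε).trans hm
  have hsmall : ∀ᶠ n in l, ρ n * (m : ℝ) ^ 2 < 1 := by
    have : Tendsto (fun n => ρ n * (m : ℝ) ^ 2) l (𝓝 0) := by
      simpa using hρ0.mul_const ((m : ℝ) ^ 2)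
    exact this.eventually (gt_mem_nhds one_pos)
  filter_upwards [hρ, hK, hsmall, hN.eventually_ge_atTop m] with n h1 h2 h3 h4
  have h5 := h2.mul_zero_le h1 i h4
  have h6 := mul_nonneg h1.le (h2.nonneg h1 0)
  rw [Real.dist_eq, sub_zero, abs_of_nonneg h6]
  rw [div_lt_iff₀ hε] at hm
  by_contra h7
  have h8 : (m : ℝ) * ε ≤ m * (ρ n * K n 0) := by gcongr; exact not_lt.1 h7
  linarith

/-- The potential kernels of the tori converge to the potential kernel of `ℤ^d`. -/
theorem exists_tendsto_torus_potential {ι : Type} {l : Filter ι} [l.NeBot] {N : ι → ℕ}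
    [∀ n, NeZero (N n)] (hd : 0 < d) (hN : Tendsto N l atTop) {ρ : ι → ℝ}
    (hρ : ∀ᶠ n in l, 0 < ρ n) (hρ0 : Tendsto ρ l (𝓝 0)) {K : ∀ n, (Fin d → ZMod (N n)) → ℝ}
    (hK : ∀ᶠ n in l, IsGreen (torusStep d (N n)) (ρ n) (K n)) :
    ∃ a : (Fin d → ℤ) → ℝ, ∀ x,
      Tendsto (fun n => K n 0 - K n (torusProj d (N n) x)) l (𝓝 (a x)) := by
  classical
  have hmass := tendsto_mass_mul_green ⟨0, hd⟩ hN hρ hρ0 hK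
  have h := exists_tendsto_potential (l := l) (k := fun n x => K n (torusProj d (N n) x))
    (σ := fun x => if x = 0 then 1 else 0) ?_ ?_ ?_
  · simpa only [torusProj_zero] using h
  · filter_upwards [hρ, hK] with n h1 h2 x i
    rw [torusProj_add, torusProj_step]
    exact h2.step_le h1 _ i
  · filter_upwards [hρ, hK] with n h1 h2 x
    rw [torusProj_neg]
    exact h2.even h1 _
  · intro x
    have hm : Tendsto (fun n => ρ n * K n (torusProj d (N n) x)) l (𝓝 0) := by
      refine squeeze_zero' ?_ ?_ hmass
      · filter_upwards [hρ, hK] with n h1 h2 using mul_nonneg h1.le (h2.nonneg h1 _)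
      · filter_upwards [hρ, hK] with n h1 h2
        have := h2.le_zero h1 (torusProj d (N n) x)
        gcongr
    have h1 := hm.const_sub (if x = 0 then (1 : ℝ) else 0)
    rw [sub_zero] at h1
    refine h1.congr' ?_
    have h3 : ∀ᶠ n in l, (torusProj d (N n) x = 0 ↔ x = 0) := by
      rcases eq_or_ne x 0 with rfl | hx
      · exact Eventually.of_forall fun n => by simp [torusProj_zero]
      · filter_upwards [eventually_torusProj_ne_zero hN hx] with n hn
        simp [hn, hx]
    filter_upwards [hK, h3] with n h2 h3
    have := h2 (torusProj d (N n) x)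
    rw [nbSum_torusProj]
    simp only [h3] at this
    split_ifs at this ⊢ <;> linarith

end TorusProj

/-! ### Combs over an abelian group -/

section Combs
variable {d : ℕ}

/-- Copies of the graph `H` on the fibres over `B`. -/
def fibreGraph (B : Set (Fin d → ℤ)) (H : SimpleGraph ℤ) : SimpleGraph (Vtx d) where
  Adj p q := p.1 = q.1 ∧ p.1 ∈ B ∧ H.Adj p.2 q.2
  symm := ⟨fun _ _ h => ⟨h.1.symm, h.1 ▸ h.2.1, h.2.2.symm⟩⟩
  loopless := ⟨fun _ h => H.irrefl h.2.2⟩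

instance (B : Set (Fin d → ℤ)) (H : SimpleGraph ℤ) [hH : BoundedDegree H] :
    BoundedDegree (fibreGraph B H) := by
  classical
  refine BoundedDegree.of_finset _ hH.exists_bound.choose
    (fun p => (nbrs H p.2).image fun y => (p.1, y)) ?_ fun p =>
      Finset.card_image_le.trans (card_nbrs H _)
  rintro ⟨x, k⟩ ⟨y, l⟩ ⟨h1, -, h3⟩
  rw [Finset.mem_image]
  exact ⟨l, (mem_nbrs H).2 h3, by simpa using h1⟩

theorem sum_nbrs_fibreGraph {M : Type} [AddCommMonoid M] (B : Set (Fin d → ℤ)) (H : SimpleGraph ℤ)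
    [BoundedDegree H] {x : Fin d → ℤ} (hx : x ∈ B) (k : ℤ) (F : Vtx d → M) :
    ∑ p ∈ nbrs (fibreGraph B H) (x, k), F p = ∑ l ∈ nbrs H k, F (x, l) := by
  have e : nbrs (fibreGraph B H) (x, k) = (nbrs H k).map ⟨_, Prod.mk_right_injective x⟩ := by
    ext ⟨y, l⟩
    simp only [mem_nbrs, fibreGraph, Finset.mem_map, Function.Embedding.coeFn_mk, Prod.mk.injEq]
    constructor
    · rintro ⟨rfl, -, h⟩
      exact ⟨l, h, rfl, rfl⟩
    · rintro ⟨l, h, rfl, rfl⟩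
      exact ⟨rfl, hx, h⟩
  rw [e, Finset.sum_map]
  rfl

/-- The graph `G` arises from copies of `H` on the fibres over `B` by joining the origins of the
fibres along the steps `± e i` of the group `T`, which parametrizes base points through `σ`. -/
def IsCombOver {T : Type} [AddCommGroup T] (G : SimpleGraph (Vtx d)) (B : Set (Fin d → ℤ))
    (H : SimpleGraph ℤ) (σ : T → Fin d → ℤ) (e : Fin d → T) : Prop :=
  ∀ p q, G.Adj p q ↔ (fibreGraph B H).Adj p q ∨
    ∃ s i, p = (σ s, 0) ∧ (q = (σ (s + e i), 0) ∨ q = (σ (s - e i), 0))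

variable {T : Type} [AddCommGroup T] {G : SimpleGraph (Vtx d)} [BoundedDegree G]
  {B : Set (Fin d → ℤ)} {H : SimpleGraph ℤ} [BoundedDegree H] {σ : T → Fin d → ℤ} {e : Fin d → T}

theorem IsCombOver.sum_nbrs_zero {M : Type} [AddCommMonoid M] (hG : IsCombOver G B H σ e)
    (hσ : Function.Injective σ) (he : Function.Injective e) (he' : ∀ i j, e i + e j ≠ 0) (s : T)
    (F : Vtx d → M) :
    ∑ p ∈ nbrs G (σ s, 0), F p = ∑ p ∈ nbrs (fibreGraph B H) (σ s, 0), F p +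
      nbSum e (fun t => F (σ t, 0)) s := by
  classical
  have e1 : nbrs G (σ s, 0) = nbrs (fibreGraph B H) (σ s, 0) ∪
      ((Finset.univ.image fun i => ((σ (s + e i), 0) : Vtx d)) ∪
        Finset.univ.image fun i => ((σ (s - e i), 0) : Vtx d)) := by
    ext q
    simp only [mem_nbrs, Finset.mem_union, Finset.mem_image, Finset.mem_univ, true_and]
    rw [hG]
    refine or_congr Iff.rfl ?_
    constructor
    · rintro ⟨s', i, h1, h2⟩
      obtain rfl := hσ (congrArg Prod.fst h1)
      exact h2.imp (fun h => ⟨i, h.symm⟩) fun h => ⟨i, h.symm⟩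
    · rintro (⟨i, h⟩ | ⟨i, h⟩)
      · exact ⟨s, i, rfl, Or.inl h.symm⟩
      · exact ⟨s, i, rfl, Or.inr h.symm⟩
  have hinj1 : Function.Injective fun i => ((σ (s + e i), 0) : Vtx d) := fun i j h =>
    he (add_left_cancel (hσ (congrArg Prod.fst h)))
  have hinj2 : Function.Injective fun i => ((σ (s - e i), 0) : Vtx d) := fun i j h =>
    he (sub_right_injective (hσ (congrArg Prod.fst h)))
  have hd1 : Disjoint (nbrs (fibreGraph B H) (σ s, 0))
      ((Finset.univ.image fun i => ((σ (s + e i), 0) : Vtx d)) ∪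
        Finset.univ.image fun i => ((σ (s - e i), 0) : Vtx d)) := by
    rw [Finset.disjoint_left]
    intro q hq hq'
    have h2 : q.2 = 0 := by
      simp only [Finset.mem_union, Finset.mem_image, Finset.mem_univ, true_and] at hq'
      rcases hq' with ⟨i, rfl⟩ | ⟨i, rfl⟩ <;> rfl
    have h3 := ((mem_nbrs _).1 hq).2.2
    rw [h2] at h3
    exact H.irrefl h3
  have hd2 : Disjoint (Finset.univ.image fun i => ((σ (s + e i), 0) : Vtx d))
      (Finset.univ.image fun i => ((σ (s - e i), 0) : Vtx d)) := by
    rw [Finset.disjoint_left]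
    intro q hq hq'
    obtain ⟨i, -, rfl⟩ := Finset.mem_image.1 hq
    obtain ⟨j, -, h⟩ := Finset.mem_image.1 hq'
    have h2 : s - e j = s + e i := hσ (congrArg Prod.fst h)
    refine he' i j ?_
    have : s + (e i + e j) = s := by rw [← add_assoc, ← h2, sub_add_cancel]
    simpa using this
  rw [e1, Finset.sum_union hd1, Finset.sum_union hd2, Finset.sum_image fun i _ j _ h => hinj1 h,
    Finset.sum_image fun i _ j _ h => hinj2 h, nbSum, Finset.sum_add_distrib]

theorem IsCombOver.nbrs_eq (hG : IsCombOver G B H σ e) {p : Vtx d} (hp : ∀ s, p ≠ (σ s, 0)) :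
    nbrs G p = nbrs (fibreGraph B H) p := by
  ext q
  rw [mem_nbrs, mem_nbrs, hG]
  refine or_iff_left ?_
  rintro ⟨s, i, h, -⟩
  exact hp s h

end Combs

/-! ### The infinite comb and the finite combs -/

theorem nbrs_line (k : ℤ) : nbrs line k = {k + 1, k - 1} := by
  ext l
  rw [mem_nbrs, Finset.mem_insert, Finset.mem_singleton]
  change |k - l| = 1 ↔ _
  rw [abs_eq zero_le_one]
  omega

theorem sum_nbrs_line {M : Type} [AddCommMonoid M] (F : ℤ → M) (k : ℤ) :
    ∑ l ∈ nbrs line k, F l = F (k + 1) + F (k - 1) := by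
  rw [nbrs_line, Finset.sum_pair (by omega)]

theorem stdStep_injective (d : ℕ) : Function.Injective (stdStep d) := by
  intro i j h
  by_contra hij
  have := congrFun h i
  simp [stdStep, hij] at this

theorem stdStep_add_ne_zero {d : ℕ} (i j : Fin d) : stdStep d i + stdStep d j ≠ 0 := by
  intro h
  have h1 := congrFun h i
  have h2 : 0 ≤ stdStep d j i := by
    rcases eq_or_ne i j with rfl | hij
    · simp [stdStep]
    · simp [stdStep, hij]
  simp only [Pi.add_apply, Pi.zero_apply] at h1
  have h3 : stdStep d i i = 1 := by simp [stdStep]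
  omega

theorem lattice_adj_iff {d : ℕ} (x y : Fin d → ℤ) :
    (lattice d).Adj x y ↔ ∃ i, y = x + stdStep d i ∨ y = x - stdStep d i := by
  change (∃ i, |x i - y i| = 1 ∧ ∀ j, j ≠ i → x j = y j) ↔ _
  refine exists_congr fun i => ?_
  rw [abs_eq zero_le_one]
  constructor
  · rintro ⟨h1 | h1, h2⟩
    · refine Or.inr (funext fun j => ?_)
      rcases eq_or_ne j i with rfl | hj
      · simp [stdStep]; omega
      · simp [stdStep, hj, h2 j hj]
    · refine Or.inl (funext fun j => ?_)
      rcases eq_or_ne j i with rfl | hj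
      · simp [stdStep]; omega
      · simp [stdStep, hj, h2 j hj]
  · rintro (rfl | rfl)
    · exact ⟨by simp [stdStep], fun j hj => by simp [stdStep, hj]⟩
    · exact ⟨by simp [stdStep], fun j hj => by simp [stdStep, hj]⟩

theorem isCombOver_combZ (d : ℕ) : IsCombOver (combZ d) Set.univ line id (stdStep d) := by
  rintro ⟨x, k⟩ ⟨y, l⟩
  change ((x = y ∧ line.Adj k l) ∨ (k = 0 ∧ l = 0 ∧ (lattice d).Adj x y)) ↔
    (x = y ∧ x ∈ Set.univ ∧ line.Adj k l) ∨ _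
  rw [lattice_adj_iff]
  refine or_congr (by simp) ?_
  constructor
  · rintro ⟨rfl, rfl, i, h⟩
    exact ⟨x, i, rfl, h.imp (fun h => by rw [h]; rfl) fun h => by rw [h]; rfl⟩
  · rintro ⟨s, i, h1, h2⟩
    obtain ⟨rfl, rfl⟩ := Prod.mk.inj h1
    refine ⟨rfl, ?_, i, ?_⟩
    · rcases h2 with h2 | h2 <;> exact (Prod.mk.inj h2).2
    · exact h2.imp (fun h => (Prod.mk.inj h).1) fun h => (Prod.mk.inj h).1

/-- The chain on `[-n, n]`, as a graph on `ℤ`. -/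
def lineBox (n : ℕ) : SimpleGraph ℤ where
  Adj k l := |k - l| = 1 ∧ |k| ≤ n ∧ |l| ≤ n
  symm := ⟨fun _ _ h => ⟨by rw [abs_sub_comm]; exact h.1, h.2.2, h.2.1⟩⟩
  loopless := ⟨fun _ h => by simp at h⟩

theorem BoundedDegree.mono {V : Type} {G G' : SimpleGraph V} [hG : BoundedDegree G]
    (h : ∀ x y, G'.Adj x y → G.Adj x y) : BoundedDegree G' :=
  BoundedDegree.of_finset G' _ (nbrs G) (fun x y hxy => (mem_nbrs G).2 (h x y hxy)) (card_nbrs G)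

instance (n : ℕ) : BoundedDegree (lineBox n) := BoundedDegree.mono (G := line) fun _ _ h => h.1

/-- The representatives in `[-n, n]^d` of the points of the torus `(ℤ / (2n+1))^d`. -/
def torusLift (d n : ℕ) (t : Fin d → ZMod (2 * n + 1)) : Fin d → ℤ := fun i => (t i).valMinAbs

section TorusLift
variable {d n : ℕ}

theorem torusProj_torusLift (t : Fin d → ZMod (2 * n + 1)) :
    torusProj d (2 * n + 1) (torusLift d n t) = t := by
  ext i
  simp [torusProj, torusLift]

theorem torusLift_injective (d n : ℕ) : Function.Injective (torusLift d n) :=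
  Function.LeftInverse.injective torusProj_torusLift

theorem abs_torusLift_le (t : Fin d → ZMod (2 * n + 1)) (i : Fin d) : |torusLift d n t i| ≤ n := by
  have := ZMod.natAbs_valMinAbs_le (t i)
  rw [torusLift, Int.abs_eq_natAbs]
  omega

theorem torusLift_torusProj {x : Fin d → ℤ} (hx : ∀ i, |x i| ≤ n) :
    torusLift d n (torusProj d (2 * n + 1) x) = x := by
  ext i
  rw [torusLift, torusProj, ZMod.valMinAbs_spec]
  refine ⟨rfl, ?_⟩
  have := abs_le.1 (hx i)
  rw [Set.mem_Ioc]
  push_cast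
  omega

theorem torusStep_ne (hn : 1 ≤ n) :
    (1 : ZMod (2 * n + 1)) ≠ 0 ∧ (1 : ZMod (2 * n + 1)) + 1 ≠ 0 := by
  constructor
  · intro h
    have : ((1 : ℕ) : ZMod (2 * n + 1)) = 0 := by exact_mod_cast h
    rw [ZMod.natCast_eq_zero_iff] at this
    have := Nat.le_of_dvd one_pos this
    omega
  · intro h
    have : ((2 : ℕ) : ZMod (2 * n + 1)) = 0 := by
      rw [← h]; norm_num
    rw [ZMod.natCast_eq_zero_iff] at this
    have := Nat.le_of_dvd two_pos this
    omega

theorem torusStep_injective (hn : 1 ≤ n) : Function.Injective (torusStep d (2 * n + 1)) := by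
  intro i j h
  by_contra hij
  have := congrFun h i
  simp [torusStep, hij] at this
  exact (torusStep_ne hn).1 (by simpa using this)

theorem torusStep_add_ne_zero (hn : 1 ≤ n) (i j : Fin d) :
    torusStep d (2 * n + 1) i + torusStep d (2 * n + 1) j ≠ 0 := by
  intro h
  have h1 := congrFun h i
  rcases eq_or_ne i j with rfl | hij
  · simp only [torusStep, Pi.add_apply, Pi.single_eq_same, Pi.zero_apply] at h1
    exact (torusStep_ne hn).2 h1
  · simp only [torusStep, Pi.add_apply, Pi.single_eq_same, Pi.zero_apply,
      Pi.single_eq_of_ne hij, add_zero] at h1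
    exact (torusStep_ne hn).1 h1

/-- The base points of the finite comb. -/
def baseBox (d n : ℕ) : Set (Fin d → ℤ) := {x | ∀ i, |x i| ≤ n}

theorem torus_adj_iff (hn : 1 ≤ n) (x y : Fin d → Box n) :
    (torus d n).Adj x y ↔ ∃ i,
      torusProj d (2 * n + 1) (fun j => (y j : ℤ)) =
        torusProj d (2 * n + 1) (fun j => (x j : ℤ)) + torusStep d (2 * n + 1) i ∨
      torusProj d (2 * n + 1) (fun j => (y j : ℤ)) =
        torusProj d (2 * n + 1) (fun j => (x j : ℤ)) - torusStep d (2 * n + 1) i := by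
  change (∃ i, x i ≠ y i ∧ ((x i : ℤ) ≡ y i + 1 [ZMOD 2 * n + 1] ∨
    (y i : ℤ) ≡ x i + 1 [ZMOD 2 * n + 1]) ∧ ∀ j, j ≠ i → x j = y j) ↔ _
  have hbox : ∀ a b : Box n, ((a : ℤ) : ZMod (2 * n + 1)) = ((b : ℤ) : ZMod (2 * n + 1)) ↔
      a = b := by
    intro a b
    constructor
    · intro h
      have ha : |(a : ℤ)| ≤ n := abs_le.2 a.2
      have hb : |(b : ℤ)| ≤ n := abs_le.2 b.2
      have h1 := torusLift_torusProj (d := 1) (n := n) (x := fun _ => (a : ℤ)) fun _ => ha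
      have h2 := torusLift_torusProj (d := 1) (n := n) (x := fun _ => (b : ℤ)) fun _ => hb
      have h3 : torusProj 1 (2 * n + 1) (fun _ => (a : ℤ)) =
          torusProj 1 (2 * n + 1) (fun _ => (b : ℤ)) := funext fun _ => h
      rw [h3, h2] at h1
      exact Subtype.ext (congrFun h1 0).symm
    · rintro rfl
      rfl
  have hmod : ∀ a b : ℤ, a ≡ b + 1 [ZMOD 2 * n + 1] ↔
      (a : ZMod (2 * n + 1)) = (b : ZMod (2 * n + 1)) + 1 := by
    intro a b
    have := ZMod.intCast_eq_intCast_iff a (b + 1) (2 * n + 1)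
    push_cast at this
    exact this.symm
  refine exists_congr fun i => ?_
  rw [hmod, hmod]
  have h1 := (torusStep_ne hn).1
  constructor
  · rintro ⟨-, h2 | h2, h3⟩
    · refine Or.inr (funext fun j => ?_)
      rcases eq_or_ne j i with rfl | hj
      · simp [torusProj, torusStep, h2]
      · simp [torusProj, torusStep, hj, h3 j hj]
    · refine Or.inl (funext fun j => ?_)
      rcases eq_or_ne j i with rfl | hj
      · simp [torusProj, torusStep, h2]
      · simp [torusProj, torusStep, hj, h3 j hj]
  · rintro (h | h)
    · have h2 : ((y i : ℤ) : ZMod (2 * n + 1)) = ((x i : ℤ) : ZMod (2 * n + 1)) + 1 := by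
        simpa [torusProj, torusStep] using congrFun h i
      refine ⟨fun hxy => ?_, Or.inr h2, fun j hj => ?_⟩
      · rw [hxy] at h2
        exact h1 (by simpa using h2.symm)
      · rw [← hbox]
        simpa [torusProj, torusStep, hj] using (congrFun h j).symm
    · have h2 : ((y i : ℤ) : ZMod (2 * n + 1)) = ((x i : ℤ) : ZMod (2 * n + 1)) - 1 := by
        simpa [torusProj, torusStep] using congrFun h i
      refine ⟨fun hxy => ?_, Or.inl (by rw [h2]; ring), fun j hj => ?_⟩
      · rw [hxy] at h2
        exact h1 (sub_eq_self.1 h2.symm)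
      · rw [← hbox]
        simpa [torusProj, torusStep, hj] using (congrFun h j).symm

theorem isCombOver_combBox (d : ℕ) (hn : 1 ≤ n) :
    IsCombOver (combBox d n) (baseBox d n) (lineBox n) (torusLift d n)
      (torusStep d (2 * n + 1)) := by
  rintro ⟨x, k⟩ ⟨y, l⟩
  rw [combBox, SimpleGraph.map_adj]
  constructor
  · rintro ⟨⟨x', k'⟩, ⟨y', l'⟩, h, h1, h2⟩
    obtain ⟨rfl, rfl⟩ := Prod.mk.inj h1
    obtain ⟨rfl, rfl⟩ := Prod.mk.inj h2
    rcases h with ⟨h3, h4⟩ | ⟨h3, h4, h5⟩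
    · left
      obtain rfl : x' = y' := h3
      exact ⟨rfl, fun i => abs_le.2 (x' i).2, h4, abs_le.2 k'.2, abs_le.2 l'.2⟩
    · right
      obtain rfl : k' = ⟨0, by simp⟩ := h3
      obtain rfl : l' = ⟨0, by simp⟩ := h4
      have hx := torusLift_torusProj (n := n) (x := fun i => (x' i : ℤ)) fun i => abs_le.2 (x' i).2
      have hy := torusLift_torusProj (n := n) (x := fun i => (y' i : ℤ)) fun i => abs_le.2 (y' i).2
      obtain ⟨i, h6⟩ := (torus_adj_iff hn x' y').1 h5
      refine ⟨torusProj d (2 * n + 1) fun i => (x' i : ℤ), i, by rw [hx], ?_⟩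
      exact h6.imp (fun h => by rw [← h, hy]) fun h => by rw [← h, hy]
  · rintro (⟨h1, h2, h3, h4, h5⟩ | ⟨s, i, h1, h2⟩)
    · obtain rfl : x = y := h1
      exact ⟨(fun i => ⟨x i, abs_le.1 (h2 i)⟩, ⟨k, abs_le.1 h4⟩),
        (fun i => ⟨x i, abs_le.1 (h2 i)⟩, ⟨l, abs_le.1 h5⟩), Or.inl ⟨rfl, h3⟩, rfl, rfl⟩
    · obtain ⟨rfl, rfl⟩ := Prod.mk.inj h1
      obtain ⟨t, ht, ht'⟩ : ∃ t, ((y, l) : Vtx d) = (torusLift d n t, 0) ∧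
          (t = s + torusStep d (2 * n + 1) i ∨ t = s - torusStep d (2 * n + 1) i) := by
        rcases h2 with h2 | h2
        · exact ⟨_, h2, Or.inl rfl⟩
        · exact ⟨_, h2, Or.inr rfl⟩
      obtain ⟨rfl, rfl⟩ := Prod.mk.inj ht
      refine ⟨(fun i => ⟨torusLift d n s i, abs_le.1 (abs_torusLift_le s i)⟩, ⟨0, by simp⟩),
        (fun i => ⟨torusLift d n t i, abs_le.1 (abs_torusLift_le t i)⟩, ⟨0, by simp⟩),
        Or.inr ⟨rfl, rfl, (torus_adj_iff hn _ _).2 ⟨i, ?_⟩⟩, rfl, rfl⟩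
      change torusProj d (2 * n + 1) (torusLift d n t) =
        torusProj d (2 * n + 1) (torusLift d n s) + _ ∨
        torusProj d (2 * n + 1) (torusLift d n t) =
        torusProj d (2 * n + 1) (torusLift d n s) - _
      rw [torusProj_torusLift, torusProj_torusLift]
      exact ht'

end TorusLift

/-! ### The norm of the comb and its Perron–Frobenius vector -/

/-- The decay rate `√(d² + 1) - d` of the Perron–Frobenius vector along the fibres. -/
noncomputable def decayRate (d : ℕ) : ℝ := √((d : ℝ) ^ 2 + 1) - d

/-- The spectral radius `2 √(d² + 1)` of the comb. -/
noncomputable def combNorm (d : ℕ) : ℝ := 2 * √((d : ℝ) ^ 2 + 1)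

section Rate
variable {d : ℕ}

theorem decayRate_mul : decayRate d * (decayRate d + 2 * d) = 1 := by
  have h := Real.sq_sqrt (show (0 : ℝ) ≤ (d : ℝ) ^ 2 + 1 by positivity)
  rw [decayRate]
  linear_combination h

theorem decayRate_pos : 0 < decayRate d := by
  rw [decayRate, sub_pos]
  exact Real.lt_sqrt_of_sq_lt (by linarith)

theorem decayRate_lt_one (hd : 0 < d) : decayRate d < 1 := by
  have h := decayRate_mul (d := d)
  have h1 := decayRate_pos (d := d)
  have h2 : (1 : ℝ) ≤ d := by exact_mod_cast hd
  by_contra h3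
  push Not at h3
  nlinarith

theorem combNorm_eq : combNorm d = 2 * decayRate d + 2 * d := by
  rw [combNorm, decayRate]; ring

theorem combNorm_mul : combNorm d * decayRate d = 1 + decayRate d ^ 2 := by
  have h := decayRate_mul (d := d)
  rw [combNorm_eq]
  linear_combination h

theorem two_lt_combNorm (hd : 0 < d) : 2 < combNorm d := by
  have h1 := combNorm_mul (d := d)
  have h2 := decayRate_lt_one hd
  have h3 := decayRate_pos (d := d)
  by_contra h4
  push Not at h4
  have h5 : combNorm d * decayRate d ≤ 2 * decayRate d := by gcongr
  nlinarith [sq_pos_of_pos (sub_pos.2 h2)]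

/-- The profile of the Perron–Frobenius vector along a fibre. -/
noncomputable def decay (d : ℕ) (k : ℤ) : ℝ := decayRate d ^ k.natAbs

theorem decay_pos (k : ℤ) : 0 < decay d k := pow_pos decayRate_pos _

theorem decay_zero : decay d 0 = 1 := by simp [decay]

theorem decay_step {k : ℤ} (hk : k ≠ 0) :
    decay d (k + 1) + decay d (k - 1) = combNorm d * decay d k := by
  have key : ∀ m : ℕ, decayRate d ^ (m + 2) + decayRate d ^ m =
      combNorm d * decayRate d ^ (m + 1) := by
    intro m
    have h := combNorm_mul (d := d)
    rw [pow_succ (decayRate d) m, mul_comm _ (decayRate d), ← mul_assoc, h, pow_add]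
    ring
  rw [decay, decay, decay]
  rcases lt_or_gt_of_ne hk with h | h
  · obtain ⟨m, rfl⟩ : ∃ m : ℕ, k = -(m + 1) := ⟨(-k - 1).toNat, by omega⟩
    have e1 : (-((m : ℤ) + 1) + 1).natAbs = m := by omega
    have e2 : (-((m : ℤ) + 1) - 1).natAbs = m + 2 := by omega
    have e3 : (-((m : ℤ) + 1)).natAbs = m + 1 := by omega
    rw [e1, e2, e3, ← key, add_comm]
  · obtain ⟨m, rfl⟩ : ∃ m : ℕ, k = m + 1 := ⟨(k - 1).toNat, by omega⟩
    have e1 : ((m : ℤ) + 1 + 1).natAbs = m + 2 := by omega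
    have e2 : ((m : ℤ) + 1 - 1).natAbs = m := by omega
    have e3 : ((m : ℤ) + 1).natAbs = m + 1 := by omega
    rw [e1, e2, e3, ← key]

theorem decay_step_zero : decay d (0 + 1) + decay d (0 - 1) + 2 * d = combNorm d := by
  rw [combNorm_eq]
  simp [decay]
  ring

theorem decay_step_le (k : ℤ) : decay d (k + 1) + decay d (k - 1) ≤ combNorm d * decay d k := by
  rcases eq_or_ne k 0 with rfl | hk
  · have h := decay_step_zero (d := d)
    rw [decay_zero, mul_one]
    have : (0 : ℝ) ≤ d := Nat.cast_nonneg d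
    linarith
  · exact (decay_step hk).le

end Rate

theorem nbrs_mono {V : Type} {G G' : SimpleGraph V} [BoundedDegree G] [BoundedDegree G']
    (h : ∀ x y, G.Adj x y → G'.Adj x y) (x : V) : nbrs G x ⊆ nbrs G' x := fun y hy =>
  (mem_nbrs G').2 (h x y ((mem_nbrs G).1 hy))

theorem sum_nbrs_le_of_le_line {G : SimpleGraph ℤ} [BoundedDegree G]
    (h : ∀ x y, G.Adj x y → line.Adj x y) {F : ℤ → ℝ} (hF : ∀ k, 0 ≤ F k) (k : ℤ) :
    ∑ l ∈ nbrs G k, F l ≤ F (k + 1) + F (k - 1) := by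
  rw [← sum_nbrs_line]
  exact Finset.sum_le_sum_of_subset_of_nonneg (nbrs_mono h k) fun l _ _ => hF l

theorem sum_nbrs_fibreGraph_le {d : ℕ} {B : Set (Fin d → ℤ)} {H : SimpleGraph ℤ} [BoundedDegree H]
    (h : ∀ x y, H.Adj x y → line.Adj x y) {F : Vtx d → ℝ} (hF : ∀ p, 0 ≤ F p) (x : Fin d → ℤ)
    (k : ℤ) : ∑ p ∈ nbrs (fibreGraph B H) (x, k), F p ≤ F (x, k + 1) + F (x, k - 1) := by
  by_cases hx : x ∈ B
  · rw [sum_nbrs_fibreGraph B H hx]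
    exact sum_nbrs_le_of_le_line h (F := fun l => F (x, l)) (fun l => hF _) k
  · have : nbrs (fibreGraph B H) (x, k) = ∅ := by
      ext q
      simp only [mem_nbrs, fibreGraph, Finset.notMem_empty, iff_false]
      exact fun h => hx h.2.1
    rw [this, Finset.sum_empty]
    exact add_nonneg (hF _) (hF _)

theorem norm_adjOp_le_two_of_le_line {G : SimpleGraph ℤ} [BoundedDegree G]
    (h : ∀ x y, G.Adj x y → line.Adj x y) : ‖adjOp G‖ ≤ 2 :=
  adjOp_norm_le_of_superharmonic G (fun _ => 1) (fun _ => one_pos) (by norm_num) fun k =>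
    (sum_nbrs_le_of_le_line h (F := fun _ => 1) (fun _ => zero_le_one) k).trans (by norm_num)

theorem norm_adjOp_fibreGraph_le {d : ℕ} (B : Set (Fin d → ℤ)) {H : SimpleGraph ℤ}
    [BoundedDegree H] (h : ∀ x y, H.Adj x y → line.Adj x y) : ‖adjOp (fibreGraph B H)‖ ≤ 2 :=
  adjOp_norm_le_of_superharmonic _ (fun _ => 1) (fun _ => one_pos) (by norm_num) fun p =>
    (sum_nbrs_fibreGraph_le h (F := fun _ => 1) (fun _ => zero_le_one) p.1 p.2).trans (by norm_num)

/-- The Schur test with the Perron–Frobenius profile along the fibres. -/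
theorem IsCombOver.norm_adjOp_le {d : ℕ} {T : Type} [AddCommGroup T] {G : SimpleGraph (Vtx d)}
    [BoundedDegree G] {B : Set (Fin d → ℤ)} {H : SimpleGraph ℤ} [BoundedDegree H]
    {σ : T → Fin d → ℤ} {e : Fin d → T} (hG : IsCombOver G B H σ e)
    (hσ : Function.Injective σ) (he : Function.Injective e) (he' : ∀ i j, e i + e j ≠ 0)
    (hH : ∀ x y, H.Adj x y → line.Adj x y) : ‖adjOp G‖ ≤ combNorm d := by
  refine adjOp_norm_le_of_superharmonic G (fun p => decay d p.2) (fun p => decay_pos _)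
    (by rw [combNorm]; positivity) fun p => ?_
  have hfib := sum_nbrs_fibreGraph_le (B := B) hH (F := fun p : Vtx d => decay d p.2)
    (fun p => (decay_pos _).le)
  by_cases hp : ∃ s, p = (σ s, 0)
  · obtain ⟨s, rfl⟩ := hp
    rw [hG.sum_nbrs_zero hσ he he']
    simp only [nbSum_const, decay_zero, mul_one]
    have := hfib (σ s) 0
    have h2 := decay_step_zero (d := d)
    linarith
  · push Not at hp
    rw [hG.nbrs_eq hp]
    exact (hfib p.1 p.2).trans (decay_step_le p.2)

theorem norm_adjOp_combBox_le {d n : ℕ} (hn : 1 ≤ n) : ‖adjOp (combBox d n)‖ ≤ combNorm d :=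
  (isCombOver_combBox d hn).norm_adjOp_le (torusLift_injective d n) (torusStep_injective hn)
    (torusStep_add_ne_zero hn) fun _ _ h => h.1

theorem sum_nbrs_combZ_zero {M : Type} [AddCommMonoid M] {d : ℕ} (F : Vtx d → M) (x : Fin d → ℤ) :
    ∑ p ∈ nbrs (combZ d) (x, 0), F p =
      F (x, 0 + 1) + F (x, 0 - 1) + nbSum (stdStep d) (fun y => F (y, 0)) x := by
  rw [← sum_nbrs_line (fun l => F (x, l)), ← sum_nbrs_fibreGraph Set.univ line (Set.mem_univ x)]
  exact (isCombOver_combZ d).sum_nbrs_zero Function.injective_id (stdStep_injective d)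
    stdStep_add_ne_zero x F

theorem sum_nbrs_combZ {M : Type} [AddCommMonoid M] {d : ℕ} (F : Vtx d → M) (x : Fin d → ℤ)
    {k : ℤ} (hk : k ≠ 0) : ∑ p ∈ nbrs (combZ d) (x, k), F p = F (x, k + 1) + F (x, k - 1) := by
  rw [(isCombOver_combZ d).nbrs_eq fun s h => hk (congrArg Prod.snd h),
    sum_nbrs_fibreGraph Set.univ line (Set.mem_univ x), sum_nbrs_line]

theorem summable_pi_prod {d : ℕ} {f : ℤ → ℝ} (hf : ∀ k, 0 ≤ f k) (h : Summable f) :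
    Summable fun x : Fin d → ℤ => ∏ i, f (x i) := by
  induction d with
  | zero => exact (hasSum_fintype _).summable
  | succ d ih =>
    have h1 := h.mul_of_nonneg ih hf fun x => Finset.prod_nonneg fun i _ => hf _
    rw [← (Fin.consEquiv fun _ : Fin (d + 1) => ℤ).summable_iff]
    refine h1.congr fun p => ?_
    simp [Fin.prod_univ_succ, Fin.consEquiv]

theorem summable_pow_natAbs {p : ℝ} (hp0 : 0 ≤ p) (hp1 : p < 1) :
    Summable fun k : ℤ => p ^ k.natAbs := by
  rw [summable_int_iff_summable_nat_and_neg]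
  simpa using summable_geometric_of_lt_one hp0 hp1

/-- The Perron–Frobenius profile as a vector of `ℓ²(ℤ)`. -/
noncomputable def decayVec (d : ℕ) (hd : 0 < d) : L2 ℤ :=
  ⟨fun k => (decay d k : ℂ), by
    refine memℓp_gen ?_
    have h := summable_pow_natAbs (p := decayRate d ^ 2) (by positivity)
      (pow_lt_one₀ decayRate_pos.le (decayRate_lt_one hd) two_ne_zero)
    refine h.congr fun k => ?_
    rw [Complex.norm_real, Real.norm_of_nonneg (decay_pos k).le, decay]
    norm_num
    rw [← pow_mul, ← pow_mul, mul_comm]⟩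

theorem decayVec_apply {d : ℕ} (hd : 0 < d) (k : ℤ) : decayVec d hd k = (decay d k : ℂ) := rfl

/-- Exponentially damped Perron–Frobenius vectors are almost eigenvectors. -/
theorem combNorm_le_norm {d : ℕ} (hd : 0 < d) : combNorm d ≤ ‖adjOp (combZ d)‖ := by
  have hlam : 0 < combNorm d := (two_lt_combNorm hd).trans' two_pos
  have key : ∀ p : ℝ, 0 < p → p < 1 → p * combNorm d ≤ ‖adjOp (combZ d)‖ := by
    intro p hp0 hp1
    -- the damping along the base, which costs at most a factor `p` per step
    set g : (Fin d → ℤ) → ℝ := fun x => ∏ i, p ^ (x i).natAbs with hg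
    have hgpos : ∀ x, 0 < g x := fun x => Finset.prod_pos fun i _ => pow_pos hp0 _
    have hgstep : ∀ x y : Fin d → ℤ, ∀ i, (∀ j, j ≠ i → y j = x j) →
        (y i).natAbs ≤ (x i).natAbs + 1 → p * g x ≤ g y := by
      intro x y i hxy hi
      simp only [hg]
      rw [← Finset.mul_prod_erase _ _ (Finset.mem_univ i),
        ← Finset.mul_prod_erase _ _ (Finset.mem_univ i), ← mul_assoc, ← pow_succ']
      have e : ∏ j ∈ Finset.univ.erase i, p ^ (y j).natAbs =
          ∏ j ∈ Finset.univ.erase i, p ^ (x j).natAbs :=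
        Finset.prod_congr rfl fun j hj => by rw [hxy j (Finset.ne_of_mem_erase hj)]
      rw [e]
      have h0 : 0 ≤ ∏ j ∈ Finset.univ.erase i, p ^ (x j).natAbs :=
        Finset.prod_nonneg fun j _ => by positivity
      exact mul_le_mul_of_nonneg_right (pow_le_pow_of_le_one hp0.le hp1.le hi) h0
    have hnb : ∀ x, 2 * d * (p * g x) ≤ nbSum (stdStep d) g x := by
      intro x
      rw [← nbSum_const (stdStep d) (p * g x) x]
      refine Finset.sum_le_sum fun i _ => add_le_add (hgstep _ _ i ?_ ?_) (hgstep _ _ i ?_ ?_)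
      · intro j hj; simp [stdStep, hj]
      · simp [stdStep]; omega
      · intro j hj; simp [stdStep, hj]
      · simp [stdStep]; omega
    set φ : Vtx d → ℝ := fun v => g v.1 * decay d v.2 with hφ
    have hφpos : ∀ v, 0 < φ v := fun v => mul_pos (hgpos _) (decay_pos _)
    have hmem : Memℓp (fun v => (φ v : ℂ)) 2 := by
      refine memℓp_gen ?_
      have h1 := summable_pow_natAbs (p := decayRate d ^ 2) (by positivity)
        (pow_lt_one₀ decayRate_pos.le (decayRate_lt_one hd) two_ne_zero)
      have h2 := summable_pi_prod (d := d) (fun k => by positivity)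
        (summable_pow_natAbs (p := p ^ 2) (by positivity) (pow_lt_one₀ hp0.le hp1 two_ne_zero))
      have h3 := h2.mul_of_nonneg h1 (fun x => Finset.prod_nonneg fun i _ => by positivity)
        fun k => by positivity
      refine h3.congr fun v => ?_
      rw [Complex.norm_real, Real.norm_of_nonneg (hφpos v).le]
      norm_num
      simp only [hφ, hg, decay]
      rw [mul_pow, ← Finset.prod_pow]
      congr 1
      · exact Finset.prod_congr rfl fun i _ => by rw [← pow_mul, ← pow_mul, mul_comm]
      · rw [← pow_mul, ← pow_mul, mul_comm]
    set f : L2 (Vtx d) := ⟨_, hmem⟩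
    have hf : ∀ v, f v = (φ v : ℂ) := fun v => rfl
    have hpt : ∀ v, p * combNorm d * φ v ≤ ∑ w ∈ nbrs (combZ d) v, φ w := by
      rintro ⟨x, k⟩
      rcases eq_or_ne k 0 with rfl | hk
      · rw [sum_nbrs_combZ_zero]
        simp only [hφ, decay_zero, mul_one]
        have h1 := hnb x
        have h2 := decay_step_zero (d := d)
        have h3 := hgpos x
        have h4 : 0 < decay d (0 + 1) + decay d (0 - 1) := add_pos (decay_pos _) (decay_pos _)
        have h5 : p * ((decay d (0 + 1) + decay d (0 - 1)) * g x) ≤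
            (decay d (0 + 1) + decay d (0 - 1)) * g x :=
          mul_le_of_le_one_left (by positivity) hp1.le
        rw [← h2]
        linarith
      · rw [sum_nbrs_combZ _ _ hk]
        simp only [hφ]
        rw [← mul_add, decay_step hk]
        have h3 := mul_pos hlam (mul_pos (hgpos x) (decay_pos (d := d) k))
        have h5 := mul_le_of_le_one_left h3.le hp1.le
        linarith
    have hle : ‖((p * combNorm d : ℝ) : ℂ) • f‖ ≤ ‖adjOp (combZ d) f‖ := by
      refine lp.norm_mono two_ne_zero fun v => ?_
      rw [adjOp_apply]
      simp only [hf]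
      rw [← Complex.ofReal_sum, Complex.norm_real, lp.coeFn_smul, Pi.smul_apply, hf, smul_eq_mul,
        ← Complex.ofReal_mul, Complex.norm_real]
      have h0 : 0 ≤ p * combNorm d * φ v := by
        have := hφpos v
        positivity
      rw [Real.norm_of_nonneg h0, Real.norm_of_nonneg (h0.trans (hpt v))]
      exact hpt v
    rw [norm_smul, Complex.norm_real, Real.norm_of_nonneg (by positivity)] at hle
    have hfne : 0 < ‖f‖ := by
      rw [norm_pos_iff]
      intro h
      have h1 : f (0, 0) = 0 := by rw [h]; rfl
      rw [hf, Complex.ofReal_eq_zero] at h1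
      exact (hφpos _).ne' h1
    exact le_of_mul_le_mul_right (hle.trans ((adjOp (combZ d)).le_opNorm f)) hfne
  by_contra! hlt
  have h0 : ‖adjOp (combZ d)‖ / combNorm d < 1 := (div_lt_one hlam).2 hlt
  obtain ⟨p, hp, hp1⟩ := exists_between h0
  have hp0 : 0 < p := (div_nonneg (norm_nonneg _) hlam.le).trans_lt hp
  rw [div_lt_iff₀ hlam] at hp
  exact (key p hp0 hp1).not_gt hp

theorem norm_adjOp_combZ {d : ℕ} (hd : 0 < d) : ‖adjOp (combZ d)‖ = combNorm d :=
  le_antisymm ((isCombOver_combZ d).norm_adjOp_le Function.injective_id (stdStep_injective d)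
    stdStep_add_ne_zero fun _ _ h => h) (combNorm_le_norm hd)

theorem resolvent_line {d : ℕ} (hd : 0 < d) :
    resolvent (adjOp line) (combNorm d : ℂ) (lp.single 2 0 1) =
      ((2 * d : ℝ) : ℂ)⁻¹ • decayVec d hd := by
  have h2 := two_lt_combNorm hd
  have hlt : ‖adjOp line‖ < ‖(combNorm d : ℂ)‖ := by
    rw [Complex.norm_real, Real.norm_of_nonneg (by linarith)]
    exact (norm_adjOp_le_two_of_le_line fun _ _ h => h).trans_lt h2
  refine (resolvent_unique _ hlt ?_).symm
  have hd0 : ((2 * d : ℝ) : ℂ) ≠ 0 := by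
    rw [Complex.ofReal_ne_zero]
    positivity
  rw [map_smul, smul_comm, ← smul_sub, inv_smul_eq_iff₀ hd0]
  ext k
  rw [lp.coeFn_sub, Pi.sub_apply, lp.coeFn_smul, lp.coeFn_smul, Pi.smul_apply, Pi.smul_apply,
    adjOp_apply, sum_nbrs_line, decayVec_apply, decayVec_apply, decayVec_apply, lp.single_apply,
    smul_eq_mul, smul_eq_mul]
  rcases eq_or_ne k 0 with rfl | hk
  · rw [Pi.single_eq_same, mul_one, ← Complex.ofReal_add, ← Complex.ofReal_mul,
      ← Complex.ofReal_sub]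
    congr 1
    rw [decay_zero, mul_one, ← decay_step_zero]
    ring
  · rw [Pi.single_eq_of_ne hk, mul_zero, ← Complex.ofReal_add, ← Complex.ofReal_mul,
      decay_step hk, sub_self]

theorem norm_decayVec_pos {d : ℕ} (hd : 0 < d) : 0 < ‖decayVec d hd‖ := by
  rw [norm_pos_iff]
  intro h
  have h1 : decayVec d hd 0 = 0 := by rw [h]; rfl
  rw [decayVec_apply, Complex.ofReal_eq_zero] at h1
  exact (decay_pos _).ne' h1

theorem pfFiber_eq {d : ℕ} (hd : 0 < d) :
    pfFiber d = (‖decayVec d hd‖ : ℂ)⁻¹ • decayVec d hd := by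
  have hd0 : (0 : ℝ) < 2 * d := by positivity
  have hn := norm_decayVec_pos hd
  rw [pfFiber, norm_adjOp_combZ hd, resolvent_line hd]
  rw [norm_smul, norm_inv, Complex.norm_real, Real.norm_of_nonneg hd0.le, smul_smul]
  congr 1
  have h1 : ((2 * d : ℝ) : ℂ) ≠ 0 := Complex.ofReal_ne_zero.2 hd0.ne'
  have h2 : (‖decayVec d hd‖ : ℂ) ≠ 0 := Complex.ofReal_ne_zero.2 hn.ne'
  push_cast at h1 ⊢
  field_simp

theorem isGeneralizedPerronFrobenius_pfVector {d : ℕ} (hd : 0 < d) :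
    IsGeneralizedPerronFrobenius (combZ d) (pfVector d) := by
  have hv : ∀ p, pfVector d p = ((‖decayVec d hd‖⁻¹ * decay d p.2 : ℝ) : ℂ) := by
    intro p
    rw [pfVector, pfFiber_eq hd, lp.coeFn_smul, Pi.smul_apply, decayVec_apply]
    simp
  refine ⟨fun p => ?_, ?_⟩
  · rw [hv, Complex.zero_lt_real]
    exact mul_pos (inv_pos.2 (norm_decayVec_pos hd)) (decay_pos _)
  · rintro ⟨x, k⟩
    simp only [hv, norm_adjOp_combZ hd]
    rw [← Complex.ofReal_sum, ← Complex.ofReal_mul, ← Finset.mul_sum, mul_left_comm]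
    congr 2
    rcases eq_or_ne k 0 with rfl | hk
    · rw [sum_nbrs_combZ_zero]
      simp only [nbSum_const, decay_zero, mul_one]
      exact decay_step_zero
    · rw [sum_nbrs_combZ _ _ hk]
      exact decay_step hk

/-! ### Local convergence of the finite combs -/

theorem lineBox_adj_eventually (k : ℤ) :
    ∀ᶠ n : ℕ in atTop, ∀ l, (lineBox n).Adj k l ↔ line.Adj k l := by
  filter_upwards [eventually_gt_atTop k.natAbs] with n hn l
  refine ⟨fun h => h.1, fun h => ⟨h, ?_⟩⟩
  have h' : |k - l| = 1 := h
  rw [abs_le, abs_le]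
  rw [abs_eq zero_le_one] at h'
  omega

theorem tendsto_lineBox (f : L2 ℤ) :
    Tendsto (fun n => adjOp (lineBox n) f) atTop (𝓝 (adjOp line f)) :=
  tendsto_adjOp line lineBox (c := 2)
    (Eventually.of_forall fun _ => norm_adjOp_le_two_of_le_line fun _ _ h => h.1)
    lineBox_adj_eventually f

theorem eventually_mem_baseBox {d : ℕ} (x : Fin d → ℤ) (a : ℕ) :
    ∀ᶠ n : ℕ in atTop, ∀ i, |x i| + a ≤ n := by
  filter_upwards [eventually_ge_atTop (Finset.univ.sup (fun i => (x i).natAbs) + a)] with n hn i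
  have := Finset.le_sup (f := fun i => (x i).natAbs) (Finset.mem_univ i)
  rw [Int.abs_eq_natAbs]
  omega

theorem fibreGraph_adj_eventually {d : ℕ} (p : Vtx d) :
    ∀ᶠ n : ℕ in atTop, ∀ q, (fibreGraph (baseBox d n) (lineBox n)).Adj p q ↔
      (fibreGraph Set.univ line).Adj p q := by
  filter_upwards [lineBox_adj_eventually p.2, eventually_mem_baseBox p.1 0] with n h1 h2 q
  have h3 : p.1 ∈ baseBox d n := fun i => by simpa using h2 i
  simp [fibreGraph, h1, h3]

theorem combBox_adj_eventually {d : ℕ} (p : Vtx d) :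
    ∀ᶠ n : ℕ in atTop, ∀ q, (combBox d n).Adj p q ↔ (combZ d).Adj p q := by
  filter_upwards [fibreGraph_adj_eventually p, eventually_mem_baseBox p.1 1,
    eventually_ge_atTop 1] with n h1 h2 hn q
  rw [isCombOver_combBox d hn, isCombOver_combZ d, h1]
  refine or_congr Iff.rfl ?_
  have hstd : ∀ (i j : Fin d), |stdStep d i j| ≤ 1 := by
    intro i j
    rcases eq_or_ne j i with rfl | hj
    · simp [stdStep]
    · simp [stdStep, hj]
  have h0 : torusLift d n (torusProj d (2 * n + 1) p.1) = p.1 :=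
    torusLift_torusProj fun i => by have := h2 i; push_cast at this; omega
  have hp : ∀ i, torusLift d n (torusProj d (2 * n + 1) p.1 + torusStep d (2 * n + 1) i) =
      p.1 + stdStep d i := by
    intro i
    rw [← torusProj_step, ← torusProj_add]
    refine torusLift_torusProj fun j => ?_
    have h3 := h2 j
    have h4 := abs_add_le (p.1 j) (stdStep d i j)
    have h5 := hstd i j
    push_cast at h3
    rw [Pi.add_apply]
    omega
  have hm : ∀ i, torusLift d n (torusProj d (2 * n + 1) p.1 - torusStep d (2 * n + 1) i) =
      p.1 - stdStep d i := by
    intro i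
    rw [← torusProj_step, ← torusProj_sub]
    refine torusLift_torusProj fun j => ?_
    have h3 := h2 j
    have h4 := abs_sub (p.1 j) (stdStep d i j)
    have h5 := hstd i j
    push_cast at h3
    rw [Pi.sub_apply]
    omega
  constructor
  · rintro ⟨s, i, h3, h4⟩
    have hs : s = torusProj d (2 * n + 1) p.1 := by
      rw [h3, torusProj_torusLift]
    refine ⟨p.1, i, ?_, ?_⟩
    · rw [h3]; rfl
    · rw [hs, hp, hm] at h4
      exact h4
  · rintro ⟨s, i, h3, h4⟩
    have hs : s = p.1 := by rw [h3]; rfl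
    refine ⟨torusProj d (2 * n + 1) p.1, i, ?_, ?_⟩
    · rw [h0, h3]
    · rw [hp, hm, ← hs]
      exact h4

theorem tendsto_combBox {d : ℕ} (f : L2 (Vtx d)) :
    Tendsto (fun n => adjOp (combBox d n) f) atTop (𝓝 (adjOp (combZ d) f)) :=
  tendsto_adjOp (combZ d) (combBox d) (c := combNorm d)
    ((eventually_ge_atTop 1).mono fun _ hn => norm_adjOp_combBox_le hn) combBox_adj_eventually f

theorem tendsto_fibreGraph {d : ℕ} (f : L2 (Vtx d)) :
    Tendsto (fun n => adjOp (fibreGraph (baseBox d n) (lineBox n)) f) atTop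
      (𝓝 (adjOp (fibreGraph Set.univ line) f)) :=
  tendsto_adjOp _ (fun n => fibreGraph (baseBox d n) (lineBox n)) (c := 2)
    (Eventually.of_forall fun _ => norm_adjOp_fibreGraph_le _ fun _ _ h => h.1)
    fibreGraph_adj_eventually f

/-! ### Vectors carried by fibres -/

section FibreVec
variable {d : ℕ}

theorem fiber_apply (ξ : L2 (Vtx d)) (x : Fin d → ℤ) (k : ℤ) : fiber ξ x k = ξ (x, k) := rfl

/-- The vector `δ_x ⊗ r`. -/
noncomputable def fibreVec (x : Fin d → ℤ) (r : L2 ℤ) : L2 (Vtx d) :=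
  ⟨fun p => if p.1 = x then r p.2 else 0, by
    refine memℓp_gen ?_
    have h := (lp.memℓp r).summable (by norm_num)
    rw [← (Prod.mk_right_injective x).summable_iff]
    · simpa [Function.comp_def] using h
    · rintro ⟨y, k⟩ hy
      have : y ≠ x := by
        rintro rfl
        exact hy ⟨k, rfl⟩
      simp [this]⟩

theorem fibreVec_apply (x : Fin d → ℤ) (r : L2 ℤ) (p : Vtx d) :
    fibreVec x r p = if p.1 = x then r p.2 else 0 := rfl

theorem inner_fibreVec (x : Fin d → ℤ) (r : L2 ℤ) (ξ : L2 (Vtx d)) :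
    ⟪fibreVec x r, ξ⟫_ℂ = ⟪r, fiber ξ x⟫_ℂ := by
  rw [lp.inner_eq_tsum, lp.inner_eq_tsum]
  rw [← (Prod.mk_right_injective x).tsum_eq]
  · exact tsum_congr fun k => by simp [fibreVec_apply, fiber_apply]
  · rintro ⟨y, k⟩ hy
    by_cases h : y = x
    · exact ⟨k, by rw [h]⟩
    · exact absurd (by simp [fibreVec_apply, h]) hy

variable {T : Type} [Fintype T]

/-- The vector `∑ t, c t • δ_(σ t) ⊗ r`. -/
noncomputable def combVec (σ : T → Fin d → ℤ) (c : T → ℂ) (r : L2 ℤ) : L2 (Vtx d) :=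
  ∑ t, c t • fibreVec (σ t) r

variable {σ : T → Fin d → ℤ}

theorem combVec_apply_of_mem (hσ : Function.Injective σ) (c : T → ℂ) (r : L2 ℤ) (t : T) (k : ℤ) :
    combVec σ c r (σ t, k) = c t * r k := by
  classical
  rw [combVec, lp.coeFn_sum, Finset.sum_apply, Finset.sum_eq_single t]
  · rw [lp.coeFn_smul, Pi.smul_apply, fibreVec_apply, if_pos rfl, smul_eq_mul]
  · intro s _ hs
    rw [lp.coeFn_smul, Pi.smul_apply, fibreVec_apply, if_neg fun h => hs (hσ h).symm, smul_zero]
  · intro h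
    exact absurd (Finset.mem_univ t) h

theorem combVec_apply_of_notMem (c : T → ℂ) (r : L2 ℤ) {p : Vtx d} (hp : ∀ t, p.1 ≠ σ t) :
    combVec σ c r p = 0 := by
  rw [combVec, lp.coeFn_sum, Finset.sum_apply]
  refine Finset.sum_eq_zero fun t _ => ?_
  rw [lp.coeFn_smul, Pi.smul_apply, fibreVec_apply, if_neg (hp t), smul_zero]

theorem inner_combVec_left (c : T → ℂ) (r : L2 ℤ) (ξ : L2 (Vtx d)) :
    ⟪combVec σ c r, ξ⟫_ℂ = ∑ t, conj (c t) * ⟪r, fiber ξ (σ t)⟫_ℂ := by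
  rw [combVec, sum_inner]
  refine Finset.sum_congr rfl fun t _ => ?_
  rw [inner_smul_left, inner_fibreVec]

theorem combVec_add (c c' : T → ℂ) (r : L2 ℤ) :
    combVec σ (fun t => c t + c' t) r = combVec σ c r + combVec σ c' r := by
  simp only [combVec, add_smul, Finset.sum_add_distrib]

theorem combVec_sub_right (c : T → ℂ) (r r' : L2 ℤ) (hσ : Function.Injective σ) :
    combVec σ c (r - r') = combVec σ c r - combVec σ c r' := by
  ext p
  rw [lp.coeFn_sub, Pi.sub_apply]
  by_cases hp : ∃ t, p.1 = σ t
  · obtain ⟨t, ht⟩ := hp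
    obtain ⟨x, k⟩ := p
    obtain rfl : x = σ t := ht
    rw [combVec_apply_of_mem hσ, combVec_apply_of_mem hσ, combVec_apply_of_mem hσ, lp.coeFn_sub,
      Pi.sub_apply, mul_sub]
  · push Not at hp
    simp [combVec_apply_of_notMem _ _ hp]

theorem combVec_smul_right (c : T → ℂ) (z : ℂ) (r : L2 ℤ) (hσ : Function.Injective σ) :
    combVec σ c (z • r) = z • combVec σ c r := by
  ext p
  rw [lp.coeFn_smul, Pi.smul_apply]
  by_cases hp : ∃ t, p.1 = σ t
  · obtain ⟨t, ht⟩ := hp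
    obtain ⟨x, k⟩ := p
    obtain rfl : x = σ t := ht
    rw [combVec_apply_of_mem hσ, combVec_apply_of_mem hσ, lp.coeFn_smul,
      Pi.smul_apply, smul_eq_mul, smul_eq_mul, mul_left_comm]
  · push Not at hp
    simp [combVec_apply_of_notMem _ _ hp]

end FibreVec

/-! ### The adjacency operator of the finite comb -/

section CombBox
variable {d n : ℕ}

theorem exists_torusLift_iff (x : Fin d → ℤ) :
    (∃ t, x = torusLift d n t) ↔ x ∈ baseBox d n := by
  constructor
  · rintro ⟨t, rfl⟩
    exact abs_torusLift_le t
  · intro h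
    exact ⟨_, (torusLift_torusProj h).symm⟩

/-- The finite comb consists of its fibres and of the torus that joins their origins. -/
theorem adjOp_combBox (hn : 1 ≤ n) (f : L2 (Vtx d)) :
    adjOp (combBox d n) f = adjOp (fibreGraph (baseBox d n) (lineBox n)) f +
      combVec (torusLift d n)
        (nbSum (torusStep d (2 * n + 1)) fun t => f (torusLift d n t, 0)) (lp.single 2 0 1) := by
  have hG := isCombOver_combBox d hn
  ext p
  rw [lp.coeFn_add, Pi.add_apply, adjOp_apply, adjOp_apply]
  by_cases hp : ∃ t, p.1 = torusLift d n t
  · obtain ⟨t, ht⟩ := hp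
    obtain ⟨x, k⟩ := p
    obtain rfl : x = torusLift d n t := ht
    rw [combVec_apply_of_mem (torusLift_injective d n), lp.single_apply]
    rcases eq_or_ne k 0 with rfl | hk
    · rw [hG.sum_nbrs_zero (torusLift_injective d n) (torusStep_injective hn)
        (torusStep_add_ne_zero hn), Pi.single_eq_same, mul_one]
    · rw [hG.nbrs_eq fun s h => hk (congrArg Prod.snd h), Pi.single_eq_of_ne hk, mul_zero, add_zero]
  · push Not at hp
    rw [combVec_apply_of_notMem _ _ hp, add_zero,
      hG.nbrs_eq fun s h => hp s (congrArg Prod.fst h)]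

theorem adjOp_fibreGraph_combVec (c : (Fin d → ZMod (2 * n + 1)) → ℂ) (r : L2 ℤ) :
    adjOp (fibreGraph (baseBox d n) (lineBox n)) (combVec (torusLift d n) c r) =
      combVec (torusLift d n) c (adjOp (lineBox n) r) := by
  have hσ := torusLift_injective d n
  ext p
  rw [adjOp_apply]
  by_cases hp : ∃ t, p.1 = torusLift d n t
  · have hB := (exists_torusLift_iff _).1 hp
    obtain ⟨t, ht⟩ := hp
    obtain ⟨x, k⟩ := p
    obtain rfl : x = torusLift d n t := ht
    rw [sum_nbrs_fibreGraph _ _ hB, combVec_apply_of_mem hσ, adjOp_apply, Finset.mul_sum]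
    exact Finset.sum_congr rfl fun l _ => combVec_apply_of_mem hσ _ _ _ _
  · push Not at hp
    rw [combVec_apply_of_notMem _ _ hp]
    refine Finset.sum_eq_zero fun q hq => ?_
    have h1 : p.1 = q.1 := ((mem_nbrs _).1 hq).1
    exact combVec_apply_of_notMem _ _ fun t => h1 ▸ hp t

end CombBox

/-! ### The resolvent of the finite comb -/

theorem re_inner_sub_pos {H : Type} [NormedAddCommGroup H] [InnerProductSpace ℂ H]
    (X : H →L[ℂ] H) {s : ℝ} (hs : ‖X‖ < s) {y : H} (hy : y ≠ 0) :
    0 < (⟪y, (s : ℂ) • y - X y⟫_ℂ).re := by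
  have h1 : (⟪y, X y⟫_ℂ).re ≤ ‖X‖ * ‖y‖ ^ 2 := by
    calc (⟪y, X y⟫_ℂ).re ≤ ‖⟪y, X y⟫_ℂ‖ := Complex.re_le_norm _
      _ ≤ ‖y‖ * ‖X y‖ := norm_inner_le_norm _ _
      _ ≤ ‖y‖ * (‖X‖ * ‖y‖) := by gcongr; exact X.le_opNorm y
      _ = _ := by ring
  have h2 : (⟪y, (s : ℂ) • y⟫_ℂ).re = s * ‖y‖ ^ 2 := by
    rw [inner_smul_right, inner_self_eq_norm_sq_to_K, Complex.re_ofReal_mul]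
    congr 1
    norm_cast
  have h3 : 0 < ‖y‖ := norm_pos_iff.2 hy
  rw [inner_sub_right, Complex.sub_re, h2]
  have h4 : ‖X‖ * ‖y‖ ^ 2 < s * ‖y‖ ^ 2 := by gcongr
  linarith

/-- The resolvent vector of the chain on `[-n, n]`, with source at the origin. -/
noncomputable def chainVec (n : ℕ) (s : ℝ) : L2 ℤ :=
  resolvent (adjOp (lineBox n)) (s : ℂ) (lp.single 2 0 1)

section ChainVec
variable {n : ℕ} {s : ℝ}

theorem lineBox_le_line (n : ℕ) : ∀ k l, (lineBox n).Adj k l → line.Adj k l := fun _ _ h => h.1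

theorem norm_lineBox_lt (hs : 2 < s) : ‖adjOp (lineBox n)‖ < ‖(s : ℂ)‖ := by
  rw [Complex.norm_real, Real.norm_of_nonneg (by linarith)]
  exact (norm_adjOp_le_two_of_le_line (lineBox_le_line n)).trans_lt hs

theorem chainVec_spec (hs : 2 < s) :
    (s : ℂ) • chainVec n s - adjOp (lineBox n) (chainVec n s) = lp.single 2 0 1 :=
  resolvent_spec _ (norm_lineBox_lt hs) _

theorem chainVec_eq_zero (hs : 2 < s) {k : ℤ} (hk : (n : ℤ) < |k|) : chainVec n s k = 0 := by
  have h := congrArg (fun f : L2 ℤ => f k) (chainVec_spec (n := n) hs)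
  simp only at h
  have hk0 : k ≠ 0 := by
    rintro rfl
    simp at hk
    omega
  have hnb : nbrs (lineBox n) k = ∅ := by
    ext l
    simp only [mem_nbrs, Finset.notMem_empty, iff_false]
    exact fun h => absurd h.2.1 (not_le.2 hk)
  rw [lp.coeFn_sub, Pi.sub_apply, lp.coeFn_smul, Pi.smul_apply, adjOp_apply, hnb,
    Finset.sum_empty, sub_zero, lp.single_apply, Pi.single_eq_of_ne hk0, smul_eq_mul] at h
  exact (mul_eq_zero.1 h).resolve_left (Complex.ofReal_ne_zero.2 (by linarith : 0 < s).ne')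

theorem single_zero_ne_zero : (lp.single 2 0 1 : L2 ℤ) ≠ 0 := by
  intro h
  have := congrArg (fun f : L2 ℤ => f 0) h
  simp [lp.single_apply] at this

theorem chainVec_ne_zero (hs : 2 < s) : chainVec n s ≠ 0 := by
  intro h
  have := chainVec_spec (n := n) hs
  rw [h, smul_zero, map_zero, sub_zero] at this
  exact single_zero_ne_zero this.symm

theorem exists_chainVec_zero (hs : 2 < s) : ∃ g : ℝ, 0 < g ∧ chainVec n s 0 = (g : ℂ) := by
  set r := chainVec n s with hr
  have h1 : ⟪(lp.single 2 0 1 : L2 ℤ), r⟫_ℂ = r 0 := by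
    rw [lp.inner_single_left]; simp
  have h2 : ⟪r, (lp.single 2 0 1 : L2 ℤ)⟫_ℂ = r 0 := by
    rw [← h1, ← chainVec_spec (n := n) hs, ← hr, inner_sub_right, inner_sub_left, inner_smul_left,
      inner_smul_right, inner_adjOp_left, Complex.conj_ofReal]
  refine ⟨(r 0).re, ?_, ?_⟩
  · rw [← h2, ← chainVec_spec (n := n) hs]
    exact re_inner_sub_pos _ ((norm_adjOp_le_two_of_le_line (lineBox_le_line n)).trans_lt hs)
      (chainVec_ne_zero hs)
  · have h3 : conj (r 0) = r 0 := by
      rw [← h2, inner_conj_symm, h1, h2]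
    exact (Complex.conj_eq_iff_re.1 h3).symm

end ChainVec

section Resolvent
variable {d n : ℕ} {s : ℝ}

/-- On vectors built from the chain resolvent, `s - A` acts at level zero only. -/
theorem sub_adjOp_combVec (hn : 1 ≤ n) (hs : 2 < s) (c : (Fin d → ZMod (2 * n + 1)) → ℂ) :
    (s : ℂ) • combVec (torusLift d n) c (chainVec n s) -
        adjOp (combBox d n) (combVec (torusLift d n) c (chainVec n s)) =
      combVec (torusLift d n) c (lp.single 2 0 1) -
        combVec (torusLift d n)
          (nbSum (torusStep d (2 * n + 1)) fun t => c t * chainVec n s 0) (lp.single 2 0 1) := by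
  have hσ := torusLift_injective d n
  rw [adjOp_combBox hn, adjOp_fibreGraph_combVec, ← combVec_smul_right _ _ _ hσ, ← sub_sub,
    ← combVec_sub_right _ _ _ hσ, chainVec_spec hs]
  simp only [combVec_apply_of_mem hσ]

/-- The mass of the effective torus Green function is positive: this is positivity of
`s - A` on the constant vector in the base direction. -/
theorem chainVec_zero_lt (hd : 0 < d) (hn : 1 ≤ n) (hs : combNorm d < s) {g : ℝ} (hg : 0 < g)
    (hg' : chainVec n s 0 = (g : ℂ)) : 2 * d * g < 1 := by
  have hs2 : 2 < s := (two_lt_combNorm hd).trans hs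
  have hσ := torusLift_injective d n
  set y := combVec (torusLift d n) (fun _ => 1) (chainVec n s) with hy
  have hy0 : y ≠ 0 := by
    intro h
    have h1 : y (torusLift d n 0, 0) = 0 := by rw [h]; rfl
    rw [hy, combVec_apply_of_mem hσ, hg', one_mul, Complex.ofReal_eq_zero] at h1
    exact hg.ne' h1
  have h1 := re_inner_sub_pos (adjOp (combBox d n))
    ((norm_adjOp_combBox_le hn).trans_lt hs) hy0
  have e : ∀ t : Fin d → ZMod (2 * n + 1),
      nbSum (torusStep d (2 * n + 1)) (fun _ => chainVec n s 0) t = 2 * d * g := by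
    intro t
    rw [hg']
    simp [nbSum]
    ring
  rw [hy, sub_adjOp_combVec hn hs2, ← hy, inner_sub_right, hy, inner_combVec_left,
    inner_combVec_left] at h1
  have e2 : ∀ (c : (Fin d → ZMod (2 * n + 1)) → ℂ) t,
      ⟪chainVec n s, fiber (combVec (torusLift d n) c (lp.single 2 0 1)) (torusLift d n t)⟫_ℂ =
        c t * g := by
    intro c t
    have : fiber (combVec (torusLift d n) c (lp.single 2 0 1)) (torusLift d n t) =
        c t • lp.single 2 0 1 := by
      ext k
      rw [fiber_apply, combVec_apply_of_mem hσ, lp.coeFn_smul, Pi.smul_apply, smul_eq_mul]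
    rw [this, inner_smul_right, lp.inner_single_right, hg']
    simp
  simp only [e2, e, map_one, one_mul] at h1
  rw [← Finset.sum_sub_distrib, Finset.sum_const, nsmul_eq_mul] at h1
  have e3 : (g : ℂ) - 2 * d * g * g = ((g * (1 - 2 * d * g) : ℝ) : ℂ) := by
    push_cast; ring
  rw [e3, ← Complex.ofReal_natCast, ← Complex.ofReal_mul, Complex.ofReal_re] at h1
  have h2 := pos_of_mul_pos_right h1 (Nat.cast_nonneg _)
  have h3 := pos_of_mul_pos_right h2 hg.le
  linarith

theorem norm_fibre_lt (hs : 2 < s) :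
    ‖adjOp (fibreGraph (baseBox d n) (lineBox n))‖ < ‖(s : ℂ)‖ := by
  rw [Complex.norm_real, Real.norm_of_nonneg (by linarith)]
  exact (norm_adjOp_fibreGraph_le _ (lineBox_le_line n)).trans_lt hs

theorem resolvent_fibre_apply_zero (hs : 2 < s) (ξ : L2 (Vtx d)) (t : Fin d → ZMod (2 * n + 1)) :
    resolvent (adjOp (fibreGraph (baseBox d n) (lineBox n))) (s : ℂ) ξ (torusLift d n t, 0) =
      ⟪chainVec n s, fiber ξ (torusLift d n t)⟫_ℂ := by
  classical
  have hσ := torusLift_injective d n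
  set S := resolvent (adjOp (fibreGraph (baseBox d n) (lineBox n))) (s : ℂ) ξ with hS
  have hspec := resolvent_spec _ (norm_fibre_lt (d := d) (n := n) hs) ξ
  rw [← hS] at hspec
  set c : (Fin d → ZMod (2 * n + 1)) → ℂ := Pi.single t 1 with hc
  have hsum : ∀ (r : L2 ℤ) (f : L2 (Vtx d)),
      ⟪combVec (torusLift d n) c r, f⟫_ℂ = ⟪r, fiber f (torusLift d n t)⟫_ℂ := by
    intro r f
    rw [inner_combVec_left, Finset.sum_eq_single t]
    · simp [hc]
    · intro t' _ ht'
      simp [hc, ht']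
    · intro h
      exact absurd (Finset.mem_univ t) h
  rw [← hsum, ← hspec, inner_sub_right, ← inner_adjOp_left, adjOp_fibreGraph_combVec,
    inner_smul_right]
  have h1 : (s : ℂ) * ⟪combVec (torusLift d n) c (chainVec n s), S⟫_ℂ =
      ⟪(s : ℂ) • combVec (torusLift d n) c (chainVec n s), S⟫_ℂ := by
    rw [inner_smul_left, Complex.conj_ofReal]
  rw [h1, ← inner_sub_left, ← combVec_smul_right _ _ _ hσ, ← combVec_sub_right _ _ _ hσ,
    chainVec_spec hs, hsum, lp.inner_single_left, fiber_apply]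
  simp

/-- The resolvent of the finite comb in terms of the resolvent of its fibres and of the Green
function `K` of the base torus, whose mass `1 / g - 2 d` is determined by the fibres. -/
theorem inner_resolvent_combBox (hd : 0 < d) (hn : 1 ≤ n) (hs : combNorm d < s) {g : ℝ}
    (hg : 0 < g) (hg' : chainVec n s 0 = (g : ℂ)) {K : (Fin d → ZMod (2 * n + 1)) → ℝ}
    (hK : IsGreen (torusStep d (2 * n + 1)) (g⁻¹ - 2 * d) K) (ξ η : L2 (Vtx d)) :
    ⟪η, resolvent (adjOp (combBox d n)) (s : ℂ) ξ⟫_ℂ =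
      ⟪η, resolvent (adjOp (fibreGraph (baseBox d n) (lineBox n))) (s : ℂ) ξ⟫_ℂ +
      ∑ t, conj ⟪chainVec n s, fiber η (torusLift d n t)⟫_ℂ *
        ((g : ℂ)⁻¹ * ((g : ℂ)⁻¹ * ∑ u, (K (t - u) : ℂ) *
          ⟪chainVec n s, fiber ξ (torusLift d n u)⟫_ℂ -
            ⟪chainVec n s, fiber ξ (torusLift d n t)⟫_ℂ)) := by
  classical
  have hs2 : 2 < s := (two_lt_combNorm hd).trans hs
  have hg0 : (g : ℂ) ≠ 0 := Complex.ofReal_ne_zero.2 hg.ne'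
  set p : (Fin d → ZMod (2 * n + 1)) → ℂ :=
    fun t => ⟪chainVec n s, fiber ξ (torusLift d n t)⟫_ℂ with hp
  -- `q` is the solution at level zero, `c` the charge induced on the fibre over a base point
  set q : (Fin d → ZMod (2 * n + 1)) → ℂ := fun t => (g : ℂ)⁻¹ * ∑ u, (K (t - u) : ℂ) * p u with hq
  set c : (Fin d → ZMod (2 * n + 1)) → ℂ := fun t => (g : ℂ)⁻¹ * (q t - p t) with hc
  have hKc : ∀ x, (g : ℂ)⁻¹ * (K x : ℂ) - nbSum (torusStep d (2 * n + 1)) (fun y => (K y : ℂ)) x =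
      if x = 0 then 1 else 0 := by
    intro x
    have h := hK x
    have h2 : nbSum (torusStep d (2 * n + 1)) (fun y => (K y : ℂ)) x =
        ((nbSum (torusStep d (2 * n + 1)) K x : ℝ) : ℂ) := by
      simp [nbSum]
    have h3 : ((g⁻¹ * K x - nbSum (torusStep d (2 * n + 1)) K x : ℝ) : ℂ) =
        if x = 0 then 1 else 0 := by
      have : g⁻¹ * K x - nbSum (torusStep d (2 * n + 1)) K x = if x = 0 then 1 else 0 := by
        rw [sub_add_cancel] at h
        rw [h]
        congr
      rw [this]
      split_ifs <;> simp
    rw [h2, ← h3]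
    push_cast
    rfl
  have hqeq : ∀ t, nbSum (torusStep d (2 * n + 1)) q t = c t := by
    intro t
    have h1 : nbSum (torusStep d (2 * n + 1)) q t = (g : ℂ)⁻¹ * ∑ u,
        nbSum (torusStep d (2 * n + 1)) (fun y => (K y : ℂ)) (t - u) * p u := by
      simp only [nbSum, hq, Finset.sum_mul, add_mul, Finset.sum_add_distrib, ← Finset.mul_sum,
        mul_add]
      congr 2
      · rw [Finset.sum_comm]
        refine Finset.sum_congr rfl fun i _ => Finset.sum_congr rfl fun u _ => ?_
        rw [add_sub_right_comm]
      · rw [Finset.sum_comm]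
        refine Finset.sum_congr rfl fun i _ => Finset.sum_congr rfl fun u _ => ?_
        rw [sub_right_comm]
    have h2 : ∀ u, nbSum (torusStep d (2 * n + 1)) (fun y => (K y : ℂ)) (t - u) * p u =
        (g : ℂ)⁻¹ * ((K (t - u) : ℂ) * p u) - if u = t then p u else 0 := by
      intro u
      have h3 := hKc (t - u)
      simp only [sub_eq_zero, eq_comm (a := t)] at h3
      rw [← sub_eq_iff_eq_add'.2 (sub_eq_iff_eq_add.1 h3), sub_mul, ite_mul, one_mul, zero_mul,
        mul_assoc]
    rw [h1]
    simp only [h2, Finset.sum_sub_distrib, ← Finset.mul_sum, Finset.sum_ite_eq', Finset.mem_univ,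
      if_true]
    rfl
  set S := resolvent (adjOp (fibreGraph (baseBox d n) (lineBox n))) (s : ℂ) ξ with hS
  have hspec := resolvent_spec _ (norm_fibre_lt (d := d) (n := n) hs2) ξ
  rw [← hS] at hspec
  have hSp : ∀ t, S (torusLift d n t, 0) = p t := resolvent_fibre_apply_zero hs2 ξ
  have hlt : ‖adjOp (combBox d n)‖ < ‖(s : ℂ)‖ := by
    rw [Complex.norm_real, Real.norm_of_nonneg (by linarith)]
    exact (norm_adjOp_combBox_le hn).trans_lt hs
  have hy : S + combVec (torusLift d n) c (chainVec n s) =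
      resolvent (adjOp (combBox d n)) (s : ℂ) ξ := by
    refine resolvent_unique _ hlt ?_
    have h1 : (s : ℂ) • S - adjOp (combBox d n) S = ξ - combVec (torusLift d n)
        (nbSum (torusStep d (2 * n + 1)) p) (lp.single 2 0 1) := by
      rw [adjOp_combBox hn, ← sub_sub, hspec]
      simp only [hSp]
    have h2 := sub_adjOp_combVec (d := d) hn hs2 c
    rw [smul_add, map_add, add_sub_add_comm, h1, h2]
    have h3 : c = fun t => nbSum (torusStep d (2 * n + 1)) p t +
        nbSum (torusStep d (2 * n + 1)) (fun t => c t * chainVec n s 0) t := by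
      ext t
      rw [← hqeq t]
      simp only [nbSum, ← Finset.sum_add_distrib, hg', hc]
      refine Finset.sum_congr rfl fun i _ => ?_
      field_simp
      ring
    have h4 : combVec (torusLift d n) c (lp.single 2 0 1) =
        combVec (torusLift d n) (nbSum (torusStep d (2 * n + 1)) p) (lp.single 2 0 1) +
        combVec (torusLift d n) (nbSum (torusStep d (2 * n + 1)) fun t => c t * chainVec n s 0)
          (lp.single 2 0 1) := by
      rw [← combVec_add, ← h3]
    rw [h4]
    abel
  rw [← hy, inner_add_right]
  congr 1
  rw [← inner_conj_symm, inner_combVec_left, map_sum]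
  refine Finset.sum_congr rfl fun t _ => ?_
  rw [map_mul, Complex.conj_conj, mul_comm]

end Resolvent

/-! ### Sums over large boxes -/

section BoxSums
variable {d : ℕ}

theorem eventually_mem_baseBox_zero (x : Fin d → ℤ) : ∀ᶠ n : ℕ in atTop, x ∈ baseBox d n :=
  (eventually_mem_baseBox x 0).mono fun n h i => by simpa using h i

open Classical in
theorem sum_torusLift (n : ℕ) (F : (Fin d → ℤ) → ℂ) :
    ∑ t, F (torusLift d n t) = ∑' x, if x ∈ baseBox d n then F x else 0 := by
  rw [← tsum_fintype (L := .unconditional _), ← (torusLift_injective d n).tsum_eq]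
  · exact tsum_congr fun t => by rw [if_pos ((exists_torusLift_iff _).1 ⟨t, rfl⟩)]
  · intro x hx
    by_contra h
    refine hx (if_neg fun hB => h ?_)
    obtain ⟨t, rfl⟩ := (exists_torusLift_iff _).2 hB
    exact ⟨t, rfl⟩

/-- Dominated convergence for sums over growing boxes. -/
theorem tendsto_sum_torusLift {F : ℕ → (Fin d → ℤ) → ℂ} {F' : (Fin d → ℤ) → ℂ}
    {bound : (Fin d → ℤ) → ℝ} (hb : Summable bound) (hF : ∀ x, Tendsto (fun n => F n x) atTop
      (𝓝 (F' x))) (h : ∀ᶠ n in atTop, ∀ x, ‖F n x‖ ≤ bound x) :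
    Tendsto (fun n => ∑ t, F n (torusLift d n t)) atTop (𝓝 (∑' x, F' x)) := by
  classical
  simp only [sum_torusLift]
  refine tendsto_tsum_of_dominated_convergence hb (fun x => ?_) ?_
  · refine (hF x).congr' ?_
    filter_upwards [eventually_mem_baseBox_zero x] with n hn
    rw [if_pos hn]
  · filter_upwards [h] with n hn x
    split_ifs
    · exact hn x
    · rw [norm_zero]
      exact (norm_nonneg _).trans (hn x)

/-- Dominated convergence for double sums over growing boxes. -/
theorem tendsto_sum_sum_torusLift {F : ℕ → (Fin d → ℤ) → (Fin d → ℤ) → ℂ}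
    {F' : (Fin d → ℤ) → (Fin d → ℤ) → ℂ} {bound : (Fin d → ℤ) × (Fin d → ℤ) → ℝ}
    (hb : Summable bound)
    (hF : ∀ x y, Tendsto (fun n => F n x y) atTop (𝓝 (F' x y)))
    (h : ∀ᶠ n in atTop, ∀ x y, ‖F n x y‖ ≤ bound (x, y)) :
    Tendsto (fun n => ∑ t, ∑ u, F n (torusLift d n t) (torusLift d n u)) atTop
      (𝓝 (∑' p : (Fin d → ℤ) × (Fin d → ℤ), F' p.1 p.2)) := by
  classical
  have e : ∀ n, ∑ t, ∑ u, F n (torusLift d n t) (torusLift d n u) =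
      ∑' p : (Fin d → ℤ) × (Fin d → ℤ),
        if p.1 ∈ baseBox d n ∧ p.2 ∈ baseBox d n then F n p.1 p.2 else 0 := by
    intro n
    rw [← Fintype.sum_prod_type' (fun t u => F n (torusLift d n t) (torusLift d n u)),
      ← tsum_fintype (L := .unconditional _),
      ← ((torusLift_injective d n).prodMap (torusLift_injective d n)).tsum_eq]
    · refine tsum_congr fun p => ?_
      rw [if_pos]
      · rfl
      · exact ⟨(exists_torusLift_iff _).1 ⟨p.1, rfl⟩, (exists_torusLift_iff _).1 ⟨p.2, rfl⟩⟩
    · rintro ⟨x, y⟩ hx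
      by_contra h
      refine hx (if_neg fun hB => h ?_)
      obtain ⟨t, ht⟩ := (exists_torusLift_iff _).2 hB.1
      obtain ⟨u, hu⟩ := (exists_torusLift_iff _).2 hB.2
      exact ⟨(t, u), Prod.ext ht.symm hu.symm⟩
  simp only [e]
  refine tendsto_tsum_of_dominated_convergence hb (fun p => ?_) ?_
  · refine (hF p.1 p.2).congr' ?_
    filter_upwards [eventually_mem_baseBox_zero p.1, eventually_mem_baseBox_zero p.2] with n h1 h2
    rw [if_pos ⟨h1, h2⟩]
  · filter_upwards [h] with n hn p
    split_ifs
    · exact hn p.1 p.2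
    · rw [norm_zero]
      exact (norm_nonneg _).trans (hn p.1 p.2)

theorem boxVector_eq (n : ℕ) (w : L2 ℤ) :
    boxVector d n w = combVec (torusLift d n) (fun _ => 1) w := by
  ext ⟨x, k⟩
  by_cases hx : x ∈ baseBox d n
  · obtain ⟨t, rfl⟩ := (exists_torusLift_iff _).2 hx
    rw [combVec_apply_of_mem (torusLift_injective d n), one_mul, boxVector,
      Set.indicator_of_mem (by exact hx)]
  · rw [combVec_apply_of_notMem _ _ fun t ht => hx ((exists_torusLift_iff _).1 ⟨t, ht⟩), boxVector,
      Set.indicator_of_notMem (by exact hx)]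

theorem pairing_boxVector (n : ℕ) (w : L2 ℤ) (ξ : L2 (Vtx d)) :
    pairing (boxVector d n w) ξ = ∑ t, ⟪w, fiber ξ (torusLift d n t)⟫_ℂ := by
  have h := inner_combVec_left (σ := torusLift d n) (fun _ => 1) w ξ
  simp only [map_one, one_mul] at h
  rw [← h, lp.inner_eq_tsum, pairing, boxVector_eq]
  exact tsum_congr fun p => by rw [RCLike.inner_apply, mul_comm]

end BoxSums

/-! ### Rapidly decreasing vectors -/

section RapidDecrease
variable {d : ℕ}

theorem summable_weight : Summable fun x : Fin d → ℤ => ∏ i, (1 + |(x i : ℝ)|)⁻¹ ^ 2 := by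
  refine summable_pi_prod (f := fun k : ℤ => (1 + |(k : ℝ)|)⁻¹ ^ 2) (fun k => by positivity) ?_
  have h : Summable fun k : ℕ => (1 + |((k : ℤ) : ℝ)|)⁻¹ ^ 2 := by
    refine ((summable_nat_add_iff 1).2 (Real.summable_one_div_nat_pow.2 one_lt_two)).congr
      fun k => ?_
    rw [Int.cast_natCast, abs_of_nonneg (Nat.cast_nonneg k)]
    push_cast
    rw [one_div, inv_pow, add_comm]
  rw [summable_int_iff_summable_nat_and_neg]
  refine ⟨h, h.congr fun k => ?_⟩
  push_cast
  rw [abs_neg]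

theorem summable_fiber_norm {ξ : L2 (Vtx d)} (hξ : ξ ∈ S0 d) :
    Summable fun x : Fin d → ℤ => (1 + ∑ i, |(x i : ℝ)|) * ‖fiber ξ x‖ := by
  obtain ⟨C, hC⟩ := hξ (2 * d + 1)
  refine Summable.of_nonneg_of_le (fun x => by positivity) (fun x => ?_)
    ((summable_weight (d := d)).mul_left ((1 + d) * C))
  have hx : ∀ i, |(x i : ℝ)| ≤ ‖x‖ := fun i => norm_le_pi_norm x i
  have h1 : 1 + ∑ i, |(x i : ℝ)| ≤ (1 + d) * (1 + ‖x‖) := by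
    have h2 : ∑ i, |(x i : ℝ)| ≤ d * ‖x‖ := by
      refine (Finset.sum_le_sum fun i _ => hx i).trans ?_
      simp
    have h3 := norm_nonneg x
    have h4 : (0 : ℝ) ≤ d := Nat.cast_nonneg d
    nlinarith
  have h5 : ∏ i, (1 + |(x i : ℝ)|) ^ 2 ≤ (1 + ‖x‖) ^ (2 * d) := by
    calc ∏ i, (1 + |(x i : ℝ)|) ^ 2 ≤ ∏ _i : Fin d, (1 + ‖x‖) ^ 2 := by
          refine Finset.prod_le_prod (fun i _ => by positivity) fun i _ => ?_
          have := hx i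
          gcongr
      _ = _ := by rw [Finset.prod_const, Finset.card_fin, ← pow_mul]
  have h6 : 0 < ∏ i, (1 + |(x i : ℝ)|) ^ 2 := Finset.prod_pos fun i _ => by positivity
  have h7 : ∏ i, (1 + |(x i : ℝ)|)⁻¹ ^ 2 = (∏ i, (1 + |(x i : ℝ)|) ^ 2)⁻¹ := by
    simp only [inv_pow, Finset.prod_inv_distrib]
  rw [h7, ← div_eq_mul_inv, le_div_iff₀ h6]
  calc (1 + ∑ i, |(x i : ℝ)|) * ‖fiber ξ x‖ * ∏ i, (1 + |(x i : ℝ)|) ^ 2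
      ≤ ((1 + d) * (1 + ‖x‖)) * ‖fiber ξ x‖ * (1 + ‖x‖) ^ (2 * d) := by gcongr
    _ = (1 + d) * ((1 + ‖x‖) ^ (2 * d + 1) * ‖fiber ξ x‖) := by ring
    _ ≤ (1 + d) * C := by gcongr; exact hC x

theorem summable_fiber_norm' {ξ : L2 (Vtx d)} (hξ : ξ ∈ S0 d) :
    Summable fun x : Fin d → ℤ => ‖fiber ξ x‖ := by
  refine Summable.of_nonneg_of_le (fun x => norm_nonneg _) (fun x => ?_) (summable_fiber_norm hξ)
  refine le_mul_of_one_le_left (norm_nonneg _) ?_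
  have : 0 ≤ ∑ i, |(x i : ℝ)| := Finset.sum_nonneg fun i _ => abs_nonneg _
  linarith

theorem summable_mul_and_tsum_le (w f : L2 ℤ) :
    (Summable fun k => ‖w k‖ * ‖f k‖) ∧ ∑' k, ‖w k‖ * ‖f k‖ ≤ ‖w‖ * ‖f‖ := by
  have hsum : ∀ f : L2 ℤ, Summable fun k => ‖f k‖ ^ (2 : ℝ) := fun f => by
    have := (lp.memℓp f).summable (by norm_num)
    simpa using this
  have hnorm : ∀ f : L2 ℤ, (∑' k, ‖f k‖ ^ (2 : ℝ)) ^ (1 / 2 : ℝ) = ‖f‖ := fun f => by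
    rw [lp.norm_eq_tsum_rpow (by norm_num)]
    simp
  have hpq : Real.HolderConjugate 2 2 := Real.HolderConjugate.two_two
  have h := Real.summable_and_inner_le_Lp_mul_Lq_tsum_of_nonneg hpq
    (fun k => norm_nonneg (w k)) (fun k => norm_nonneg (f k)) (hsum w) (hsum f)
  rw [hnorm, hnorm] at h
  exact h

theorem summable_conj_mul (w : L2 ℤ) {ξ : L2 (Vtx d)} (hξ : ξ ∈ S0 d) :
    Summable fun p : Vtx d => conj (w p.2) * ξ p := by
  have h : Summable fun p : Vtx d => ‖w p.2‖ * ‖ξ p‖ := by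
    refine (summable_prod_of_nonneg fun p => mul_nonneg (norm_nonneg _) (norm_nonneg _)).2
      ⟨fun x => (summable_mul_and_tsum_le w (fiber ξ x)).1, ?_⟩
    exact Summable.of_nonneg_of_le
      (fun x => tsum_nonneg fun k => mul_nonneg (norm_nonneg _) (norm_nonneg _))
      (fun x => (summable_mul_and_tsum_le w (fiber ξ x)).2)
      ((summable_fiber_norm' hξ).mul_left ‖w‖)
  refine Summable.of_norm (h.congr fun p => ?_)
  rw [norm_mul, RCLike.norm_conj]

theorem summable_pfVector_mul {ξ : L2 (Vtx d)} (hξ : ξ ∈ S0 d) :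
    Summable fun p : Vtx d => conj (pfVector d p) * ξ p :=
  summable_conj_mul (pfFiber d) hξ

theorem pairing_pfVector {ξ : L2 (Vtx d)} (hξ : ξ ∈ S0 d) :
    pairing (pfVector d) ξ = ∑' x, ⟪pfFiber d, fiber ξ x⟫_ℂ := by
  rw [pairing, (summable_pfVector_mul hξ).tsum_prod]
  refine tsum_congr fun x => ?_
  rw [lp.inner_eq_tsum]
  exact tsum_congr fun k => by rw [RCLike.inner_apply, mul_comm]; rfl

theorem tendsto_pairing_boxVector {w : ℕ → L2 ℤ} (hw : Tendsto w atTop (𝓝 (pfFiber d)))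
    {ξ : L2 (Vtx d)} (hξ : ξ ∈ S0 d) :
    Tendsto (fun n => pairing (boxVector d n (w n)) ξ) atTop (𝓝 (pairing (pfVector d) ξ)) := by
  simp only [pairing_boxVector, pairing_pfVector hξ]
  refine tendsto_sum_torusLift (F := fun n x => ⟪w n, fiber ξ x⟫_ℂ)
    (bound := fun x => (‖pfFiber d‖ + 1) * ‖fiber ξ x‖) ((summable_fiber_norm' hξ).mul_left _)
    (fun x => hw.inner tendsto_const_nhds) ?_
  have h := hw.norm.eventually (gt_mem_nhds (lt_add_one ‖pfFiber d‖))
  filter_upwards [h] with n hn x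
  exact (norm_inner_le_norm _ _).trans (by gcongr)

end RapidDecrease

/-! ### The finite volume two-point function -/

section Decomposition
variable {d : ℕ}

/-- A pointwise limit of sesquilinear forms is a sesquilinear form. -/
theorem exists_limit_form {E : Type} [AddCommGroup E] [Module ℂ E] (C : ℕ → E →ₗ⋆[ℂ] E →ₗ[ℂ] ℂ)
    (h : ∀ η ξ, ∃ L, Tendsto (fun n => C n η ξ) atTop (𝓝 L)) :
    ∃ C' : E →ₗ⋆[ℂ] E →ₗ[ℂ] ℂ, ∀ ξ η, Tendsto (fun n => C n η ξ) atTop (𝓝 (C' η ξ)) := by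
  choose c hc using h
  refine ⟨LinearMap.mk₂'ₛₗ (starRingEnd ℂ) (RingHom.id ℂ) c ?_ ?_ ?_ ?_, fun ξ η => hc η ξ⟩
  · intro η η' ξ
    refine tendsto_nhds_unique (hc _ _) (((hc η ξ).add (hc η' ξ)).congr fun n => ?_)
    rw [map_add, LinearMap.add_apply]
  · intro z η ξ
    refine tendsto_nhds_unique (hc _ _) (((hc η ξ).const_smul (conj z)).congr fun n => ?_)
    rw [LinearMap.map_smulₛₗ, LinearMap.smul_apply]
  · intro η ξ ξ'
    refine tendsto_nhds_unique (hc _ _) (((hc η ξ).add (hc η ξ')).congr fun n => ?_)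
    rw [map_add]
  · intro z η ξ
    refine tendsto_nhds_unique (hc _ _) (((hc η ξ).const_smul z).congr fun n => ?_)
    rw [map_smul]

/-- The form `⟪η, X ξ⟫ - k ⟪η, V⟫ ⟪V, ξ⟫`. -/
noncomputable def remainderForm (S : Submodule ℂ (L2 (Vtx d))) (X : L2 (Vtx d) →L[ℂ] L2 (Vtx d))
    (k : ℝ) (V : L2 (Vtx d)) : S →ₗ⋆[ℂ] S →ₗ[ℂ] ℂ :=
  LinearMap.mk₂'ₛₗ (starRingEnd ℂ) (RingHom.id ℂ)
    (fun η ξ => ⟪(η : L2 (Vtx d)), X ξ⟫_ℂ - k * conj ⟪V, η⟫_ℂ * ⟪V, ξ⟫_ℂ)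
    (fun η η' ξ => by simp only [Submodule.coe_add, inner_add_left, inner_add_right, map_add]; ring)
    (fun z η ξ => by
      simp only [Submodule.coe_smul, inner_smul_left, inner_smul_right, map_mul, smul_eq_mul]; ring)
    (fun η ξ ξ' => by simp only [Submodule.coe_add, inner_add_right, map_add]; ring)
    (fun z η ξ => by
      simp only [Submodule.coe_smul, inner_smul_right, map_smul, smul_eq_mul, RingHom.id_apply]
      ring)

theorem pairing_boxVector_eq_inner (n : ℕ) (w : L2 ℤ) (ξ : L2 (Vtx d)) :
    pairing (boxVector d n w) ξ = ⟪combVec (torusLift d n) (fun _ => 1) w, ξ⟫_ℂ := by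
  rw [pairing_boxVector, inner_combVec_left]
  simp

theorem hamiltonian_eq (hd : 0 < d) (μ : ℝ) (n : ℕ) :
    hamiltonian d μ n = ((combNorm d - μ : ℝ) : ℂ) • 1 - adjOp (combBox d n) := by
  rw [hamiltonian, norm_adjOp_combZ hd]

/-- The regular part of the finite volume Bose operator. -/
noncomputable def regularPart (d : ℕ) (β μ : ℝ) (n : ℕ) : L2 (Vtx d) →L[ℂ] L2 (Vtx d) :=
  boseRegOp ((β : ℂ) • (((combNorm d - μ : ℝ) : ℂ) • 1 - adjOp (combBox d n)))

theorem gibbsTwoPoint_eq (hd : 0 < d) {β : ℝ} (hβ : 0 < β) {μ : ℝ} (hμ : μ < 0) {n : ℕ}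
    (hn : 1 ≤ n) (ξ η : L2 (Vtx d)) :
    gibbsTwoPoint d β μ n ξ η = (β : ℂ)⁻¹ *
      ⟪η, resolvent (adjOp (combBox d n)) ((combNorm d - μ : ℝ) : ℂ) ξ⟫_ℂ +
      ⟪η, regularPart d β μ n ξ⟫_ℂ := by
  have hs : ‖adjOp (combBox d n)‖ < combNorm d - μ :=
    (norm_adjOp_combBox_le hn).trans_lt (by linarith)
  rw [gibbsTwoPoint, hamiltonian_eq hd, inverse_exp_hamiltonian _ (isSelfAdjoint_adjOp _) hβ hs,
    add_apply, inner_add_right, smul_apply, inner_smul_right]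
  rfl

theorem tendsto_regularPart (β : ℝ) {μ : ℕ → ℝ} (hμ : Tendsto μ atTop (𝓝 0))
    (ξ : L2 (Vtx d)) : ∃ f, Tendsto (fun n => regularPart d β (μ n) n ξ) atTop (𝓝 f) := by
  have hsa : ∀ (s : ℝ) (A : L2 (Vtx d) →L[ℂ] L2 (Vtx d)), IsSelfAdjoint A →
      IsSelfAdjoint ((β : ℂ) • ((s : ℂ) • 1 - A)) := by
    intro s A hA
    have h1 : IsSelfAdjoint (β : ℂ) := Complex.conj_ofReal β
    have h2 : IsSelfAdjoint (s : ℂ) := Complex.conj_ofReal s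
    exact h1.smul ((h2.smul (IsSelfAdjoint.one _)).sub hA)
  have hbound : ∀ (s : ℝ) (A : L2 (Vtx d) →L[ℂ] L2 (Vtx d)), |s| ≤ combNorm d + 1 →
      ‖A‖ ≤ combNorm d → ‖(β : ℂ) • ((s : ℂ) • (1 : L2 (Vtx d) →L[ℂ] L2 (Vtx d)) - A)‖ ≤
        |β| * (combNorm d + 1 + combNorm d) := by
    intro s A hs hA
    rw [norm_smul, Complex.norm_real, Real.norm_eq_abs]
    gcongr
    refine (norm_sub_le _ _).trans (add_le_add ?_ hA)
    rw [norm_smul, Complex.norm_real, Real.norm_eq_abs]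
    refine le_trans ?_ hs
    exact mul_le_of_le_one_right (abs_nonneg _) ContinuousLinearMap.norm_id_le
  have hlam : 0 ≤ combNorm d := by rw [combNorm]; positivity
  have hs0 : Tendsto (fun n => combNorm d - μ n) atTop (𝓝 (combNorm d)) := by
    simpa using hμ.const_sub (combNorm d)
  refine ⟨boseRegOp ((β : ℂ) • ((combNorm d : ℂ) • 1 - adjOp (combZ d))) ξ, ?_⟩
  refine tendsto_boseRegOp_apply (M := |β| * (combNorm d + 1 + combNorm d))
    (fun n => hsa _ _ (isSelfAdjoint_adjOp _)) (hsa _ _ (isSelfAdjoint_adjOp _)) ?_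
    (hbound _ _ (by rw [abs_of_nonneg hlam]; linarith)
      ((isCombOver_combZ d).norm_adjOp_le Function.injective_id (stdStep_injective d)
        stdStep_add_ne_zero fun _ _ h => h)) (fun f => ?_) ξ
  · have h1 : ∀ᶠ n in atTop, |combNorm d - μ n| < combNorm d + 1 :=
      hs0.abs.eventually (gt_mem_nhds (by rw [abs_of_nonneg hlam]; linarith))
    filter_upwards [h1, eventually_ge_atTop 1] with n h2 hn
    exact hbound _ _ h2.le (norm_adjOp_combBox_le hn)
  · simp only [smul_apply, sub_apply, one_apply_eq_self]
    have h2 : Tendsto (fun n => ((combNorm d - μ n : ℝ) : ℂ)) atTop (𝓝 (combNorm d : ℂ)) :=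
      (Complex.continuous_ofReal.tendsto _).comp hs0
    exact ((h2.smul_const f).sub (tendsto_combBox f)).const_smul (β : ℂ)

theorem tendsto_chainVec (hd : 0 < d) {μ : ℕ → ℝ} (hμ : Tendsto μ atTop (𝓝 0)) :
    Tendsto (fun n => chainVec n (combNorm d - μ n)) atTop
      (𝓝 (((2 * d : ℝ) : ℂ)⁻¹ • decayVec d hd)) := by
  have hs0 : Tendsto (fun n => combNorm d - μ n) atTop (𝓝 (combNorm d)) := by
    simpa using hμ.const_sub (combNorm d)
  have h2 := two_lt_combNorm hd
  rw [← resolvent_line hd]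
  refine tendsto_resolvent (c := 2)
    (Eventually.of_forall fun n => norm_adjOp_le_two_of_le_line (lineBox_le_line n))
    (norm_adjOp_le_two_of_le_line fun _ _ h => h)
    ((Complex.continuous_ofReal.tendsto _).comp hs0) ?_ tendsto_lineBox _
  rw [Complex.norm_real, Real.norm_of_nonneg (by linarith)]
  exact h2

theorem tendsto_fibre_resolvent (hd : 0 < d) {μ : ℕ → ℝ} (hμ : Tendsto μ atTop (𝓝 0))
    (ξ : L2 (Vtx d)) : Tendsto (fun n => resolvent (adjOp (fibreGraph (baseBox d n) (lineBox n)))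
      ((combNorm d - μ n : ℝ) : ℂ) ξ) atTop
      (𝓝 (resolvent (adjOp (fibreGraph Set.univ line)) (combNorm d : ℂ) ξ)) := by
  have hs0 : Tendsto (fun n => combNorm d - μ n) atTop (𝓝 (combNorm d)) := by
    simpa using hμ.const_sub (combNorm d)
  have h2 := two_lt_combNorm hd
  refine tendsto_resolvent (c := 2)
    (Eventually.of_forall fun n => norm_adjOp_fibreGraph_le _ (lineBox_le_line n))
    (norm_adjOp_fibreGraph_le _ fun _ _ h => h)
    ((Complex.continuous_ofReal.tendsto _).comp hs0) ?_ tendsto_fibreGraph _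
  rw [Complex.norm_real, Real.norm_of_nonneg (by linarith)]
  exact h2

/-- The condensate part of the two-point function is isolated by replacing the Green function of
the base torus by its value at the pole. -/
theorem gibbsTwoPoint_sub (hd : 0 < d) {β : ℝ} (hβ : 0 < β) {μ : ℝ} (hμ : μ < 0) {n : ℕ}
    (hn : 1 ≤ n) {g : ℝ} (hg : 0 < g) (hg' : chainVec n (combNorm d - μ) 0 = (g : ℂ))
    {K : (Fin d → ZMod (2 * n + 1)) → ℝ}
    (hK : IsGreen (torusStep d (2 * n + 1)) (g⁻¹ - 2 * d) K) {r w : L2 ℤ}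
    (hr : chainVec n (combNorm d - μ) = r) (hw : w = (‖r‖ : ℂ)⁻¹ • r) (ξ η : L2 (Vtx d)) :
    gibbsTwoPoint d β μ n ξ η - ((K 0 * ‖r‖ ^ 2 / (β * g ^ 2) : ℝ) : ℂ) *
        conj (pairing (boxVector d n w) η) * pairing (boxVector d n w) ξ =
      ⟪η, regularPart d β μ n ξ⟫_ℂ + (β : ℂ)⁻¹ *
        (⟪η, resolvent (adjOp (fibreGraph (baseBox d n) (lineBox n)))
            ((combNorm d - μ : ℝ) : ℂ) ξ⟫_ℂ -
          (g : ℂ)⁻¹ ^ 2 * ∑ t, ∑ u, conj ⟪r, fiber η (torusLift d n t)⟫_ℂ *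
            ((K 0 - K (torusProj d (2 * n + 1) (torusLift d n t - torusLift d n u)) : ℝ) : ℂ) *
            ⟪r, fiber ξ (torusLift d n u)⟫_ℂ -
          (g : ℂ)⁻¹ * ∑ t, conj ⟪r, fiber η (torusLift d n t)⟫_ℂ *
            ⟪r, fiber ξ (torusLift d n t)⟫_ℂ) := by
  have hr0 : (‖r‖ : ℂ) ≠ 0 := by
    rw [Complex.ofReal_ne_zero, norm_ne_zero_iff, ← hr]
    exact chainVec_ne_zero ((two_lt_combNorm hd).trans (by linarith))
  have hg0 : (g : ℂ) ≠ 0 := Complex.ofReal_ne_zero.2 hg.ne'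
  have hβ0 : (β : ℂ) ≠ 0 := Complex.ofReal_ne_zero.2 hβ.ne'
  rw [gibbsTwoPoint_eq hd hβ hμ hn, inner_resolvent_combBox hd hn (by linarith) hg hg' hK, hr,
    pairing_boxVector, pairing_boxVector, hw]
  simp only [inner_smul_left, torusProj_sub, torusProj_torusLift, ← Finset.mul_sum, map_inv₀,
    Complex.conj_ofReal, map_mul]
  set P := fun t => ⟪r, fiber ξ (torusLift d n t)⟫_ℂ
  set Q := fun t => ⟪r, fiber η (torusLift d n t)⟫_ℂ
  have e1 : ∑ t, conj (Q t) * ((g : ℂ)⁻¹ * ((g : ℂ)⁻¹ * ∑ u, (K (t - u) : ℂ) * P u - P t)) =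
      (g : ℂ)⁻¹ ^ 2 * ∑ t, ∑ u, conj (Q t) * (K (t - u) : ℂ) * P u -
        (g : ℂ)⁻¹ * ∑ t, conj (Q t) * P t := by
    rw [Finset.mul_sum, Finset.mul_sum, ← Finset.sum_sub_distrib]
    refine Finset.sum_congr rfl fun t _ => ?_
    simp only [mul_assoc, ← Finset.mul_sum]
    ring
  have e2 : ∑ t, ∑ u, conj (Q t) * ((K 0 - K (t - u) : ℝ) : ℂ) * P u =
      (K 0 : ℂ) * (conj (∑ t, Q t) * ∑ u, P u) -
        ∑ t, ∑ u, conj (Q t) * (K (t - u) : ℂ) * P u := by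
    rw [map_sum, Finset.sum_mul_sum, Finset.mul_sum, ← Finset.sum_sub_distrib]
    refine Finset.sum_congr rfl fun t _ => ?_
    rw [Finset.mul_sum, ← Finset.sum_sub_distrib]
    refine Finset.sum_congr rfl fun u _ => ?_
    push_cast
    ring
  rw [e1, e2]
  push_cast
  field_simp
  ring

end Decomposition

/-! ### The condensate and the limiting form -/

section Limit
variable {d : ℕ}

/-- The remainder of the two-point function has a limit: the differences `K 0 - K x` of the torus
Green functions converge and grow at most linearly in `x`, which rapidly decreasing fibre norms
absorb. -/
theorem exists_tendsto_gibbsTwoPoint_sub (hd : 0 < d) {β : ℝ} (hβ : 0 < β) {μ : ℕ → ℝ}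
    (hμ_neg : ∀ n, μ n < 0) (hμ : Tendsto μ atTop (𝓝 0)) {g : ℕ → ℝ} (hg : ∀ n, 0 < g n)
    (hg' : ∀ n, chainVec n (combNorm d - μ n) 0 = (g n : ℂ))
    (hgl : Tendsto g atTop (𝓝 (2 * d : ℝ)⁻¹)) {K : ∀ n : ℕ, (Fin d → ZMod (2 * n + 1)) → ℝ}
    (hρ : ∀ᶠ n in atTop, 0 < (g n)⁻¹ - 2 * d)
    (hK : ∀ᶠ n in atTop, IsGreen (torusStep d (2 * n + 1)) ((g n)⁻¹ - 2 * d) (K n))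
    {w : ℕ → L2 ℤ} (hw : ∀ n, w n = (‖chainVec n (combNorm d - μ n)‖ : ℂ)⁻¹ •
      chainVec n (combNorm d - μ n)) {ξ η : L2 (Vtx d)} (hξ : ξ ∈ S0 d) (hη : η ∈ S0 d) :
    ∃ L, Tendsto (fun n => gibbsTwoPoint d β (μ n) n ξ η -
      ((K n 0 * ‖chainVec n (combNorm d - μ n)‖ ^ 2 / (β * g n ^ 2) : ℝ) : ℂ) *
        conj (pairing (boxVector d n (w n)) η) * pairing (boxVector d n (w n)) ξ)
      atTop (𝓝 L) := by
  have hdR : (0 : ℝ) < 2 * d := by positivity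
  have hρ0 : Tendsto (fun n => (g n)⁻¹ - 2 * d) atTop (𝓝 0) := by
    have := (hgl.inv₀ (inv_pos.2 hdR).ne').sub_const (2 * d : ℝ)
    rwa [inv_inv, sub_self] at this
  have hN : Tendsto (fun n : ℕ => 2 * n + 1) atTop atTop :=
    tendsto_atTop_mono (fun n => (by omega : n ≤ 2 * n + 1)) tendsto_id
  obtain ⟨a, ha⟩ := exists_tendsto_torus_potential hd hN hρ hρ0 hK
  obtain ⟨f, hf⟩ := tendsto_regularPart β hμ ξ
  have hr := tendsto_chainVec hd hμ
  set r : ℕ → L2 ℤ := fun n => chainVec n (combNorm d - μ n) with hr_def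
  set r' : L2 ℤ := ((2 * d : ℝ) : ℂ)⁻¹ • decayVec d hd
  have hginv : Tendsto (fun n => (g n : ℂ)⁻¹) atTop (𝓝 (((2 * d : ℝ)⁻¹ : ℝ) : ℂ)⁻¹) :=
    ((Complex.continuous_ofReal.tendsto _).comp hgl).inv₀
      (Complex.ofReal_ne_zero.2 (inv_pos.2 hdR).ne')
  have hB : ∀ᶠ n in atTop, ‖r n‖ ≤ ‖r'‖ + 1 :=
    (hr.norm.eventually (gt_mem_nhds (lt_add_one _))).mono fun n h => h.le
  have hQ : ∀ (ζ : L2 (Vtx d)) x, Tendsto (fun n => ⟪r n, fiber ζ x⟫_ℂ) atTop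
      (𝓝 ⟪r', fiber ζ x⟫_ℂ) := fun ζ x => hr.inner tendsto_const_nhds
  have hQn : ∀ᶠ n in atTop, ∀ (ζ : L2 (Vtx d)) x, ‖⟪r n, fiber ζ x⟫_ℂ‖ ≤
      (‖r'‖ + 1) * ‖fiber ζ x‖ := by
    filter_upwards [hB] with n hn ζ x
    exact (norm_inner_le_norm _ _).trans (by gcongr)
  have hdouble := tendsto_sum_sum_torusLift (d := d)
    (F := fun n x y => conj ⟪r n, fiber η x⟫_ℂ *
      ((K n 0 - K n (torusProj d (2 * n + 1) (x - y)) : ℝ) : ℂ) * ⟪r n, fiber ξ y⟫_ℂ)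
    (F' := fun x y => conj ⟪r', fiber η x⟫_ℂ * ((a (x - y) : ℝ) : ℂ) * ⟪r', fiber ξ y⟫_ℂ)
    (bound := fun p => (‖r'‖ + 1) ^ 2 * (((1 + ∑ i, |(p.1 i : ℝ)|) * ‖fiber η p.1‖) *
      ((1 + ∑ i, |(p.2 i : ℝ)|) * ‖fiber ξ p.2‖)))
    (((summable_fiber_norm hη).mul_of_nonneg (summable_fiber_norm hξ)
      (fun x => by positivity) (fun x => by positivity)).mul_left _)
    (fun x y => (((Complex.continuous_conj.tendsto _).comp (hQ η x)).mul
      ((Complex.continuous_ofReal.tendsto _).comp (ha (x - y)))).mul (hQ ξ y)) (by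
      filter_upwards [hQn, hρ, hK] with n h1 h2 h3 x y
      have h4 := h3.abs_zero_sub_le h2 (x - y)
      have h5 : ∑ i, |((x - y) i : ℝ)| ≤ (1 + ∑ i, |(x i : ℝ)|) * (1 + ∑ i, |(y i : ℝ)|) := by
        have h6 : ∑ i, |((x - y) i : ℝ)| ≤ ∑ i, |(x i : ℝ)| + ∑ i, |(y i : ℝ)| := by
          rw [← Finset.sum_add_distrib]
          refine Finset.sum_le_sum fun i _ => ?_
          rw [Pi.sub_apply, Int.cast_sub]
          exact abs_sub _ _
        have h7 : 0 ≤ ∑ i, |(x i : ℝ)| := Finset.sum_nonneg fun i _ => abs_nonneg _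
        have h8 : 0 ≤ ∑ i, |(y i : ℝ)| := Finset.sum_nonneg fun i _ => abs_nonneg _
        nlinarith [mul_nonneg h7 h8]
      rw [norm_mul, norm_mul, RCLike.norm_conj, Complex.norm_real, Real.norm_eq_abs]
      calc _ ≤ ((‖r'‖ + 1) * ‖fiber η x‖) *
            ((1 + ∑ i, |(x i : ℝ)|) * (1 + ∑ i, |(y i : ℝ)|)) *
            ((‖r'‖ + 1) * ‖fiber ξ y‖) := by
            gcongr
            · exact h1 η x
            · exact h4.trans h5
            · exact h1 ξ y
        _ = _ := by ring)
  have hsingle := tendsto_sum_torusLift (d := d)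
    (F := fun n x => conj ⟪r n, fiber η x⟫_ℂ * ⟪r n, fiber ξ x⟫_ℂ)
    (bound := fun x => (‖r'‖ + 1) ^ 2 * (∑' y, ‖fiber ξ y‖) * ‖fiber η x‖)
    ((summable_fiber_norm' hη).mul_left _)
    (fun x => ((Complex.continuous_conj.tendsto _).comp (hQ η x)).mul (hQ ξ x)) (by
      filter_upwards [hQn] with n h1 x
      rw [norm_mul, RCLike.norm_conj]
      calc _ ≤ ((‖r'‖ + 1) * ‖fiber η x‖) * ((‖r'‖ + 1) * ∑' y, ‖fiber ξ y‖) := by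
            gcongr
            · exact h1 η x
            · exact (h1 ξ x).trans (by
                gcongr
                exact (summable_fiber_norm' hξ).le_tsum x fun _ _ => norm_nonneg _)
        _ = _ := by ring)
  have hreg : Tendsto (fun n => ⟪η, regularPart d β (μ n) n ξ⟫_ℂ) atTop (𝓝 ⟪η, f⟫_ℂ) :=
    tendsto_const_nhds.inner hf
  have hfib := (tendsto_const_nhds (x := η)).inner (𝕜 := ℂ) (tendsto_fibre_resolvent hd hμ ξ)
  refine ⟨_, Tendsto.congr' ?_ (hreg.add (((hfib.sub ((hginv.pow 2).mul hdouble)).sub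
    (hginv.mul hsingle)).const_mul (β : ℂ)⁻¹))⟩
  filter_upwards [hK, eventually_ge_atTop 1] with n h1 hn
  exact (gibbsTwoPoint_sub hd hβ (hμ_neg n) hn (hg n) (hg' n) h1 rfl (hw n) ξ η).symm

/-- The two-point function is a diverging multiple of a rank one form plus a convergent form. -/
theorem exists_condensate_decomposition (hd : d = 1 ∨ d = 2) {β : ℝ} (hβ : 0 < β) {μ : ℕ → ℝ}
    (hμ_neg : ∀ n, μ n < 0) (hμ : Tendsto μ atTop (𝓝 0)) :
    ∃ (k' : ℕ → ℝ) (w : ℕ → L2 ℤ) (C : ℕ → S0 d →ₗ⋆[ℂ] S0 d →ₗ[ℂ] ℂ)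
        (C_lim : S0 d →ₗ⋆[ℂ] S0 d →ₗ[ℂ] ℂ),
      Tendsto k' atTop atTop ∧
      (∀ (n : ℕ) (j : ℤ), (n : ℤ) < |j| → w n j = 0) ∧
      Tendsto w atTop (𝓝 (pfFiber d)) ∧
      (∀ n, ∀ ξ η : S0 d, gibbsTwoPoint d β (μ n) n ξ η =
        k' n * conj (pairing (boxVector d n (w n)) (η : L2 (Vtx d))) *
          pairing (boxVector d n (w n)) (ξ : L2 (Vtx d)) + C n η ξ) ∧
      (∀ ξ η : S0 d, Tendsto (fun n => C n η ξ) atTop (𝓝 (C_lim η ξ))) := by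
  have hd0 : 0 < d := by omega
  have hdR : (0 : ℝ) < 2 * d := by positivity
  have hs : ∀ n, 2 < combNorm d - μ n := fun n =>
    (two_lt_combNorm hd0).trans (by linarith [hμ_neg n])
  choose g hg hg' using fun n => exists_chainVec_zero (n := n) (hs n)
  have hr := tendsto_chainVec hd0 hμ
  have hgl : Tendsto g atTop (𝓝 (2 * d : ℝ)⁻¹) := by
    have h1 := (((lp.evalCLM ℂ (fun _ : ℤ => ℂ) 2 0).continuous.tendsto _).comp hr)
    have h2 := (Complex.continuous_re.tendsto _).comp h1
    have e : (((2 * d : ℝ) : ℂ)⁻¹ • decayVec d hd0) 0 = (((2 * d : ℝ)⁻¹ : ℝ) : ℂ) := by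
      rw [lp.coeFn_smul, Pi.smul_apply, decayVec_apply, decay_zero]
      simp
    have h3 : ∀ f : L2 ℤ, lp.evalCLM ℂ (fun _ : ℤ => ℂ) 2 0 f = f 0 := fun f => rfl
    rw [h3, e, Complex.ofReal_re] at h2
    refine h2.congr fun n => ?_
    rw [Function.comp_apply, Function.comp_apply, h3, hg', Complex.ofReal_re]
  have hρ : ∀ n, 1 ≤ n → 0 < (g n)⁻¹ - 2 * d := fun n hn => by
    have h1 := chainVec_zero_lt hd0 hn (by linarith [hμ_neg n]) (hg n) (hg' n)
    rw [sub_pos, lt_inv_comm₀ hdR (hg n), ← one_div, lt_div_iff₀ hdR]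
    linarith
  -- the reduction to the torus needs `n ≥ 1`: for `n = 0` all steps of the torus are loops, whereas
  -- the comb is a single vertex without edges
  have hKex : ∀ n : ℕ, ∃ K, 1 ≤ n → IsGreen (torusStep d (2 * n + 1)) ((g n)⁻¹ - 2 * d) K := by
    intro n
    by_cases hn : 1 ≤ n
    · exact (exists_isGreen _ (hρ n hn)).imp fun K hK _ => hK
    · exact ⟨0, fun h => absurd h hn⟩
  choose K hK using hKex
  have hρ' : ∀ᶠ n in atTop, 0 < (g n)⁻¹ - 2 * d := (eventually_ge_atTop 1).mono hρ
  have hK' : ∀ᶠ n in atTop, IsGreen (torusStep d (2 * n + 1)) ((g n)⁻¹ - 2 * d) (K n) :=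
    (eventually_ge_atTop 1).mono hK
  have hρ0 : Tendsto (fun n => (g n)⁻¹ - 2 * d) atTop (𝓝 0) := by
    have := (hgl.inv₀ (inv_pos.2 hdR).ne').sub_const (2 * d : ℝ)
    rwa [inv_inv, sub_self] at this
  have hk0 : Tendsto (fun n => K n 0) atTop atTop := tendsto_green_zero hd hρ' hρ0 hK'
  set r : ℕ → L2 ℤ := fun n => chainVec n (combNorm d - μ n) with hr_def
  set k' : ℕ → ℝ := fun n => K n 0 * ‖r n‖ ^ 2 / (β * g n ^ 2) with hk'
  set w : ℕ → L2 ℤ := fun n => (‖r n‖ : ℂ)⁻¹ • r n with hw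
  have hr'0 : ((2 * d : ℝ) : ℂ)⁻¹ • decayVec d hd0 ≠ 0 :=
    smul_ne_zero (inv_ne_zero (Complex.ofReal_ne_zero.2 hdR.ne'))
      (norm_pos_iff.1 (norm_decayVec_pos hd0))
  have hwl : Tendsto w atTop (𝓝 (pfFiber d)) := by
    have h1 := (((Complex.continuous_ofReal.tendsto _).comp hr.norm).inv₀
      (Complex.ofReal_ne_zero.2 (norm_ne_zero_iff.2 hr'0))).smul hr
    refine h1.trans_eq ?_
    congr 1
    rw [pfFiber_eq hd0, norm_smul, smul_smul, norm_inv, Complex.norm_real,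
      Real.norm_of_nonneg hdR.le]
    congr 1
    have : (‖decayVec d hd0‖ : ℂ) ≠ 0 := Complex.ofReal_ne_zero.2 (norm_decayVec_pos hd0).ne'
    have h2 : ((2 * d : ℝ) : ℂ) ≠ 0 := Complex.ofReal_ne_zero.2 hdR.ne'
    rw [Complex.ofReal_mul, Complex.ofReal_inv]
    field_simp
  have hkl : Tendsto k' atTop atTop := by
    have h1 : Tendsto (fun n => ‖r n‖ ^ 2 / (β * g n ^ 2)) atTop
        (𝓝 (‖((2 * d : ℝ) : ℂ)⁻¹ • decayVec d hd0‖ ^ 2 / (β * ((2 * d : ℝ)⁻¹) ^ 2))) :=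
      (hr.norm.pow 2).div ((hgl.pow 2).const_mul β) (by positivity)
    have h2 := hk0.atTop_mul_pos (div_pos (pow_pos (norm_pos_iff.2 hr'0) 2) (by positivity)) h1
    exact h2.congr fun n => (mul_div_assoc _ _ _).symm
  -- the remainder is defined for every `n`, including those where the Green function plays no role
  set C : ℕ → S0 d →ₗ⋆[ℂ] S0 d →ₗ[ℂ] ℂ := fun n => remainderForm (S0 d)
    (Ring.inverse (NormedSpace.exp ((β : ℂ) • hamiltonian d (μ n) n) - 1)) (k' n)
    (combVec (torusLift d n) (fun _ => 1) (w n)) with hC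
  have hCeq : ∀ n (ξ η : S0 d), C n η ξ = gibbsTwoPoint d β (μ n) n ξ η -
      k' n * conj (pairing (boxVector d n (w n)) (η : L2 (Vtx d))) *
        pairing (boxVector d n (w n)) (ξ : L2 (Vtx d)) := fun n ξ η => by
    rw [pairing_boxVector_eq_inner, pairing_boxVector_eq_inner]
    rfl
  obtain ⟨C_lim, hC_lim⟩ := exists_limit_form C fun η ξ => by
    simp only [hCeq]
    exact exists_tendsto_gibbsTwoPoint_sub hd0 hβ hμ_neg hμ hg hg' hgl hρ' hK'
      (fun n => rfl) ξ.2 η.2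
  refine ⟨k', w, C, C_lim, hkl, fun n j hj => ?_, hwl, fun n ξ η => ?_, hC_lim⟩
  · rw [hw]
    simp only [lp.coeFn_smul, Pi.smul_apply, hr_def, chainVec_eq_zero (hs n) hj, smul_zero]
  · rw [hCeq, add_sub_cancel]

end Limit

/-! ### Continuity of Fock normal states -/

section FockNormal
variable {E : Type} [NormedAddCommGroup E] [InnerProductSpace ℂ E]

theorem norm_weyl_le (h : E) : ‖weyl h‖ ≤ 1 := by
  refine ContinuousLinearMap.opNorm_le_bound _ zero_le_one fun x => ?_
  rw [one_mul]
  induction x using UniformSpace.Completion.induction_on with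
  | hp => exact isClosed_le (weyl h).continuous.norm continuous_norm
  | ih x =>
    have : weyl h (x : Fock E) = ((preWeyl h x : PreFock E) : Fock E) := by simp [weyl]
    rw [this, UniformSpace.Completion.norm_coe, UniformSpace.Completion.norm_coe]
    exact ((preWeyl h).isometryOfInner (inner_preWeyl h)).norm_map x |>.le

theorem dense_span_coherent :
    Dense (Submodule.span ℂ (Set.range (coherent (E := E))) : Set (Fock E)) := by
  refine UniformSpace.Completion.denseRange_coe.mono ?_
  rintro _ ⟨x, rfl⟩
  have hx : x = ∑ f ∈ (preFockCoeff E x).support, preFockCoeff E x f • preCoherent f := by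
    apply (preFockCoeff E).injective
    rw [map_sum]
    simp only [map_smul, preCoherent, LinearEquiv.apply_symm_apply, Finsupp.smul_single,
      smul_eq_mul, mul_one]
    exact (Finsupp.sum_single _).symm
  have h : ((x : PreFock E) : Fock E) =
      ∑ f ∈ (preFockCoeff E x).support, preFockCoeff E x f • coherent f := by
    conv_lhs => rw [hx]
    have h1 := map_sum (UniformSpace.Completion.toComplₗᵢ (𝕜 := ℂ) (E := PreFock E))
      (fun f => preFockCoeff E x f • preCoherent f) (preFockCoeff E x).support
    simp only [map_smul] at h1
    exact h1
  rw [h]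
  exact Submodule.sum_mem _ fun f _ => Submodule.smul_mem _ _ (Submodule.subset_span ⟨f, rfl⟩)

/-- Regularity of the Fock representation. -/
theorem tendsto_weyl_apply {ι : Type} {l : Filter ι} {h : ι → E} (hh : Tendsto h l (𝓝 0))
    (x : Fock E) : Tendsto (fun i => weyl (h i) x) l (𝓝 x) := by
  refine tendsto_apply_of_total (T := fun i => weyl (h i)) (T' := ContinuousLinearMap.id ℂ _)
    (Eventually.of_forall fun i => norm_weyl_le (h i)) _ dense_span_coherent ?_ x
  rintro _ ⟨g, rfl⟩
  have hnorm : ∀ f : E, ‖coherent f‖ = 1 := fun f => by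
    have h2 : vacuumKernel f f = 1 := by
      rw [vacuumKernel, inner_self_eq_norm_sq_to_K, ← Complex.exp_zero]
      congr 1
      simp
      ring
    have h3 : ‖coherent f‖ ^ 2 = 1 := by
      rw [@norm_sq_eq_re_inner ℂ, inner_coherent, h2, RCLike.one_re]
    exact (pow_eq_one_iff_of_nonneg (norm_nonneg _) two_ne_zero).1 h3
  -- the vectors have norm one, so that convergence of the overlap with the limit suffices
  have hinner : Tendsto (fun i => ⟪coherent g, weyl (h i) (coherent g)⟫_ℂ) l (𝓝 1) := by
    have hc : Continuous fun f : E => weylPhase f g * vacuumKernel g (f + g) := by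
      simp only [weylPhase, vacuumKernel]
      fun_prop
    have h1 := (hc.tendsto 0).comp hh
    have h2 : weylPhase (0 : E) g * vacuumKernel g (0 + g) = 1 := by
      rw [zero_add, ← inner_coherent, inner_self_eq_norm_sq_to_K, hnorm]
      simp [weylPhase]
    rw [h2] at h1
    refine h1.congr fun i => ?_
    rw [weyl_coherent, inner_smul_right, inner_coherent, Function.comp_apply]
  rw [tendsto_iff_norm_sub_tendsto_zero]
  have h3 : Tendsto (fun i => √(2 - 2 * (⟪coherent g, weyl (h i) (coherent g)⟫_ℂ).re)) l (𝓝 0) := by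
    have := (((Complex.continuous_re.tendsto _).comp hinner).const_mul 2).const_sub 2
    simpa using this.sqrt
  refine h3.congr fun i => ?_
  rw [ContinuousLinearMap.id_apply, ← Real.sqrt_sq (norm_nonneg (_ - _)), norm_sub_rev,
    norm_sub_sq (𝕜 := ℂ), weyl_coherent, norm_smul, hnorm, hnorm]
  congr 1
  have h4 : ‖weylPhase (h i) g‖ = 1 := by
    rw [weylPhase, Complex.norm_exp]
    simp
  rw [h4, RCLike.re_eq_complex_re]
  ring

/-- Along any sequence of test functions tending to `0`, a Fock normal state tends to `1` on the
Weyl operators. -/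
theorem tendsto_of_isFockNormalOn {φ : CCR E →ₚ[ℂ] ℂ} (hφ : φ 1 = 1) {M : Submodule ℂ E}
    (h : IsFockNormalOn φ M) {f : ℕ → E} (hfM : ∀ n, f n ∈ M) (hf : Tendsto f atTop (𝓝 0)) :
    Tendsto (fun n => φ (ccrWeyl (f n))) atTop (𝓝 1) := by
  -- the cyclic vector makes `φ` a normal state of its own GNS representation
  set Ω : φ.GNS := ((φ.toPreGNS 1 : φ.PreGNS) : φ.GNS)
  have hΩ : ∀ a : CCR E, ⟪Ω, φ.gnsStarAlgHom a Ω⟫_ℂ = φ a := by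
    intro a
    have h1 : φ.gnsStarAlgHom a Ω = ((φ.leftMulMapPreGNS a (φ.toPreGNS 1) : φ.PreGNS) : φ.GNS) :=
      φ.gnsNonUnitalStarAlgHom_apply_coe
    rw [h1, UniformSpace.Completion.inner_coe, PositiveLinearMap.preGNS_inner_def]
    simp
  have hmem : (fun a : localCCR M => φ a) ∈
      normalStates (φ.gnsStarAlgHom.comp (localCCR M).subtype) ⊤ := by
    refine ⟨Pi.single 0 Ω, fun _ => Submodule.mem_top, ?_, fun a => ?_⟩
    · have h1 : ‖Ω‖ ^ 2 = 1 := by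
        have h3 := hΩ 1
        rw [map_one, one_apply_eq_self, hφ] at h3
        rw [@norm_sq_eq_re_inner ℂ, h3, RCLike.one_re]
      have h2 := hasSum_single (f := fun n : ℕ => ‖(Pi.single 0 Ω : ℕ → φ.GNS) n‖ ^ 2) 0
        fun n hn => by simp [hn]
      simpa [h1] using h2
    · have h2 := hasSum_single (f := fun n : ℕ => ⟪(Pi.single 0 Ω : ℕ → φ.GNS) n,
        φ.gnsStarAlgHom (a : CCR E) ((Pi.single 0 Ω : ℕ → φ.GNS) n)⟫_ℂ) 0 fun n hn => by simp [hn]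
      rw [Pi.single_eq_same, hΩ] at h2
      exact h2
  rw [h] at hmem
  obtain ⟨ξ, -, hξ, hψ⟩ := hmem
  have hW : ∀ n, ccrWeyl (f n) ∈ localCCR M := fun n =>
    StarSubalgebra.le_topologicalClosure _ (StarAlgebra.subset_adjoin ℂ _ ⟨f n, hfM n, rfl⟩)
  have hsum : ∀ n, φ (ccrWeyl (f n)) = ∑' k, ⟪ξ k, weyl (f n) (ξ k)⟫_ℂ := fun n =>
    (hψ ⟨_, hW n⟩).tsum_eq.symm
  have h1 : (1 : ℂ) = ∑' k, ⟪ξ k, ξ k⟫_ℂ := by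
    simp only [inner_self_eq_norm_sq_to_K]
    have := (Complex.hasSum_ofReal.2 hξ).tsum_eq
    push_cast at this
    exact this.symm
  simp only [hsum]
  rw [h1]
  refine tendsto_tsum_of_dominated_convergence hξ.summable
    (fun k => tendsto_const_nhds.inner (tendsto_weyl_apply hf (ξ k)))
    (Eventually.of_forall fun n k => ?_)
  calc ‖⟪ξ k, weyl (f n) (ξ k)⟫_ℂ‖ ≤ ‖ξ k‖ * ‖weyl (f n) (ξ k)‖ := norm_inner_le_norm _ _
    _ ≤ ‖ξ k‖ * (1 * ‖ξ k‖) := by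
        gcongr
        exact ContinuousLinearMap.le_of_opNorm_le _ (norm_weyl_le _) _
    _ = ‖ξ k‖ ^ 2 := by ring

end FockNormal

/-! ### Absence of locally normal limit states -/

section LocallyNormal
variable {d : ℕ}

theorem single_mem_S0 (p : Vtx d) (z : ℂ) : (lp.single 2 p z : L2 (Vtx d)) ∈ S0 d := by
  classical
  intro N
  refine ⟨(1 + ‖p.1‖) ^ N * ‖fiber (lp.single 2 p z) p.1‖, fun j => ?_⟩
  rcases eq_or_ne j p.1 with rfl | hj
  · exact le_rfl
  · have : fiber (lp.single 2 p z) j = 0 := by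
      ext k
      have hne : (j, k) ≠ p := fun h => hj (congrArg Prod.fst h)
      exact lp.single_apply_ne (E := fun _ : Vtx d => ℂ) 2 p z hne
    rw [this, norm_zero, mul_zero]
    positivity

theorem pairing_single {V : Type} [DecidableEq V] (v : V → ℂ) (x : V) (z : ℂ) :
    pairing v (lp.single 2 x z) = conj (v x) * z := by
  rw [pairing, tsum_eq_single x fun y hy => ?_]
  · exact congrArg _ (lp.single_apply_self (E := fun _ : V => ℂ) 2 x z)
  · exact (congrArg _ (lp.single_apply_ne (E := fun _ : V => ℂ) 2 x z hy)).trans (mul_zero _)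

theorem tendsto_gibbsWeyl_zero (hd : d = 1 ∨ d = 2) {β : ℝ} (hβ : 0 < β) {μ : ℕ → ℝ}
    (hμ_neg : ∀ n, μ n < 0) (hμ : Tendsto μ atTop (𝓝 0)) (f : S0 d)
    (hf : pairing (pfVector d) (f : L2 (Vtx d)) ≠ 0) :
    Tendsto (fun n => gibbsWeyl d β (μ n) n f) atTop (𝓝 0) := by
  obtain ⟨k', w, C, C_lim, hk, -, hw, hG, hC⟩ := exists_condensate_decomposition hd hβ hμ_neg hμ
  have h1 := tendsto_pairing_boxVector hw f.2
  have h2 : Tendsto (fun n => k' n * ‖pairing (boxVector d n (w n)) (f : L2 (Vtx d))‖ ^ 2 +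
      (C n f f).re) atTop atTop :=
    (hk.atTop_mul_pos (pow_pos (norm_pos_iff.2 hf) 2) (h1.norm.pow 2)).atTop_add
      ((Complex.continuous_re.tendsto _).comp (hC f f))
  have h3 : ∀ n, (gibbsTwoPoint d β (μ n) n f f).re =
      k' n * ‖pairing (boxVector d n (w n)) (f : L2 (Vtx d))‖ ^ 2 + (C n f f).re := by
    intro n
    rw [hG n f f, Complex.add_re, mul_assoc, mul_comm (conj _), Complex.mul_conj,
      Complex.normSq_eq_norm_sq, ← Complex.ofReal_mul, Complex.ofReal_re]
  rw [tendsto_zero_iff_norm_tendsto_zero]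
  have h4 : Tendsto (fun n => Real.exp (-(‖(f : L2 (Vtx d))‖ ^ 2 / 4) -
      (gibbsTwoPoint d β (μ n) n f f).re / 2)) atTop (𝓝 0) := by
    refine Real.tendsto_exp_atBot.comp ?_
    simp only [h3, sub_eq_add_neg]
    exact tendsto_atBot_add_const_left _ _ (tendsto_neg_atTop_atBot.comp
      (h2.atTop_div_const two_pos))
  refine h4.congr fun n => ?_
  rw [gibbsWeyl, Complex.norm_exp]
  rw [Complex.sub_re, Complex.neg_re, Complex.ofReal_re, Complex.div_ofNat_re]

/-- A locally normal state would be continuous along `t ↦ W(t δ)`, but every limit of the Gibbs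
states vanishes on `W(t δ)` for `t ≠ 0`. -/
theorem not_isLocallyNormal (hd : d = 1 ∨ d = 2) {β : ℝ} (hβ : 0 < β) {μ : ℕ → ℝ}
    (hμ_neg : ∀ n, μ n < 0) (hμ : Tendsto μ atTop (𝓝 0)) (φ : CCR (S0 d) →ₚ[ℂ] ℂ)
    (hφ1 : φ 1 = 1) (hφ : ∀ f : S0 d, {x | (f : L2 (Vtx d)) x ≠ 0}.Finite →
      Tendsto (fun n => gibbsWeyl d β (μ n) n f) atTop (𝓝 (φ (ccrWeyl f)))) :
    ¬ IsLocallyNormal φ := by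
  intro hloc
  have hpos := (isGeneralizedPerronFrobenius_pfVector (by omega : 0 < d)).1 0
  set t : ℕ → ℝ := fun m => 1 / ((m : ℝ) + 1)
  have ht : ∀ m, 0 < t m := fun m => Nat.one_div_pos_of_nat
  set f : ℕ → S0 d := fun m => ⟨lp.single 2 0 (t m : ℂ), single_mem_S0 0 _⟩
  have hfx : ∀ m x, x ∉ ({0} : Finset (Vtx d)) → (f m : L2 (Vtx d)) x = 0 := fun m x hx =>
    lp.single_apply_ne 2 0 _ (by simpa using hx)
  have hzero : ∀ m, φ (ccrWeyl (f m)) = 0 := fun m => by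
    refine tendsto_nhds_unique (hφ (f m) ?_) (tendsto_gibbsWeyl_zero hd hβ hμ_neg hμ (f m) ?_)
    · refine (Finset.finite_toSet {0}).subset fun x hx => ?_
      by_contra h
      exact hx (hfx m x h)
    · rw [pairing_single]
      exact mul_ne_zero ((map_ne_zero _).2 hpos.ne') (Complex.ofReal_ne_zero.2 (ht m).ne')
  have hf0 : Tendsto f atTop (𝓝 0) := by
    rw [tendsto_zero_iff_norm_tendsto_zero]
    refine (tendsto_one_div_add_atTop_nhds_zero_nat (𝕜 := ℝ)).congr fun m => ?_
    rw [Submodule.coe_norm, lp.norm_single (by norm_num), Complex.norm_real,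
      Real.norm_of_nonneg (ht m).le]
  have h := tendsto_of_isFockNormalOn hφ1 (hloc {0}) (f := f) (fun m => hfx m) hf0
  simp only [hzero] at h
  exact zero_ne_one (tendsto_nhds_unique tendsto_const_nhds h)

end LocallyNormal

end CombBEC

theorem mainTheorem2 (d : ℕ) (hd : d = 1 ∨ d = 2) (β : ℝ) (hβ : 0 < β) (μ : ℕ → ℝ)
    (hμ_neg : ∀ n, μ n < 0) (hμ : Tendsto μ atTop (𝓝 0)) :
    IsGeneralizedPerronFrobenius (combZ d) (pfVector d) ∧
    (∃ (k' : ℕ → ℝ) (w : ℕ → L2 ℤ) (v : ℕ → Vtx d → ℂ)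
        (C : ℕ → S0 d →ₗ⋆[ℂ] S0 d →ₗ[ℂ] ℂ) (C_lim : S0 d →ₗ⋆[ℂ] S0 d →ₗ[ℂ] ℂ),
      Tendsto k' atTop atTop ∧
      (∀ (n : ℕ) (j : ℤ), (n : ℤ) < |j| → w n j = 0) ∧
      Tendsto w atTop (𝓝 (pfFiber d)) ∧
      (∀ n, v n = boxVector d n (w n)) ∧
      (∀ η : S0 d, Summable (fun x => conj (pfVector d x) * (η : L2 (Vtx d)) x) ∧
        Tendsto (fun n => pairing (v n) (η : L2 (Vtx d))) atTop
          (𝓝 (pairing (pfVector d) (η : L2 (Vtx d))))) ∧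
      (∀ n, ∀ ξ η : S0 d, gibbsTwoPoint d β (μ n) n ξ η =
        k' n * conj (pairing (v n) (η : L2 (Vtx d))) * pairing (v n) (ξ : L2 (Vtx d)) + C n η ξ) ∧
      (∀ ξ η : S0 d, Tendsto (fun n => C n η ξ) atTop (𝓝 (C_lim η ξ)))) ∧
    (∀ φ : CCR (S0 d) →ₚ[ℂ] ℂ, φ 1 = 1 →
      (∀ f : S0 d, {x | (f : L2 (Vtx d)) x ≠ 0}.Finite →
        Tendsto (fun n => gibbsWeyl d β (μ n) n f) atTop (𝓝 (φ (ccrWeyl f)))) →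
      ¬ IsLocallyNormal φ) := by
  have hd0 : 0 < d := by omega
  refine ⟨isGeneralizedPerronFrobenius_pfVector hd0, ?_,
    not_isLocallyNormal hd hβ hμ_neg hμ⟩
  obtain ⟨k', w, C, C_lim, hk, hws, hw, hG, hC⟩ :=
    exists_condensate_decomposition hd hβ hμ_neg hμ
  exact ⟨k', w, fun n => boxVector d n (w n), C, C_lim, hk, hws, hw, fun _ => rfl,
    fun η => ⟨summable_pfVector_mul η.2, tendsto_pairing_boxVector hw η.2⟩, hG, hC⟩
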